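/- For $n\ge 0$ let $B_n$ be Artin's braid group on $n$ strands, with its standard generators $\sigma_1,\dots,\sigma_{n-1}$, and let $P_n$ be the pure braid group, the kernel of $B_n\to\mathfrak S_n$, $\sigma_i\mapsto (i\ \,i+1)$. For $1\le i<j\le n$ put $A_{ij}=(\sigma_{j-1}\cdots\sigma_{i+1})\,\sigma_i^2\,(\sigma_{j-1}\cdots\sigma_{i+1})^{-1}\in P_n$. For a group $G$ with lower central series $G=\Gamma_1(G)\supseteq\Gamma_2(G)\supseteq\cdots$, let $\mathrm{Lie}(G)=\bigoplus_{i\ge1}\Gamma_i(G)/\Gamma_{i+1}(G)$ be the Lie ring whose bracket is induced by commutators $[x,y]=xyx^{-1}y^{-1}$. The Drinfeld–Kohno Lie ring is $DK_n=\mathrm{Lie}(P_n)$; let $t_{ij}\in DK_n$ be the degree-one class of $A_{ij}$. Let $F_n$ be the free group on $x_1,\dots,x_n$, let $\mathfrak L_n=\mathrm{Lie}(F_n)$ be the free Lie ring on the classes $X_i$ of the $x_i$, and let $\bar\partial_n=X_1+\cdots+X_n\in\mathfrak L_n$. The group $B_n$ acts on $F_n$ by the Artin action, for which $\sigma_i$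 sends $x_i\mapsto x_{i+1}$, $x_{i+1}\mapsto x_{i+1}^{-1}x_ix_{i+1}$ and fixes the other $x_k$; on $P_n$ this is the action by conjugation on the subgroup of $P_{n+1}$ generated by the elements $x_i=A_{i,n+1}$. It induces the Johnson morphism $\tau:DK_n\to\mathrm{Der}(\mathfrak L_n)$, which sends the class of $\beta$ to the derivation sending the class of $h$ to the class of $(\beta\cdot h)h^{-1}$. The inclusion $P_n\to P_{n+1}$ that adds a last strand and the morphism $F_n\to P_{n+1}$, $x_i\mapsto A_{i,n+1}$, induce morphisms of Lie rings $DK_n\to DK_{n+1}$ and $\mathfrak L_n\to DK_{n+1}$, by which elements of $DK_n$ and $\mathfrak L_n$ are regarded as elements of $DK_{n+1}$. Put $\bar\xi_n=\sum_{1\le i<j\le n}t_{ij}\in DK_n$. Then: 1. $\bar\xi_1=0$, and $\bar\xi_{n+1}=\bar\partial_n+\bar\xi_n$ in $DK_{n+1}$ for every $n\ge 0$; 2. for every $n\ge1$, the center of $DK_n$ is the cyclic group $\mathbb Z\cdot\bar\xi_n$, and it is infinite cyclic if $n\ge2$ (it is zero if $n=1$); 3. for every $n\ge1$, as a braid derivation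 $\bar\xi_n$ is $-\mathrm{ad}(\bar\partial_n)$, that is, $\tau(\bar\xi_n)=-\mathrm{ad}(\bar\partial_n)$ in $\mathrm{Der}(\mathfrak L_n)$. -/

import Mathlib

/-! ## The lower central series and actions that are trivial on the abelianization -/

/-- The lower central series of `G`, indexed from `0`:
`lcs G i` is `Γ_{i+1}(G)`, so `lcs G 0 = G` and `lcs G (i+1) = [lcs G i, G]`. -/
abbrev lcs (G : Type*) [Group G] (i : ℕ) : Subgroup G :=
  (⊤ : Subgroup G).lowerCentralSeries i

theorem mem_lcs_zero {G : Type*} [Group G] (x : G) : x ∈ lcs G 0 := Subgroup.mem_top x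

section LowerCentral

open scoped commutatorElement

theorem three_subgroups_mod {G : Type*} [Group G] (N H₁ H₂ H₃ : Subgroup G) [N.Normal]
    (h1 : ⁅⁅H₂, H₃⁆, H₁⁆ ≤ N) (h2 : ⁅⁅H₃, H₁⁆, H₂⁆ ≤ N) : ⁅⁅H₁, H₂⁆, H₃⁆ ≤ N := by
  have key : ∀ K : Subgroup G, K ≤ N ↔ K.map (QuotientGroup.mk' N) = ⊥ := by
    intro K
    rw [Subgroup.map_eq_bot_iff, QuotientGroup.ker_mk']
  rw [key] at h1 h2 ⊢
  simp only [Subgroup.map_commutator] at h1 h2 ⊢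
  exact Subgroup.commutator_commutator_eq_bot_of_rotate h1 h2

theorem commutator_lcs_le (G : Type*) [Group G] (i j : ℕ) :
    ⁅lcs G i, lcs G j⁆ ≤ lcs G (i + j + 1) := by
  induction i generalizing j with
  | zero =>
    rw [Subgroup.commutator_comm, Nat.zero_add]
    exact le_refl _
  | succ i ih =>
    have h : ⁅⁅lcs G i, (⊤ : Subgroup G)⁆, lcs G j⁆ ≤ lcs G (i + j + 2) := by
      apply three_subgroups_mod
      · have h1 : ⁅(⊤ : Subgroup G), lcs G j⁆ = lcs G (j + 1) := by
          rw [Subgroup.commutator_comm]; rfl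
        rw [h1, Subgroup.commutator_comm]
        exact ih (j + 1)
      · have h2 : ⁅lcs G j, lcs G i⁆ ≤ lcs G (i + j + 1) := by
          rw [Subgroup.commutator_comm]; exact ih j
        exact Subgroup.commutator_mono h2 le_rfl
    have e : i + 1 + j + 1 = i + j + 2 := by omega
    rw [e]
    exact h

theorem lcs_le {G : Type*} [Group G] {i j : ℕ} (h : i ≤ j) : lcs G j ≤ lcs G i :=
  Subgroup.lowerCentralSeries_antitone _ h

theorem lcs_commute {G : Type*} [Group G] {i j k : ℕ} {x y : G} (hx : x ∈ lcs G i)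
    (hy : y ∈ lcs G j) (h : k ≤ i + j + 1) :
    Commute (x : G ⧸ lcs G k) (y : G ⧸ lcs G k) := by
  have h1 : ⁅x, y⁆ ∈ lcs G k :=
    lcs_le h (commutator_lcs_le G i j (Subgroup.commutator_mem_commutator hx hy))
  rw [← commutatorElement_eq_one_iff_commute]
  have h2 := (QuotientGroup.eq_one_iff (N := lcs G k) ⁅x, y⁆).2 h1
  rw [← h2]
  exact (map_commutatorElement (QuotientGroup.mk' (lcs G k)) x y).symm

/-- The action `φ` of `A` on `B` induces the trivial action on `B^{ab}`. -/
def AbTrivial {A B : Type*} [Group A] [Group B] (φ : A →* MulAut B) : Prop :=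
  ∀ a b, φ a b * b⁻¹ ∈ lcs B 1

theorem abTrivial_conj (G : Type*) [Group G] : AbTrivial (MulAut.conj : G →* MulAut G) := by
  intro a b
  exact Subgroup.commutator_mem_commutator (Subgroup.mem_top a) (Subgroup.mem_top b)

theorem eq_mod_of_mul_inv_mem {G : Type*} [Group G] {N : Subgroup G} [N.Normal] {x y : G}
    (h : x * y⁻¹ ∈ N) : (x : G ⧸ N) = y := by
  have h2 := (QuotientGroup.eq_one_iff (N := N) (x * y⁻¹)).2 h
  rw [QuotientGroup.mk_mul, QuotientGroup.mk_inv] at h2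
  exact mul_inv_eq_one.1 h2

theorem mul_inv_mem_of_eq_mod {G : Type*} [Group G] {N : Subgroup G} [N.Normal] {x y : G}
    (h : (x : G ⧸ N) = y) : x * y⁻¹ ∈ N := by
  rw [← QuotientGroup.eq_one_iff, QuotientGroup.mk_mul, QuotientGroup.mk_inv, h, mul_inv_cancel]

theorem mod_lcs_eq_one {G : Type*} [Group G] {i k : ℕ} {x : G} (hx : x ∈ lcs G i) (h : k ≤ i) :
    (x : G ⧸ lcs G k) = 1 :=
  (QuotientGroup.eq_one_iff _).2 (lcs_le h hx)

theorem AbTrivial.mem_zero {A B : Type*} [Group A] [Group B] {φ : A →* MulAut B}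
    (hφ : AbTrivial φ) (a : A) (j : ℕ) : ∀ b ∈ lcs B j, φ a b * b⁻¹ ∈ lcs B (j + 1) := by
  induction j with
  | zero => intro b _; exact hφ a b
  | succ j ih =>
    let N := lcs B (j + 2)
    let f : B →* B ⧸ N := (QuotientGroup.mk' N).comp (φ a).toMonoidHom
    suffices h : lcs B (j + 1) ≤ f.eqLocus (QuotientGroup.mk' N) by
      intro b hb
      exact mul_inv_mem_of_eq_mod (h hb)
    refine Subgroup.commutator_le.2 ?_
    intro y hy z _
    change f ⁅y, z⁆ = QuotientGroup.mk' N ⁅y, z⁆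
    rw [map_commutatorElement, map_commutatorElement]
    have hu := ih y hy
    have hw := hφ a z
    set u := φ a y * y⁻¹ with hu'
    set w := φ a z * z⁻¹ with hw'
    have e1 : f y = (u : B ⧸ N) * (y : B ⧸ N) := by
      rw [← QuotientGroup.mk_mul, hu', inv_mul_cancel_right]; rfl
    have e2 : f z = (w : B ⧸ N) * (z : B ⧸ N) := by
      rw [← QuotientGroup.mk_mul, hw', inv_mul_cancel_right]; rfl
    rw [e1, e2]
    change ⁅(u : B ⧸ N) * (y : B ⧸ N), (w : B ⧸ N) * (z : B ⧸ N)⁆ = ⁅(y : B ⧸ N), (z : B ⧸ N)⁆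
    have hyz : ⁅y, z⁆ ∈ lcs B (j + 1) :=
      Subgroup.commutator_mem_commutator hy (Subgroup.mem_top z)
    have c1 : Commute (u : B ⧸ N) ⁅(y : B ⧸ N), (w : B ⧸ N) * (z : B ⧸ N)⁆ :=
      lcs_commute (G := B) (y := ⁅y, w * z⁆) (j := 0) hu (Subgroup.mem_top _) (by omega)
    have c2 : Commute (u : B ⧸ N) ((w : B ⧸ N) * (z : B ⧸ N)) :=
      lcs_commute (G := B) (y := w * z) (j := 0) hu (Subgroup.mem_top _) (by omega)
    have c3 : Commute (y : B ⧸ N) (w : B ⧸ N) := lcs_commute hy hw (by omega)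
    have c4 : Commute ⁅(y : B ⧸ N), (z : B ⧸ N)⁆ (w : B ⧸ N) :=
      lcs_commute (G := B) (x := ⁅y, z⁆) (j := 0) hyz (Subgroup.mem_top _) (by omega)
    rw [commutatorElement_mul_left_eq_conj_mul, c1.eq, mul_inv_cancel_right,
      commutatorElement_eq_one_iff_commute.2 c2, mul_one,
      commutatorElement_mul_right_eq_mul_conj, commutatorElement_eq_one_iff_commute.2 c3, one_mul,
      ← c4.eq, mul_inv_cancel_right]

/-- An action that is trivial on the abelianization is compatible with the lower central series:
`[Γ_{i+1} A, Γ_{j+1} B] ⊆ Γ_{i+j+2} B`. -/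
theorem AbTrivial.mem {A B : Type*} [Group A] [Group B] {φ : A →* MulAut B}
    (hφ : AbTrivial φ) {i j : ℕ} {a : A} {b : B} (ha : a ∈ lcs A i) (hb : b ∈ lcs B j) :
    φ a b * b⁻¹ ∈ lcs B (i + j + 1) := by
  induction i generalizing a b j with
  | zero => rw [Nat.zero_add]; exact hφ.mem_zero a j b hb
  | succ i ih =>
    let N := lcs B (i + 1 + j + 1)
    -- the elements of `A` that act trivially on `lcs B j` modulo `N`
    have hst : ∀ (x : A) (c : B), c ∈ lcs B j → φ x c ∈ lcs B j := by
      intro x c hc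
      have h1 := lcs_le (Nat.le_succ j) (hφ.mem_zero x j c hc)
      have h2 := mul_mem h1 hc
      rwa [inv_mul_cancel_right] at h2
    let S : Subgroup A :=
      { carrier := {x | ∀ c ∈ lcs B j, ((φ x c : B) : B ⧸ N) = (c : B ⧸ N)}
        one_mem' := by intro c _; simp
        mul_mem' := by
          intro x y hx hy c hc
          rw [map_mul, MulAut.mul_apply, hx _ (hst y c hc), hy c hc]
        inv_mem' := by
          intro x hx c hc
          have h := hx (φ x⁻¹ c) (hst x⁻¹ c hc)
          rw [← MulAut.mul_apply, ← map_mul, mul_inv_cancel, map_one, MulAut.one_apply] at h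
          exact h.symm }
    suffices h : lcs A (i + 1) ≤ S from mul_inv_mem_of_eq_mod (h ha b hb)
    refine Subgroup.commutator_le.2 ?_
    intro x hx y _
    have main : ∀ c ∈ lcs B j, ((φ (x * y) c : B) : B ⧸ N) = ((φ (y * x) c : B) : B ⧸ N) := by
      intro c hc
      have hu := ih hx hc
      have hv := hφ.mem_zero y j c hc
      set u := φ x c * c⁻¹ with hu'
      set v := φ y c * c⁻¹ with hv'
      have eu : φ x c = u * c := by rw [hu', inv_mul_cancel_right]
      have ev : φ y c = v * c := by rw [hv', inv_mul_cancel_right]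
      have e1 : ((φ x v : B) : B ⧸ N) = v :=
        eq_mod_of_mul_inv_mem (lcs_le (by omega) (ih hx hv))
      have e2 : ((φ y u : B) : B ⧸ N) = u :=
        eq_mod_of_mul_inv_mem (lcs_le (by omega) (hφ.mem_zero y _ u hu))
      have c1 : Commute (u : B ⧸ N) (v : B ⧸ N) := lcs_commute hu hv (by omega)
      rw [map_mul, map_mul, MulAut.mul_apply, MulAut.mul_apply, eu, ev, map_mul (φ x) v c,
        map_mul (φ y) u c, eu, ev]
      clear_value u v
      simp only [QuotientGroup.mk_mul, e1, e2]
      rw [← mul_assoc, ← mul_assoc, c1.eq]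
    intro c hc
    have h := main (φ (y * x)⁻¹ c) (hst _ c hc)
    rw [← MulAut.mul_apply, ← MulAut.mul_apply, ← map_mul, ← map_mul, mul_inv_cancel, map_one,
      MulAut.one_apply] at h
    rw [← h, commutatorElement_def, mul_inv_rev]
    simp only [mul_assoc]

end LowerCentral

/-! ## The Lie ring of a group -/

/-- The `i`-th graded piece `Γ_{i+1}(G) / Γ_{i+2}(G)`, written additively. -/
def LieGr (G : Type*) [Group G] (i : ℕ) : Type _ :=
  Additive (lcs G i ⧸ (lcs G (i + 1)).subgroupOf (lcs G i))

instance LieGr.instAddGroup (G : Type*) [Group G] (i : ℕ) : AddGroup (LieGr G i) :=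
  inferInstanceAs (AddGroup (Additive (lcs G i ⧸ (lcs G (i + 1)).subgroupOf (lcs G i))))

/-- The class of `x ∈ Γ_{i+1}(G)` in `Γ_{i+1}(G) / Γ_{i+2}(G)`. -/
def LieGr.mk {G : Type*} [Group G] (i : ℕ) (x : G) (hx : x ∈ lcs G i) : LieGr G i :=
  Additive.ofMul (QuotientGroup.mk (⟨x, hx⟩ : lcs G i))

theorem LieGr.ind {G : Type*} [Group G] {i : ℕ} {p : LieGr G i → Prop}
    (h : ∀ x hx, p (LieGr.mk i x hx)) (q : LieGr G i) : p q := by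
  have h2 : ∀ r : lcs G i ⧸ (lcs G (i + 1)).subgroupOf (lcs G i), p (Additive.ofMul r) := by
    intro r
    induction r using QuotientGroup.induction_on with
    | H z => exact h z.1 z.2
  exact h2 q.toMul

theorem LieGr.mk_mul {G : Type*} [Group G] {i : ℕ} {x y : G} (hx : x ∈ lcs G i)
    (hy : y ∈ lcs G i) :
    LieGr.mk i (x * y) (mul_mem hx hy) = LieGr.mk i x hx + LieGr.mk i y hy := rfl

theorem LieGr.mk_eq {G : Type*} [Group G] {i : ℕ} {x y : G} {hx : x ∈ lcs G i}
    {hy : y ∈ lcs G i} :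
    LieGr.mk i x hx = LieGr.mk i y hy ↔ (x : G ⧸ lcs G (i + 1)) = (y : G ⧸ lcs G (i + 1)) := by
  have h1 : LieGr.mk i x hx = LieGr.mk i y hy ↔
      (QuotientGroup.mk (⟨x, hx⟩ : lcs G i) : lcs G i ⧸ (lcs G (i + 1)).subgroupOf (lcs G i)) =
        QuotientGroup.mk (⟨y, hy⟩ : lcs G i) := Iff.rfl
  rw [h1, QuotientGroup.eq, QuotientGroup.eq]
  rfl

instance LieGr.instAddCommGroup (G : Type*) [Group G] (i : ℕ) : AddCommGroup (LieGr G i) :=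
  { LieGr.instAddGroup G i with
    add_comm := by
      intro a b
      induction a using LieGr.ind with
      | h x hx =>
      induction b using LieGr.ind with
      | h y hy =>
      rw [← LieGr.mk_mul, ← LieGr.mk_mul, LieGr.mk_eq, QuotientGroup.mk_mul, QuotientGroup.mk_mul]
      exact (lcs_commute hx hy (by omega)).eq }

/-- The associated graded abelian group `⨁ Γ_{i+1}(G) / Γ_{i+2}(G)` of the lower central series. -/
def GrLie (G : Type*) [Group G] : Type _ := DirectSum ℕ (LieGr G)

noncomputable instance GrLie.instAddCommGroup (G : Type*) [Group G] : AddCommGroup (GrLie G) :=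
  inferInstanceAs (AddCommGroup (DirectSum ℕ (LieGr G)))

/-- The inclusion of the graded piece of degree `i + 1`. -/
noncomputable def GrLie.of (G : Type*) [Group G] (i : ℕ) : LieGr G i →+ GrLie G :=
  DirectSum.of (LieGr G) i

/-- The additive map out of `GrLie G` given by additive maps out of the graded pieces. -/
noncomputable def GrLie.lift {G M : Type*} [Group G] [AddCommGroup M]
    (f : ∀ i, LieGr G i →+ M) : GrLie G →+ M :=
  DirectSum.toAddMonoid f

theorem GrLie.lift_of {G M : Type*} [Group G] [AddCommGroup M] (f : ∀ i, LieGr G i →+ M) (i : ℕ)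
    (x : LieGr G i) : GrLie.lift f (GrLie.of G i x) = f i x :=
  DirectSum.toAddMonoid_of f i x

/-- The class `x̄` of `x ∈ Γ_{i+1}(G)`, as a homogeneous element of degree `i + 1`. -/
noncomputable def GrLie.cls {G : Type*} [Group G] (i : ℕ) (x : G) (hx : x ∈ lcs G i) : GrLie G :=
  GrLie.of G i (LieGr.mk i x hx)

section GrLieBasic

variable {G : Type*} [Group G]

theorem GrLie.cls_congr {i j : ℕ} {x y : G} {hx : x ∈ lcs G i} {hy : y ∈ lcs G j} (h : i = j)
    (hxy : (x : G ⧸ lcs G (i + 1)) = (y : G ⧸ lcs G (i + 1))) :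
    GrLie.cls i x hx = GrLie.cls j y hy := by
  subst h
  exact congrArg (GrLie.of G i) (LieGr.mk_eq.2 hxy)

theorem GrLie.cls_mul {i : ℕ} {x y : G} (hx : x ∈ lcs G i) (hy : y ∈ lcs G i) :
    GrLie.cls i (x * y) (mul_mem hx hy) = GrLie.cls i x hx + GrLie.cls i y hy :=
  map_add (GrLie.of G i) (LieGr.mk i x hx) (LieGr.mk i y hy)

theorem GrLie.cls_one (i : ℕ) : GrLie.cls i (1 : G) (one_mem _) = 0 :=
  map_zero (GrLie.of G i)

theorem GrLie.induction {p : GrLie G → Prop} (h0 : p 0)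
    (h1 : ∀ i x hx, p (GrLie.cls i x hx)) (h2 : ∀ u v, p u → p v → p (u + v)) (u : GrLie G) :
    p u := by
  refine DirectSum.induction_on (β := LieGr G) (motive := p) u h0 ?_ h2
  intro i q
  induction q using LieGr.ind with
  | h x hx => exact h1 i x hx

end GrLieBasic

section Pairing

variable {A B C : Type*} [Group A] [Group B] [Group C]

theorem AbTrivial.mul_left_mod {φ : A →* MulAut B} (hφ : AbTrivial φ) {i j : ℕ} {a a' : A} {b : B}
    (ha : a ∈ lcs A i) (ha' : a' ∈ lcs A i) (hb : b ∈ lcs B j) :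
    ((φ (a * a') b * b⁻¹ : B) : B ⧸ lcs B (i + j + 1 + 1)) =
      ((φ a b * b⁻¹ * (φ a' b * b⁻¹) : B) : B ⧸ lcs B (i + j + 1 + 1)) := by
  have h1 := hφ.mem ha hb
  have h2 := hφ.mem ha' hb
  have h3 : ((φ a (φ a' b * b⁻¹) : B) : B ⧸ lcs B (i + j + 1 + 1)) = ((φ a' b * b⁻¹ : B) : B ⧸ _) :=
    eq_mod_of_mul_inv_mem (lcs_le (by omega) (hφ.mem ha h2))
  have c := lcs_commute h1 h2 (k := i + j + 1 + 1) (by omega)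
  have e : φ (a * a') b * b⁻¹ = φ a (φ a' b * b⁻¹) * (φ a b * b⁻¹) := by
    rw [map_mul, MulAut.mul_apply, ← mul_assoc, ← map_mul, inv_mul_cancel_right]
  rw [e, QuotientGroup.mk_mul, h3, ← c.eq, ← QuotientGroup.mk_mul]

theorem AbTrivial.mul_right_mod {φ : A →* MulAut B} (hφ : AbTrivial φ) {i j : ℕ} {a : A} {b b' : B}
    (ha : a ∈ lcs A i) (_hb : b ∈ lcs B j) (hb' : b' ∈ lcs B j) :
    ((φ a (b * b') * (b * b')⁻¹ : B) : B ⧸ lcs B (i + j + 1 + 1)) =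
      ((φ a b * b⁻¹ * (φ a b' * b'⁻¹) : B) : B ⧸ lcs B (i + j + 1 + 1)) := by
  have h2 := hφ.mem ha hb'
  have c := lcs_commute (j := 0) h2 (Subgroup.mem_top b) (k := i + j + 1 + 1) (by omega)
  have e : φ a (b * b') * (b * b')⁻¹ = φ a b * ((φ a b' * b'⁻¹) * b⁻¹) := by
    rw [map_mul, mul_inv_rev]; simp only [mul_assoc]
  rw [e, mul_assoc (φ a b)]
  generalize φ a b' * b'⁻¹ = z at *
  simp only [QuotientGroup.mk_mul, QuotientGroup.mk_inv]
  rw [c.inv_right.eq]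

/-- The map `(ā, b̄) ↦ \overline{(a · b) b⁻¹}` on graded pieces. -/
def LieGr.act {φ : A →* MulAut B} (hφ : AbTrivial φ) (i j : ℕ) :
    LieGr A i → LieGr B j → LieGr B (i + j + 1) :=
  Quotient.map₂ (fun a b => (⟨φ a.1 b.1 * b.1⁻¹, hφ.mem a.2 b.2⟩ : lcs B (i + j + 1))) (by
    intro a a' ha b b' hb
    replace ha : a.1⁻¹ * a'.1 ∈ lcs A (i + 1) := (QuotientGroup.leftRel_apply (s := (lcs A (i + 1)).subgroupOf _)).1 ha
    replace hb : b.1⁻¹ * b'.1 ∈ lcs B (j + 1) := (QuotientGroup.leftRel_apply (s := (lcs B (j + 1)).subgroupOf _)).1 hb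
    refine QuotientGroup.leftRel_apply.2 ?_
    change (φ a.1 b.1 * b.1⁻¹)⁻¹ * (φ a'.1 b'.1 * b'.1⁻¹) ∈ lcs B (i + j + 1 + 1)
    rw [← QuotientGroup.eq]
    obtain ⟨a, hai⟩ := a
    obtain ⟨a', hai'⟩ := a'
    obtain ⟨b, hbj⟩ := b
    obtain ⟨b', hbj'⟩ := b'
    obtain ⟨s, rfl⟩ : ∃ s, a' = a * s := ⟨a⁻¹ * a', by simp⟩
    obtain ⟨t, rfl⟩ : ∃ t, b' = b * t := ⟨b⁻¹ * b', by simp⟩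
    simp only [inv_mul_cancel_left] at ha hb
    symm
    change ((φ (a * s) (b * t) * (b * t)⁻¹ : B) : B ⧸ lcs B (i + j + 1 + 1)) =
      ((φ a b * b⁻¹ : B) : B ⧸ lcs B (i + j + 1 + 1))
    rw [hφ.mul_left_mod hai (lcs_le (Nat.le_succ i) ha) hbj', QuotientGroup.mk_mul,
      mod_lcs_eq_one (hφ.mem ha hbj') (by omega), mul_one,
      hφ.mul_right_mod hai hbj (lcs_le (Nat.le_succ j) hb), QuotientGroup.mk_mul,
      mod_lcs_eq_one (hφ.mem hai hb) (by omega), mul_one])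

theorem LieGr.act_mk {φ : A →* MulAut B} (hφ : AbTrivial φ) {i j : ℕ} {a : A} {b : B}
    (ha : a ∈ lcs A i) (hb : b ∈ lcs B j) :
    LieGr.act hφ i j (LieGr.mk i a ha) (LieGr.mk j b hb) =
      LieGr.mk (i + j + 1) (φ a b * b⁻¹) (hφ.mem ha hb) := rfl

/-- The same map, as a biadditive map. -/
def LieGr.actHom {φ : A →* MulAut B} (hφ : AbTrivial φ) (i j : ℕ) :
    LieGr A i →+ LieGr B j →+ LieGr B (i + j + 1) :=
  AddMonoidHom.mk' (fun a => AddMonoidHom.mk' (fun b => LieGr.act hφ i j a b) (by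
      intro b b'
      induction a using LieGr.ind with
      | h a ha =>
      induction b using LieGr.ind with
      | h b hb =>
      induction b' using LieGr.ind with
      | h b' hb' =>
      rw [← LieGr.mk_mul, LieGr.act_mk, LieGr.act_mk, LieGr.act_mk, ← LieGr.mk_mul, LieGr.mk_eq]
      exact hφ.mul_right_mod ha hb hb')) (by
    intro a a'
    ext b
    change LieGr.act hφ i j (a + a') b = LieGr.act hφ i j a b + LieGr.act hφ i j a' b
    induction a using LieGr.ind with
    | h a ha =>
    induction a' using LieGr.ind with
    | h a' ha' =>
    induction b using LieGr.ind with
    | h b hb =>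
    rw [← LieGr.mk_mul, LieGr.act_mk, LieGr.act_mk, LieGr.act_mk, ← LieGr.mk_mul, LieGr.mk_eq]
    exact hφ.mul_left_mod ha ha' hb)

/-- The biadditive map `GrLie A × GrLie B → GrLie B` given on homogeneous elements by
`(ā, b̄) ↦ \overline{(a · b) b⁻¹}`. -/
noncomputable def GrLie.act {φ : A →* MulAut B} (hφ : AbTrivial φ) :
    GrLie A →+ GrLie B →+ GrLie B :=
  GrLie.lift fun i => AddMonoidHom.flip (GrLie.lift fun j => AddMonoidHom.flip
    ((AddMonoidHom.compHom (GrLie.of B (i + j + 1))).comp (LieGr.actHom hφ i j)))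

theorem GrLie.act_cls {φ : A →* MulAut B} (hφ : AbTrivial φ) {i j : ℕ} {a : A} {b : B}
    (ha : a ∈ lcs A i) (hb : b ∈ lcs B j) :
    GrLie.act hφ (GrLie.cls i a ha) (GrLie.cls j b hb) =
      GrLie.cls (i + j + 1) (φ a b * b⁻¹) (hφ.mem ha hb) := by
  unfold GrLie.act GrLie.cls
  rw [GrLie.lift_of, AddMonoidHom.flip_apply, GrLie.lift_of]
  rfl

/-- The common source of the Jacobi identity, of the Leibniz rule for the Johnson morphism
and of its compatibility with brackets. -/
theorem GrLie.act_act {φ : A →* MulAut B} {ψ : A →* MulAut C} {χ : B →* MulAut C}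
    (hφ : AbTrivial φ) (hψ : AbTrivial ψ) (hχ : AbTrivial χ)
    (compat : ∀ a b c, ψ a (χ b c) = χ (φ a b) (ψ a c)) (u : GrLie A) (v : GrLie B) (w : GrLie C) :
    GrLie.act hψ u (GrLie.act hχ v w) =
      GrLie.act hχ (GrLie.act hφ u v) w + GrLie.act hχ v (GrLie.act hψ u w) := by
  induction u using GrLie.induction with
  | h0 => simp
  | h2 u u' hu hu' =>
    simp only [map_add, AddMonoidHom.add_apply, hu, hu']
    abel
  | h1 i a ha =>
  induction v using GrLie.induction with
  | h0 => simp
  | h2 v v' hv hv' =>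
    simp only [map_add, AddMonoidHom.add_apply, hv, hv']
    abel
  | h1 j b hb =>
  induction w using GrLie.induction with
  | h0 => simp
  | h2 w w' hw hw' =>
    simp only [map_add, hw, hw']
    abel
  | h1 k c hc =>
  have hx := hφ.mem ha hb
  have hu := hψ.mem ha hc
  have hv := hχ.mem hb hc
  have hwc := hχ.mem hx hc
  have hbu := hχ.mem hb hu
  have hav := hψ.mem ha hv
  rw [GrLie.act_cls hχ hb hc, GrLie.act_cls hψ ha hv, GrLie.act_cls hφ ha hb,
    GrLie.act_cls hχ hx hc, GrLie.act_cls hψ ha hc, GrLie.act_cls hχ hb hu]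
  have e1 : GrLie.cls (j + (i + k + 1) + 1) _ hbu =
      GrLie.cls (i + j + 1 + k + 1) _ (by
        have : i + j + 1 + k + 1 = j + (i + k + 1) + 1 := by omega
        rw [this]; exact hbu) := GrLie.cls_congr (by omega) rfl
  rw [e1, ← GrLie.cls_mul]
  refine GrLie.cls_congr (by omega) ?_
  have key := compat a b c
  set u := ψ a c * c⁻¹ with hu'
  set v := χ b c * c⁻¹ with hv'
  set x := φ a b * b⁻¹ with hx'
  have eu : ψ a c = u * c := by rw [hu', inv_mul_cancel_right]
  have ev : χ b c = v * c := by rw [hv', inv_mul_cancel_right]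
  have ex : φ a b = x * b := by rw [hx', inv_mul_cancel_right]
  set p := ψ a v * v⁻¹ with hp'
  set q := χ x c * c⁻¹ with hq'
  set r := χ b u * u⁻¹ with hr'
  have ep : ψ a v = p * v := by rw [hp', inv_mul_cancel_right]
  have eq : χ x c = q * c := by rw [hq', inv_mul_cancel_right]
  have er : χ b u = r * u := by rw [hr', inv_mul_cancel_right]
  clear_value u v x p q r
  rw [ev, ex, eu, map_mul, map_mul χ, MulAut.mul_apply, map_mul (χ b), er, ev, map_mul (χ x),
    map_mul (χ x), map_mul (χ x), eq, ep, eu] at key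
  have m1 : ∀ {m : ℕ} {y : C}, y ∈ lcs C m → k ≤ m → (i + k + 1 ≤ m ∨ j + k + 1 ≤ m) →
      ((χ x y : C) : C ⧸ lcs C (i + (j + k + 1) + 1 + 1)) = (y : C ⧸ _) := by
    intro m y hy _ _
    exact eq_mod_of_mul_inv_mem (lcs_le (by omega) (hχ.mem hx hy))
  have key2 := congrArg (fun z : C => (z : C ⧸ lcs C (i + (j + k + 1) + 1 + 1))) key
  simp only [QuotientGroup.mk_mul] at key2 ⊢
  rw [m1 hbu (by omega) (by omega), m1 hu (by omega) (by omega), m1 hv (by omega) (by omega)]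
    at key2
  have c1 : Commute (v : C ⧸ lcs C (i + (j + k + 1) + 1 + 1)) (u : C ⧸ _) :=
    lcs_commute hv hu (by omega)
  have c2 : Commute (v : C ⧸ lcs C (i + (j + k + 1) + 1 + 1)) (q : C ⧸ _) :=
    lcs_commute hv hwc (by omega)
  have c3 : Commute (u : C ⧸ lcs C (i + (j + k + 1) + 1 + 1)) (q : C ⧸ _) :=
    lcs_commute hu hwc (by omega)
  have c4 : Commute (r : C ⧸ lcs C (i + (j + k + 1) + 1 + 1)) (q : C ⧸ _) :=
    lcs_commute hbu hwc (by omega)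
  generalize (p : C ⧸ lcs C (i + (j + k + 1) + 1 + 1)) = P at *
  generalize (q : C ⧸ lcs C (i + (j + k + 1) + 1 + 1)) = Q at *
  generalize (r : C ⧸ lcs C (i + (j + k + 1) + 1 + 1)) = R at *
  generalize (u : C ⧸ lcs C (i + (j + k + 1) + 1 + 1)) = U at *
  generalize (v : C ⧸ lcs C (i + (j + k + 1) + 1 + 1)) = V at *
  generalize (c : C ⧸ lcs C (i + (j + k + 1) + 1 + 1)) = W at *
  have k3 : P * (V * U * W) = (Q * R) * (V * U * W) := by
    calc P * (V * U * W) = P * V * (U * W) := by simp only [mul_assoc]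
      _ = R * U * (V * (Q * W)) := key2
      _ = R * (U * (V * Q)) * W := by simp only [mul_assoc]
      _ = R * ((U * Q) * V) * W := by rw [c2.eq]; simp only [mul_assoc]
      _ = (R * Q) * (U * V) * W := by rw [c3.eq]; simp only [mul_assoc]
      _ = (Q * R) * (V * U * W) := by rw [c4.eq, c1.eq]; simp only [mul_assoc]
  exact mul_right_cancel k3

end Pairing

theorem conj_compat {G : Type*} [Group G] (a b c : G) :
    MulAut.conj a (MulAut.conj b c) = MulAut.conj (MulAut.conj a b) (MulAut.conj a c) := by
  simp only [MulAut.conj_apply, mul_assoc, inv_mul_cancel_left, mul_inv_rev, inv_inv]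

theorem GrLie.act_conj_swap {G : Type*} [Group G] (u v : GrLie G) :
    GrLie.act (abTrivial_conj G) u v + GrLie.act (abTrivial_conj G) v u = 0 := by
  induction u using GrLie.induction with
  | h0 => simp
  | h2 u u' hu hu' =>
    simp only [map_add, AddMonoidHom.add_apply]
    rw [add_add_add_comm, hu, hu', add_zero]
  | h1 i a ha =>
  induction v using GrLie.induction with
  | h0 => simp
  | h2 v v' hv hv' =>
    simp only [map_add, AddMonoidHom.add_apply]
    rw [add_add_add_comm, hv, hv', add_zero]
  | h1 j b hb =>
  have h1 := (abTrivial_conj G).mem ha hb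
  have h2 := (abTrivial_conj G).mem hb ha
  rw [GrLie.act_cls _ ha hb, GrLie.act_cls _ hb ha]
  have e1 : GrLie.cls (j + i + 1) _ h2 = GrLie.cls (i + j + 1) _ (by
        have : i + j + 1 = j + i + 1 := by omega
        rw [this]; exact h2) := GrLie.cls_congr (by omega) rfl
  rw [e1, ← GrLie.cls_mul, ← GrLie.cls_one (G := G) (i + j + 1)]
  refine GrLie.cls_congr rfl (congrArg _ ?_)
  simp only [MulAut.conj_apply, mul_assoc, inv_mul_cancel_left, mul_inv_cancel_left,
    mul_inv_cancel]

theorem GrLie.act_conj_self {G : Type*} [Group G] (u : GrLie G) :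
    GrLie.act (abTrivial_conj G) u u = 0 := by
  induction u using GrLie.induction with
  | h0 => simp
  | h2 u v hu hv =>
    simp only [map_add, AddMonoidHom.add_apply]
    rw [hu, hv, zero_add, add_zero, add_comm, GrLie.act_conj_swap]
  | h1 i a ha =>
  rw [GrLie.act_cls _ ha ha, ← GrLie.cls_one (G := G) (i + i + 1)]
  refine GrLie.cls_congr rfl (congrArg _ ?_)
  simp only [MulAut.conj_apply, mul_inv_cancel_right, mul_inv_cancel]

/-- The bracket of the Lie ring of `G` is induced by commutators:
`[ā, b̄]` is the class of `(a b a⁻¹) b⁻¹`. -/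
noncomputable instance GrLie.instLieRing (G : Type*) [Group G] : LieRing (GrLie G) where
  bracket u v := GrLie.act (abTrivial_conj G) u v
  add_lie u v w := by
    change GrLie.act (abTrivial_conj G) (u + v) w = _
    rw [map_add]; rfl
  lie_add u v w := map_add (GrLie.act (abTrivial_conj G) u) v w
  lie_self u := GrLie.act_conj_self u
  leibniz_lie u v w := GrLie.act_act _ _ _ conj_compat u v w

theorem GrLie.lie_cls {G : Type*} [Group G] {i j : ℕ} {a b : G} (ha : a ∈ lcs G i)
    (hb : b ∈ lcs G j) :
    ⁅GrLie.cls i a ha, GrLie.cls j b hb⁆ =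
      GrLie.cls (i + j + 1) (a * b * a⁻¹ * b⁻¹)
        (commutator_lcs_le G i j (Subgroup.commutator_mem_commutator ha hb)) :=
  GrLie.act_cls (abTrivial_conj G) ha hb

/-! ## Functoriality -/

section Functoriality

variable {G H : Type*} [Group G] [Group H]

theorem map_mem_lcs (f : G →* H) {i : ℕ} {x : G} (hx : x ∈ lcs G i) : f x ∈ lcs H i := by
  have h := Subgroup.mem_map_of_mem f hx
  rw [Subgroup.map_lowerCentralSeries] at h
  exact Subgroup.lowerCentralSeries_mono _ le_top h

/-- The map induced by `f : G →* H` on graded pieces. -/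
def LieGr.map (f : G →* H) (i : ℕ) : LieGr G i →+ LieGr H i :=
  MonoidHom.toAdditive (QuotientGroup.map ((lcs G (i + 1)).subgroupOf (lcs G i))
    ((lcs H (i + 1)).subgroupOf (lcs H i))
    ((f.comp (lcs G i).subtype).codRestrict (lcs H i) (fun x => map_mem_lcs f x.2))
    (fun x hx => map_mem_lcs f (i := i + 1) (x := x.1) hx))

noncomputable def GrLie.mapAdd (f : G →* H) : GrLie G →+ GrLie H :=
  DirectSum.map (LieGr.map f)

theorem GrLie.mapAdd_cls (f : G →* H) {i : ℕ} {x : G} (hx : x ∈ lcs G i) :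
    GrLie.mapAdd f (GrLie.cls i x hx) = GrLie.cls i (f x) (map_mem_lcs f hx) :=
  DirectSum.map_of (LieGr.map f) i (LieGr.mk i x hx)

/-- The morphism of Lie rings induced by a group morphism. -/
noncomputable def GrLie.map (f : G →* H) : GrLie G →ₗ⁅ℤ⁆ GrLie H :=
  { (GrLie.mapAdd f).toIntLinearMap with
    map_lie' := by
      intro u v
      change GrLie.mapAdd f ⁅u, v⁆ = ⁅GrLie.mapAdd f u, GrLie.mapAdd f v⁆
      induction u using GrLie.induction with
      | h0 => simp
      | h2 u u' hu hu' => simp only [add_lie, map_add, hu, hu']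
      | h1 i a ha =>
      induction v using GrLie.induction with
      | h0 => simp
      | h2 v v' hv hv' => simp only [lie_add, map_add, hv, hv']
      | h1 j b hb =>
      rw [GrLie.lie_cls ha hb, GrLie.mapAdd_cls, GrLie.mapAdd_cls, GrLie.mapAdd_cls,
        GrLie.lie_cls (map_mem_lcs f ha) (map_mem_lcs f hb)]
      refine GrLie.cls_congr rfl (congrArg _ ?_)
      simp only [map_mul, map_inv] }

end Functoriality

/-! ## The Johnson morphism -/

/-- The Johnson morphism of an action `φ` of `K` on `H` that is trivial on `H^{ab}`:
it sends `k̄` to the derivation `h̄ ↦ \overline{(k · h) h⁻¹}` of the Lie ring of `H`. -/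
noncomputable def johnson {K H : Type*} [Group K] [Group H] {φ : K →* MulAut H}
    (hφ : AbTrivial φ) : GrLie K →ₗ⁅ℤ⁆ LieDerivation ℤ (GrLie H) (GrLie H) where
  toFun u :=
    { (GrLie.act hφ u).toIntLinearMap with
      leibniz' := by
        intro v w
        change GrLie.act hφ u ⁅v, w⁆ = ⁅v, GrLie.act hφ u w⁆ - ⁅w, GrLie.act hφ u v⁆
        rw [← lie_skew w (GrLie.act hφ u v), sub_neg_eq_add, add_comm]
        refine GrLie.act_act hφ hφ (abTrivial_conj H) ?_ u v w
        intro a b c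
        simp only [MulAut.conj_apply, map_mul, map_inv] }
  map_add' u v := by
    ext w
    change GrLie.act hφ (u + v) w = GrLie.act hφ u w + GrLie.act hφ v w
    rw [map_add]; rfl
  map_smul' n u := by
    ext w
    change GrLie.act hφ (n • u) w = n • GrLie.act hφ u w
    rw [map_zsmul]; rfl
  map_lie' := by
    intro u v
    ext w
    rw [LieDerivation.lie_apply]
    change GrLie.act hφ ⁅u, v⁆ w =
      GrLie.act hφ u (GrLie.act hφ v w) - GrLie.act hφ v (GrLie.act hφ u w)
    rw [eq_sub_iff_add_eq]
    refine (GrLie.act_act (abTrivial_conj K) hφ hφ ?_ u v w).symm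
    intro a b c
    simp only [← MulAut.mul_apply, ← map_mul, MulAut.conj_apply, inv_mul_cancel_right]

theorem johnson_cls {K H : Type*} [Group K] [Group H] {φ : K →* MulAut H}
    (hφ : AbTrivial φ) {i j : ℕ} {k : K} {h : H} (hk : k ∈ lcs K i) (hh : h ∈ lcs H j) :
    johnson hφ (GrLie.cls i k hk) (GrLie.cls j h hh) =
      GrLie.cls (i + j + 1) (φ k h * h⁻¹) (hφ.mem hk hh) :=
  GrLie.act_cls hφ hk hh

/-! ## Braid groups -/

theorem mulAut_freeGroup_ext {X : Type*} {f g : MulAut (FreeGroup X)}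
    (h : ∀ k, f (FreeGroup.of k) = g (FreeGroup.of k)) : f = g := by
  apply MulEquiv.toMonoidHom_injective
  ext k
  exact h k

section ArtinGenerators

variable {X : Type*} [DecidableEq X]

/-- The endomorphism of the free group with `a ↦ b`, `b ↦ b⁻¹ a b` and all other generators fixed. -/
def artinEnd (a b : X) : FreeGroup X →* FreeGroup X :=
  FreeGroup.lift fun k => if k = a then FreeGroup.of b
    else if k = b then (FreeGroup.of b)⁻¹ * FreeGroup.of a * FreeGroup.of b else FreeGroup.of k

/-- The endomorphism of the free group with `b ↦ a`, `a ↦ a b a⁻¹` and all other generators fixed. -/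
def artinEndInv (a b : X) : FreeGroup X →* FreeGroup X :=
  FreeGroup.lift fun k => if k = b then FreeGroup.of a
    else if k = a then FreeGroup.of a * FreeGroup.of b * (FreeGroup.of a)⁻¹ else FreeGroup.of k

/-- The automorphism of the free group with `a ↦ b`, `b ↦ b⁻¹ a b` and all other generators
fixed. -/
def artinAut {a b : X} (hab : a ≠ b) : MulAut (FreeGroup X) :=
  MonoidHom.toMulEquiv (artinEnd a b) (artinEndInv a b)
    (by
      ext k
      by_cases h1 : k = a
      · subst h1; simp [artinEnd, artinEndInv]
      · by_cases h2 : k = b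
        · subst h2; simp [artinEnd, artinEndInv, hab, h1, mul_assoc]
        · simp [artinEnd, artinEndInv, h1, h2])
    (by
      ext k
      by_cases h1 : k = a
      · subst h1; simp [artinEnd, artinEndInv, hab, hab.symm, mul_assoc]
      · by_cases h2 : k = b
        · subst h2; simp [artinEnd, artinEndInv]
        · simp [artinEnd, artinEndInv, h1, h2])

theorem artinAut_left {a b : X} (hab : a ≠ b) :
    artinAut hab (FreeGroup.of a) = FreeGroup.of b := by
  simp [artinAut, artinEnd]

theorem artinAut_right {a b : X} (hab : a ≠ b) : artinAut hab (FreeGroup.of b) =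
    (FreeGroup.of b)⁻¹ * FreeGroup.of a * FreeGroup.of b := by
  simp [artinAut, artinEnd, hab.symm]

theorem artinAut_other {a b k : X} (hab : a ≠ b) (h1 : k ≠ a) (h2 : k ≠ b) :
    artinAut hab (FreeGroup.of k) = FreeGroup.of k := by
  simp [artinAut, artinEnd, h1, h2]

theorem artinAut_braid {a b c : X} (hab : a ≠ b) (hbc : b ≠ c) (hac : a ≠ c) :
    artinAut hab * artinAut hbc * artinAut hab = artinAut hbc * artinAut hab * artinAut hbc := by
  apply mulAut_freeGroup_ext
  intro k
  simp only [MulAut.mul_apply]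
  by_cases h1 : k = a
  · subst h1
    simp only [artinAut_left, artinAut_other hbc hab hac]
    rw [artinAut_other hab hac.symm hbc.symm]
  · by_cases h2 : k = b
    · subst h2
      simp only [artinAut_left, artinAut_right, map_mul, map_inv, artinAut_other hbc hab hac,
        artinAut_other hab hac.symm hbc.symm]
    · by_cases h3 : k = c
      · subst h3
        simp only [artinAut_left, artinAut_right, map_mul, map_inv, artinAut_other hbc hab hac,
          artinAut_other hab hac.symm hbc.symm, mul_assoc, mul_inv_rev, inv_inv,
          mul_inv_cancel_left]
      · simp only [artinAut_other hab h1 h2, artinAut_other hbc h2 h3]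

theorem artinAut_comm {a b c d : X} (hab : a ≠ b) (hcd : c ≠ d) (hac : a ≠ c) (had : a ≠ d)
    (hbc : b ≠ c) (hbd : b ≠ d) : artinAut hab * artinAut hcd = artinAut hcd * artinAut hab := by
  apply mulAut_freeGroup_ext
  intro k
  simp only [MulAut.mul_apply]
  by_cases h1 : k = a
  · subst h1
    simp only [artinAut_left, artinAut_other hcd hac had, artinAut_other hcd hbc hbd]
  by_cases h2 : k = b
  · subst h2
    simp only [artinAut_right, map_mul, map_inv, artinAut_other hcd hac had,
      artinAut_other hcd hbc hbd]
  by_cases h3 : k = c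
  · subst h3
    simp only [artinAut_left, artinAut_other hab hac.symm hbc.symm,
      artinAut_other hab had.symm hbd.symm]
  by_cases h4 : k = d
  · subst h4
    simp only [artinAut_right, map_mul, map_inv, artinAut_other hab hac.symm hbc.symm,
      artinAut_other hab had.symm hbd.symm]
  simp only [artinAut_other hab h1 h2, artinAut_other hcd h3 h4]

theorem swap_braid {a b c : X} (hab : a ≠ b) (hbc : b ≠ c) (hac : a ≠ c) :
    Equiv.swap a b * Equiv.swap b c * Equiv.swap a b =
      Equiv.swap b c * Equiv.swap a b * Equiv.swap b c := by
  have e1 := Equiv.swap_mul_swap_mul_swap (x := c) (y := b) (z := a) hbc.symm hac.symm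
  rw [Equiv.swap_comm b a, Equiv.swap_comm c b, Equiv.swap_comm a c] at e1
  rw [e1]
  exact (Equiv.swap_mul_swap_mul_swap hab hac).symm

end ArtinGenerators

/-- Artin's relations: `σ_i σ_{i+1} σ_i = σ_{i+1} σ_i σ_{i+1}`, and `σ_i σ_j = σ_j σ_i`
if `|i - j| ≥ 2`. -/
def braidRels (n : ℕ) : Set (FreeGroup (Fin (n - 1))) :=
  {r | ∃ i j : Fin (n - 1), (i : ℕ) + 1 = j ∧
    r = FreeGroup.of i * FreeGroup.of j * FreeGroup.of i *
      (FreeGroup.of j * FreeGroup.of i * FreeGroup.of j)⁻¹} ∪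
  {r | ∃ i j : Fin (n - 1), (i : ℕ) + 1 < j ∧
    r = FreeGroup.of i * FreeGroup.of j * (FreeGroup.of j * FreeGroup.of i)⁻¹}

/-- Artin's braid group on `n` strands. The strands are numbered `0, …, n - 1`. -/
abbrev BraidGroup (n : ℕ) : Type := PresentedGroup (braidRels n)

namespace BraidGroup

/-- Group morphisms out of the braid group. -/
def lift {n : ℕ} {G : Type*} [Group G] (f : Fin (n - 1) → G)
    (h1 : ∀ i j : Fin (n - 1), (i : ℕ) + 1 = j → f i * f j * f i = f j * f i * f j)
    (h2 : ∀ i j : Fin (n - 1), (i : ℕ) + 1 < j → f i * f j = f j * f i) : BraidGroup n →* G :=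
  PresentedGroup.toGroup (f := f) (by
    rintro r (⟨i, j, hij, rfl⟩ | ⟨i, j, hij, rfl⟩)
    · simp only [map_mul, map_inv, FreeGroup.lift_apply_of]
      rw [h1 i j hij, mul_inv_cancel]
    · simp only [map_mul, map_inv, FreeGroup.lift_apply_of]
      rw [h2 i j hij, mul_inv_cancel])

theorem lift_of {n : ℕ} {G : Type*} [Group G] (f : Fin (n - 1) → G)
    (h1 : ∀ i j : Fin (n - 1), (i : ℕ) + 1 = j → f i * f j * f i = f j * f i * f j)
    (h2 : ∀ i j : Fin (n - 1), (i : ℕ) + 1 < j → f i * f j = f j * f i) (i : Fin (n - 1)) :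
    lift f h1 h2 (PresentedGroup.of i) = f i := PresentedGroup.toGroup.of _

theorem of_braid {n : ℕ} {i j : Fin (n - 1)} (h : (i : ℕ) + 1 = j) :
    (PresentedGroup.of i * PresentedGroup.of j * PresentedGroup.of i : BraidGroup n) =
      PresentedGroup.of j * PresentedGroup.of i * PresentedGroup.of j :=
  PresentedGroup.mk_eq_mk_of_mul_inv_mem (Or.inl ⟨i, j, h, rfl⟩)

theorem of_comm {n : ℕ} {i j : Fin (n - 1)} (h : (i : ℕ) + 1 < j) :
    (PresentedGroup.of i * PresentedGroup.of j : BraidGroup n) =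
      PresentedGroup.of j * PresentedGroup.of i :=
  PresentedGroup.mk_eq_mk_of_mul_inv_mem (Or.inr ⟨i, j, h, rfl⟩)

/-- The first of the two strands that `σ_i` crosses. -/
def lo {n : ℕ} (i : Fin (n - 1)) : Fin n := ⟨i, by omega⟩

/-- The second of the two strands that `σ_i` crosses. -/
def hi {n : ℕ} (i : Fin (n - 1)) : Fin n := ⟨i + 1, by omega⟩

theorem lo_ne_hi {n : ℕ} (i : Fin (n - 1)) : lo i ≠ hi i := by
  intro h
  have := congrArg Fin.val h
  simp only [lo, hi] at this
  omega

/-- The permutation of a braid. -/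
def perm (n : ℕ) : BraidGroup n →* Equiv.Perm (Fin n) :=
  lift (fun i => Equiv.swap (lo i) (hi i))
    (by
      intro i j h
      have e : lo j = hi i := Fin.ext h.symm
      have h1 : hi i ≠ hi j := by rw [← e]; exact lo_ne_hi j
      have h2 : lo i ≠ hi j := by
        intro h'
        have := congrArg Fin.val h'
        simp only [lo, hi] at this
        omega
      rw [e]
      exact swap_braid (lo_ne_hi i) h1 h2)
    (by
      intro i j h
      refine (Equiv.Perm.Disjoint.commute ?_).eq
      apply Equiv.Perm.disjoint_swap_swap
      simp only [lo, hi, List.nodup_cons, List.mem_cons, Fin.mk.injEq, List.not_mem_nil]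
      simp
      omega)

/-- The Artin representation of the braid group on the free group with basis `x_0, …, x_{n-1}`:
`σ_i` sends `x_i` to `x_{i+1}`, `x_{i+1}` to `x_{i+1}⁻¹ x_i x_{i+1}`, and fixes the other `x_k`. -/
def artin (n : ℕ) : BraidGroup n →* MulAut (FreeGroup (Fin n)) :=
  lift (fun i => artinAut (lo_ne_hi i))
    (by
      intro i j h
      have e : lo j = hi i := Fin.ext h.symm
      have h1 : hi i ≠ hi j := by rw [← e]; exact lo_ne_hi j
      have h2 : lo i ≠ hi j := by
        intro h'
        have := congrArg Fin.val h'
        simp only [lo, hi] at this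
        omega
      have e2 : artinAut (lo_ne_hi j) = artinAut h1 := by congr 1
      rw [e2]
      exact artinAut_braid (lo_ne_hi i) h1 h2)
    (by
      intro i j h
      apply artinAut_comm
      all_goals
        intro h'
        have := congrArg Fin.val h'
        simp only [lo, hi] at this
        omega)

/-- The morphism that adds a strand to the right of the other ones. -/
def addStrand (n : ℕ) : BraidGroup n →* BraidGroup (n + 1) :=
  lift (fun i => PresentedGroup.of (Fin.castLE (by omega) i))
    (fun _ _ h => of_braid h) (fun _ _ h => of_comm h)

theorem perm_addStrand (n : ℕ) (β : BraidGroup n) :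
    perm (n + 1) (addStrand n β) = (perm n β).viaEmbedding Fin.castSuccEmb := by
  have h : (perm (n + 1)).comp (addStrand n) =
      (Equiv.Perm.viaEmbeddingHom Fin.castSuccEmb).comp (perm n) := by
    apply PresentedGroup.ext
    intro i
    simp only [MonoidHom.comp_apply, addStrand, perm, lift_of, Equiv.Perm.viaEmbeddingHom_apply]
    have h1 : lo (n := n + 1) (Fin.castLE (by omega) i) = Fin.castSuccEmb (lo i) := rfl
    have h2 : hi (n := n + 1) (Fin.castLE (by omega) i) = Fin.castSuccEmb (hi i) := rfl
    rw [h1, h2]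
    ext k : 1
    induction k using Fin.lastCases with
    | last =>
      rw [Equiv.Perm.viaEmbedding_apply_of_notMem, Equiv.swap_apply_of_ne_of_ne]
      · exact (Fin.castSucc_lt_last _).ne'
      · exact (Fin.castSucc_lt_last _).ne'
      · rintro ⟨k, hk⟩
        exact (Fin.castSucc_lt_last k).ne hk
    | cast k =>
      change Equiv.swap (Fin.castSuccEmb (lo i)) (Fin.castSuccEmb (hi i)) (Fin.castSuccEmb k) =
        (Equiv.swap (lo i) (hi i)).viaEmbedding Fin.castSuccEmb (Fin.castSuccEmb k)
      rw [Equiv.Perm.viaEmbedding_apply]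
      exact (Fin.castSuccEmb.injective.swap_apply _ _ _).symm ▸ rfl
  exact DFunLike.congr_fun h β

end BraidGroup

/-- The pure braid group on `n` strands. -/
abbrev PureBraid (n : ℕ) : Subgroup (BraidGroup n) := (BraidGroup.perm n).ker

namespace PureBraid

/-- The generator `σ_i` of the braid group, with the convention `σ_i = 1` if `i + 1 ≥ n`. -/
def sigma (n i : ℕ) : BraidGroup n :=
  if h : i + 1 < n then PresentedGroup.of ⟨i, by omega⟩ else 1

/-- The product `σ_{i+d} ⋯ σ_{i+1}`. -/
def sigmaProd (n i : ℕ) : ℕ → BraidGroup n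
  | 0 => 1
  | d + 1 => sigma n (i + d + 1) * sigmaProd n i d

/-- The braid `A_{ij} = (σ_{j-1} ⋯ σ_{i+1}) σ_i² (σ_{j-1} ⋯ σ_{i+1})⁻¹`, for `i < j`. -/
def genAux (n i j : ℕ) : BraidGroup n :=
  sigmaProd n i (j - i - 1) * sigma n i ^ 2 * (sigmaProd n i (j - i - 1))⁻¹

theorem genAux_mem (n i j : ℕ) : genAux n i j ∈ PureBraid n := by
  have h : sigma n i ^ 2 ∈ PureBraid n := by
    rw [MonoidHom.mem_ker, map_pow, sigma]
    split_ifs with hi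
    · rw [BraidGroup.perm, BraidGroup.lift_of, sq, Equiv.swap_mul_self]
    · rw [map_one, one_pow]
  exact (inferInstance : (PureBraid n).Normal).conj_mem _ h _

/-- The pure braid `A_{ij}`, for all `i` and `j`, with `A_{ji} = A_{ij}` and `A_{ii} = 1`. -/
def gen (n : ℕ) (i j : Fin n) : PureBraid n :=
  if i < j then ⟨genAux n i j, genAux_mem n i j⟩
  else if j < i then ⟨genAux n j i, genAux_mem n j i⟩ else 1

/-- The action of the pure braid group on the free group. -/
def artin (n : ℕ) : PureBraid n →* MulAut (FreeGroup (Fin n)) :=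
  (BraidGroup.artin n).comp (PureBraid n).subtype

/-- The morphism that adds a strand to the right of the other ones. -/
def addStrand (n : ℕ) : PureBraid n →* PureBraid (n + 1) :=
  ((BraidGroup.addStrand n).comp (PureBraid n).subtype).codRestrict (PureBraid (n + 1)) (by
    intro β
    have h : BraidGroup.perm n β.1 = 1 := β.2
    change BraidGroup.perm (n + 1) (BraidGroup.addStrand n β.1) = 1
    rw [BraidGroup.perm_addStrand, h]
    exact map_one (Equiv.Perm.viaEmbeddingHom _))

/-- The morphism from the free group to the pure braid group on one more strand,
which sends `x_i` to `A_{i,n}` (where `n` is the number of the last strand). -/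
def ofFree (n : ℕ) : FreeGroup (Fin n) →* PureBraid (n + 1) :=
  FreeGroup.lift fun i => gen (n + 1) i.castSucc (Fin.last n)

theorem abTrivial_artin (n : ℕ) : AbTrivial (artin n) := by
  let F := FreeGroup (Fin n)
  let Φ : MulAut F →* MulAut (Abelianization F) :=
    { toFun := fun e => MulEquiv.abelianizationCongr e
      map_one' := abelianizationCongr_refl
      map_mul' := fun e f => (abelianizationCongr_trans f e).symm }
  let Ψ : Equiv.Perm (Fin n) →* MulAut F :=
    { toFun := fun e => FreeGroup.freeGroupCongr e
      map_one' := FreeGroup.freeGroupCongr_refl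
      map_mul' := fun e f => (FreeGroup.freeGroupCongr_trans f e).symm }
  have h : Φ.comp (BraidGroup.artin n) = (Φ.comp Ψ).comp (BraidGroup.perm n) := by
    apply PresentedGroup.ext
    intro i
    simp only [MonoidHom.comp_apply, BraidGroup.artin, BraidGroup.perm, BraidGroup.lift_of]
    apply MulEquiv.toMonoidHom_injective
    ext k
    change Abelianization.of (artinAut (BraidGroup.lo_ne_hi i) (FreeGroup.of k)) =
      Abelianization.of (FreeGroup.of (Equiv.swap (BraidGroup.lo i) (BraidGroup.hi i) k))
    by_cases h1 : k = BraidGroup.lo i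
    · subst h1
      rw [artinAut_left, Equiv.swap_apply_left]
    by_cases h2 : k = BraidGroup.hi i
    · subst h2
      rw [artinAut_right, Equiv.swap_apply_right, map_mul, map_mul, map_inv, mul_right_comm,
        inv_mul_cancel, one_mul]
    · rw [artinAut_other _ h1 h2, Equiv.swap_apply_of_ne_of_ne h1 h2]
  intro β x
  have h2 : Φ (BraidGroup.artin n β.1) = 1 := by
    have h3 := DFunLike.congr_fun h β.1
    have h4 : BraidGroup.perm n β.1 = 1 := β.2
    simpa only [MonoidHom.comp_apply, h4, map_one] using h3
  have h5 : Abelianization.of (artin n β x) = Abelianization.of x :=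
    DFunLike.congr_fun h2 (Abelianization.of x)
  have h6 : Abelianization.of (artin n β x * x⁻¹) = 1 := by
    rw [map_mul, map_inv, h5, mul_inv_cancel]
  rw [← MonoidHom.mem_ker, Abelianization.ker_of] at h6
  exact h6

theorem sigma_braid (n i : ℕ) (h : i + 2 < n) :
    sigma n i * sigma n (i + 1) * sigma n i = sigma n (i + 1) * sigma n i * sigma n (i + 1) := by
  rw [sigma, sigma, dif_pos (by omega), dif_pos (by omega)]
  exact BraidGroup.of_braid rfl

theorem sigma_comm (n : ℕ) {i j : ℕ} (h : i + 1 < j) : Commute (sigma n i) (sigma n j) := by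
  rw [sigma, sigma]
  split_ifs
  · exact BraidGroup.of_comm h
  · exact Commute.one_right _
  · exact Commute.one_left _
  · exact Commute.one_left _

theorem genAux_succ_self (n i : ℕ) : genAux n i (i + 1) = sigma n i ^ 2 := by
  simp [genAux, sigmaProd]

theorem genAux_succ (n : ℕ) {i j : ℕ} (h : i < j) :
    genAux n i (j + 1) = sigma n j * genAux n i j * (sigma n j)⁻¹ := by
  obtain ⟨d, rfl⟩ : ∃ d, j = i + d + 1 := ⟨j - i - 1, by omega⟩
  have e1 : i + d + 1 + 1 - i - 1 = d + 1 := by omega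
  have e2 : i + d + 1 - i - 1 = d := by omega
  simp only [genAux, e1, e2, sigmaProd, mul_inv_rev, mul_assoc]

theorem sigma_comm_genAux_right (n : ℕ) {i j k : ℕ} (h1 : i < j) (h2 : j < k) :
    Commute (sigma n k) (genAux n i j) := by
  induction j, h1 using Nat.le_induction with
  | base =>
    rw [Nat.succ_eq_add_one, genAux_succ_self]
    exact ((sigma_comm n h2).symm).pow_right 2
  | succ j hj ih =>
    rw [genAux_succ n hj]
    have c := (sigma_comm n (i := j) (j := k) h2).symm
    exact (c.mul_right (ih (by omega))).mul_right c.inv_right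

/-- The action of `σ_i` by conjugation on the `A_{k,m}` is given by the formulas of the Artin
representation. -/
theorem sigma_conj_genAux (n : ℕ) {i m : ℕ} (hm : i + 2 ≤ m) (hn : m < n) :
    sigma n i * genAux n i m * (sigma n i)⁻¹ = genAux n (i + 1) m ∧
    sigma n i * genAux n (i + 1) m * (sigma n i)⁻¹ =
      (genAux n (i + 1) m)⁻¹ * genAux n i m * genAux n (i + 1) m ∧
    ∀ k < m, k ≠ i → k ≠ i + 1 → sigma n i * genAux n k m * (sigma n i)⁻¹ = genAux n k m := by
  induction m, hm using Nat.le_induction with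
  | base =>
    have hb := sigma_braid n i hn
    rw [genAux_succ n (Nat.lt_succ_self i), genAux_succ_self, genAux_succ_self]
    refine ⟨?_, ?_, ?_⟩
    · generalize sigma n i = s at *
      generalize sigma n (i + 1) = t at *
      rw [mul_inv_eq_iff_eq_mul]
      calc s * (t * s ^ 2 * t⁻¹) = (s * t * s) * s * t⁻¹ := by simp only [sq, mul_assoc]
        _ = (t * s * t) * s * t⁻¹ := by rw [hb]
        _ = t * (s * t * s) * t⁻¹ := by simp only [mul_assoc]
        _ = t ^ 2 * s := by rw [hb]; simp only [sq, mul_assoc, mul_inv_cancel, mul_one]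
    · generalize sigma n i = s at *
      generalize sigma n (i + 1) = t at *
      have h1 : t * s * t ^ 2 = s ^ 2 * t * s := by
        calc t * s * t ^ 2 = (t * s * t) * t := by simp only [sq, mul_assoc]
          _ = s * (t * s * t) := by rw [← hb]; simp only [mul_assoc, ← hb]
          _ = s ^ 2 * t * s := by rw [← hb]; simp only [sq, mul_assoc]
      have h2 : s * t ^ 2 * s⁻¹ = t⁻¹ * s ^ 2 * t := by
        rw [mul_inv_eq_iff_eq_mul, mul_assoc t⁻¹, mul_assoc t⁻¹, eq_inv_mul_iff_mul_eq,
          ← mul_assoc, h1]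
      rw [h2]
      group
    · intro k hk h1 h2
      have hki : k < i := by omega
      have c := sigma_comm_genAux_right n hki (Nat.lt_succ_self i)
      rw [genAux_succ n (show k < i + 1 by omega), genAux_succ n hki]
      rw [Nat.succ_eq_add_one] at c
      generalize sigma n i = s at *
      generalize sigma n (i + 1) = t at *
      generalize genAux n k i = g at *
      calc s * (t * (s * g * s⁻¹) * t⁻¹) * s⁻¹ = (s * t * s) * g * (s * t * s)⁻¹ := by
            simp only [mul_inv_rev, mul_assoc]
        _ = t * s * (t * g * t⁻¹) * s⁻¹ * t⁻¹ := by
            rw [hb]; simp only [mul_inv_rev, mul_assoc]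
        _ = t * (s * g * s⁻¹) * t⁻¹ := by
            rw [c.eq, mul_inv_cancel_right]; simp only [mul_assoc]
  | succ m hm ih =>
    obtain ⟨ih1, ih2, ih3⟩ := ih (by omega)
    have c : Commute (sigma n i) (sigma n m) := sigma_comm n (by omega)
    have key : ∀ g : BraidGroup n, sigma n i * (sigma n m * g * (sigma n m)⁻¹) * (sigma n i)⁻¹ =
        sigma n m * (sigma n i * g * (sigma n i)⁻¹) * (sigma n m)⁻¹ := by
      intro g
      have c' := c.inv_inv
      simp only [← mul_assoc]
      rw [c.eq]
      simp only [mul_assoc]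
      rw [c'.eq]
    rw [genAux_succ n (show i < m by omega), genAux_succ n (show i + 1 < m by omega)]
    refine ⟨?_, ?_, ?_⟩
    · rw [key, ih1]
    · rw [key, ih2]
      simp only [mul_assoc, mul_inv_rev, inv_inv, inv_mul_cancel_left]
    · intro k hk h1 h2
      rcases Nat.lt_succ_iff_lt_or_eq.1 hk with hk | rfl
      · rw [genAux_succ n hk, key, ih3 k hk h1 h2]
      · rw [genAux_succ_self, (c.pow_right 2).eq, mul_inv_cancel_right]

theorem coe_ofFree_of (n : ℕ) (i : Fin n) :
    ((ofFree n (FreeGroup.of i) : PureBraid (n + 1)) : BraidGroup (n + 1)) =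
      genAux (n + 1) i n := by
  rw [ofFree, FreeGroup.lift_apply_of, gen, if_pos (Fin.castSucc_lt_last i)]
  rfl

/-- The Artin action is the action by conjugation in the pure braid group on one more strand. -/
theorem addStrand_conj_ofFree (n : ℕ) (β : PureBraid n) (x : FreeGroup (Fin n)) :
    addStrand n β * ofFree n x * (addStrand n β)⁻¹ = ofFree n (artin n β x) := by
  let f : FreeGroup (Fin n) →* BraidGroup (n + 1) := (PureBraid (n + 1)).subtype.comp (ofFree n)
  let S : Subgroup (BraidGroup n) :=
    { carrier := {γ | ∀ x, BraidGroup.addStrand n γ * f x * (BraidGroup.addStrand n γ)⁻¹ =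
        f (BraidGroup.artin n γ x)}
      one_mem' := by intro x; simp
      mul_mem' := by
        intro γ δ hγ hδ x
        rw [map_mul (BraidGroup.artin n), MulAut.mul_apply, ← hγ, ← hδ]
        simp only [map_mul, mul_inv_rev, mul_assoc]
      inv_mem' := by
        intro γ hγ x
        have h := hγ (BraidGroup.artin n γ⁻¹ x)
        rw [← MulAut.mul_apply, ← map_mul, mul_inv_cancel, map_one, MulAut.one_apply] at h
        rw [← h, map_inv]
        simp only [mul_assoc, inv_inv, inv_mul_cancel_left, inv_mul_cancel, mul_one] }
  have hS : ∀ γ, γ ∈ S := by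
    refine PresentedGroup.generated_by _ S ?_
    intro i
    have hi := i.2
    have e1 : BraidGroup.addStrand n (PresentedGroup.of i) = sigma (n + 1) i := by
      rw [BraidGroup.addStrand, BraidGroup.lift_of, sigma, dif_pos (by omega)]
      rfl
    have e2 : BraidGroup.artin n (PresentedGroup.of i) = artinAut (BraidGroup.lo_ne_hi i) := by
      rw [BraidGroup.artin, BraidGroup.lift_of]
    obtain ⟨h1, h2, h3⟩ := sigma_conj_genAux (n + 1) (i := i) (m := n) (by omega) (by omega)
    have hf : ∀ k : Fin n, f (FreeGroup.of k) = genAux (n + 1) k n := coe_ofFree_of n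
    have h : (MulAut.conj (sigma (n + 1) i)).toMonoidHom.comp f =
        f.comp (artinAut (BraidGroup.lo_ne_hi i)).toMonoidHom := by
      ext k
      change sigma (n + 1) i * f (FreeGroup.of k) * (sigma (n + 1) i)⁻¹ =
        f (artinAut (BraidGroup.lo_ne_hi i) (FreeGroup.of k))
      by_cases k1 : k = BraidGroup.lo i
      · subst k1
        rw [artinAut_left, hf, hf]
        exact h1
      by_cases k2 : k = BraidGroup.hi i
      · subst k2
        rw [artinAut_right, map_mul, map_mul, map_inv, hf, hf]
        exact h2
      · rw [artinAut_other _ k1 k2, hf]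
        refine h3 k k.2 (fun h => k1 (Fin.ext h)) (fun h => k2 (Fin.ext h))
    intro x
    rw [e1, e2]
    exact DFunLike.congr_fun h x
  exact Subtype.ext (hS β.1 x)

end PureBraid

/-! ## The Drinfeld–Kohno Lie ring -/

/-- The Drinfeld–Kohno Lie ring `DK_n`: the Lie ring of the pure braid group. -/
abbrev DrinfeldKohno (n : ℕ) : Type := GrLie (PureBraid n)

/-- The free Lie ring on `n` generators, as the Lie ring of the free group. -/
abbrev FreeLieRing (n : ℕ) : Type := GrLie (FreeGroup (Fin n))

namespace DrinfeldKohno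

/-- The class `t_{ij}` of `A_{ij}`, of degree `1`. -/
noncomputable def t (n : ℕ) (i j : Fin n) : DrinfeldKohno n :=
  GrLie.cls 0 (PureBraid.gen n i j) (mem_lcs_zero _)

/-- The generator `X_i` of the free Lie ring: the class of `x_i`. -/
noncomputable def X (n : ℕ) (i : Fin n) : FreeLieRing n :=
  GrLie.cls 0 (FreeGroup.of i) (mem_lcs_zero _)

/-- The boundary element `X_1 + ⋯ + X_n`. -/
noncomputable def boundary (n : ℕ) : FreeLieRing n := ∑ i, X n i

/-- `∑_{i < j} t_{ij}`. -/
noncomputable def xi (n : ℕ) : DrinfeldKohno n :=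
  ∑ p : Fin n × Fin n with p.1 < p.2, t n p.1 p.2

/-- `DK_n → DK_{n+1}`, induced by adding a strand. -/
noncomputable def addStrand (n : ℕ) : DrinfeldKohno n →ₗ⁅ℤ⁆ DrinfeldKohno (n + 1) :=
  GrLie.map (PureBraid.addStrand n)

/-- The morphism from the free Lie ring to `DK_{n+1}` with `X_i ↦ t_{i,n+1}`. -/
noncomputable def ofFree (n : ℕ) : FreeLieRing n →ₗ⁅ℤ⁆ DrinfeldKohno (n + 1) :=
  GrLie.map (PureBraid.ofFree n)

/-- The Johnson morphism `τ : DK_n → Der(𝔏_n)` of the Artin action. -/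
noncomputable def tau (n : ℕ) :
    DrinfeldKohno n →ₗ⁅ℤ⁆ LieDerivation ℤ (FreeLieRing n) (FreeLieRing n) :=
  johnson (PureBraid.abTrivial_artin n)

end DrinfeldKohno

/-! ## Almost direct products -/

section AlmostDirect

open scoped commutatorElement

/-! The pure braid group splits as P_{n+1} = F_n ⋊ P_n, where P_n acts on F_n by the Artin action,
hence trivially on F_n^{ab}. For such an almost direct product the lower central series splits as
well, factor by factor (`lcs_le_prodLcs`). So DK_{n+1} is the semidirect product of 𝔏_n and DK_n,
with DK_n acting on 𝔏_n through τ.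

On generators, τ(t_ij) sends X_i to -[X_j, X_i], X_j to -[X_i, X_j] and the other X_k to 0
(`tau_t`). Summing over the pairs gives τ(ξ_n) = -ad(∂_n). Moreover τ(u)(∂_n) = 0 for every u, since
braids fix the product x_1⋯x_n (`tau_boundary`). Now bracket ξ_{n+1} = ∂_n + ξ_n with w in 𝔏_n: the
result is [∂_n, w] - [∂_n, w] = 0. With u in DK_n it is -τ(u)(∂_n) + [ξ_n, u], which is 0 by
induction. So ξ_n is central (`xi_lie`). Conversely, a central z of DK_{n+1} projects to a central
element kξ_n of DK_n. Then z - kξ_{n+1} lies in 𝔏_n and commutes with 𝔏_n. It vanishes if n ≥ 2,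
because 𝔏_n then has trivial center; if n = 1 it is a multiple of X_1 = ξ_2. The exponent sum of
braids, equal to 2 on each A_ij, shows that ξ_n has infinite order for n ≥ 2.

Two classical inputs carry the rest. For the splitting, B_{n+1} is made to act on {0,…,n} × (F_n ⋊
B_n) by the formulas for left multiplication on cosets; the orbit of a base point shows that F_n ⋊
B_n → B_{n+1} is injective (`prodHom_injective`) and that its image contains P_{n+1}
(`exists_prodHom_eq`). For the center of 𝔏_n, the Magnus expansion compares it with noncommutative
polynomials, where only constants commute with two distinct generators. Nothing is lost in the
comparison because the free Lie algebra embeds, degree by degree, in the free associative algebra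
(`eq_zero_of_lieToAssoc_eq_zero`); this is proved by Lazard elimination of one generator at a time.
-/

theorem commute_mk_of_commutator_mem {G : Type*} [Group G] {N : Subgroup G} [N.Normal] {x y : G}
    (h : ⁅x, y⁆ ∈ N) : Commute (x : G ⧸ N) (y : G ⧸ N) := by
  rw [← commutatorElement_eq_one_iff_commute]
  have h2 := (QuotientGroup.eq_one_iff (N := N) ⁅x, y⁆).2 h
  rw [← h2]
  exact (map_commutatorElement (QuotientGroup.mk' N) x y).symm

variable {A K G : Type*} [Group A] [Group K] [Group G] {i : A →* G} {s : K →* G} {p : G →* K}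
  {φ : K →* MulAut A}

/-- The subgroup `Γ_{j+1}(A) ⋊ Γ_{j+1}(K)` of `A ⋊ K`. -/
def prodLcs (h : ∀ k a, s k * i a * (s k)⁻¹ = i (φ k a)) (j : ℕ) : Subgroup G where
  carrier := {g | ∃ a ∈ lcs A j, ∃ k ∈ lcs K j, g = i a * s k}
  one_mem' := ⟨1, one_mem _, 1, one_mem _, by simp⟩
  mul_mem' := by
    rintro _ _ ⟨a, ha, k, hk, rfl⟩ ⟨a', ha', k', hk', rfl⟩
    refine ⟨a * φ k a', mul_mem ha (map_mem_lcs (φ k).toMonoidHom ha'), k * k', mul_mem hk hk', ?_⟩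
    rw [map_mul, ← h, map_mul]
    simp only [mul_assoc, inv_mul_cancel_left]
  inv_mem' := by
    rintro _ ⟨a, ha, k, hk, rfl⟩
    refine ⟨φ k⁻¹ a⁻¹, map_mem_lcs (φ k⁻¹).toMonoidHom (inv_mem ha), k⁻¹, inv_mem hk, ?_⟩
    rw [← h]
    simp

/-- Conjugation by `s k'` preserves both factors. Conjugation by `i a'` leaves `k` unchanged and
multiplies the `A`-part by an error term, the inverse of `φ k a' * a'⁻¹`; this lies deep enough in
`A` because the action is trivial on the abelianization. -/
theorem prodLcs_normal (hφ : AbTrivial φ) (h : ∀ k a, s k * i a * (s k)⁻¹ = i (φ k a))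
    (hg : ∀ g, ∃ a k, g = i a * s k) (j : ℕ) : (prodLcs h j).Normal where
  conj_mem := by
    rintro _ ⟨a, ha, k, hk, rfl⟩ g
    have hs : ∀ k', s k' * (i a * s k) * (s k')⁻¹ ∈ prodLcs h j := by
      intro k'
      refine ⟨φ k' a, map_mem_lcs (φ k').toMonoidHom ha, k' * k * k'⁻¹,
        Subgroup.Normal.conj_mem inferInstance k hk k', ?_⟩
      rw [← h]
      simp [mul_assoc]
    have hi : ∀ x ∈ prodLcs h j, ∀ a', i a' * x * (i a')⁻¹ ∈ prodLcs h j := by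
      rintro _ ⟨a, ha, k, hk, rfl⟩ a'
      have h1 := inv_mem (hφ.mem hk (mem_lcs_zero a'))
      refine ⟨a' * a * (φ k a')⁻¹, ?_, k, hk, ?_⟩
      · have e : a' * a * (φ k a')⁻¹ = (a' * a * a'⁻¹) * (φ k a' * a'⁻¹)⁻¹ := by group
        rw [e]
        exact mul_mem (Subgroup.Normal.conj_mem inferInstance a ha a') (lcs_le (by omega) h1)
      · simp only [map_mul, map_inv, ← h, mul_inv_rev, inv_inv, mul_assoc, inv_mul_cancel,
          mul_one]
    obtain ⟨a', k', rfl⟩ := hg g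
    have e : i a' * s k' * (i a * s k) * (i a' * s k')⁻¹ =
        i a' * (s k' * (i a * s k) * (s k')⁻¹) * (i a')⁻¹ := by group
    rw [e]
    exact hi _ (hs k') a'

/-- The Falk–Randell argument. Modulo the normal subgroup `prodLcs h (j + 1)`, both factors of `i a
* s k` commute with both factors of `i a' * s k'`. Commutators inside `A` or inside `K` fall in the
next term, and mixed ones do so because they equal `i (φ k a * a⁻¹)`, up to inversion. -/
theorem lcs_le_prodLcs (hφ : AbTrivial φ) (h : ∀ k a, s k * i a * (s k)⁻¹ = i (φ k a))
    (hg : ∀ g, ∃ a k, g = i a * s k) (j : ℕ) : lcs G j ≤ prodLcs h j := by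
  induction j with
  | zero =>
    intro g _
    obtain ⟨a, k, rfl⟩ := hg g
    exact ⟨a, mem_lcs_zero _, k, mem_lcs_zero _, rfl⟩
  | succ j ih =>
    have hN := prodLcs_normal hφ h hg (j + 1)
    refine Subgroup.commutator_le.2 ?_
    intro x hx y _
    obtain ⟨a, ha, k, hk, rfl⟩ := ih hx
    obtain ⟨a', k', rfl⟩ := hg y
    have mi : ∀ b ∈ lcs A (j + 1), i b ∈ prodLcs h (j + 1) :=
      fun b hb => ⟨b, hb, 1, one_mem _, by simp⟩
    have ms : ∀ b ∈ lcs K (j + 1), s b ∈ prodLcs h (j + 1) :=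
      fun b hb => ⟨1, one_mem _, b, hb, by simp⟩
    have hks : ∀ k a, ⁅s k, i a⁆ = i (φ k a * a⁻¹) := by
      intro k a
      rw [map_mul, ← h, map_inv, commutatorElement_def]
    have c1 : Commute ((i a : G) : G ⧸ prodLcs h (j + 1)) ((i a' : G) : G ⧸ prodLcs h (j + 1)) := by
      apply commute_mk_of_commutator_mem
      rw [← map_commutatorElement]
      exact mi _ (Subgroup.commutator_mem_commutator ha (Subgroup.mem_top a'))
    have c2 : Commute ((s k : G) : G ⧸ prodLcs h (j + 1)) ((s k' : G) : G ⧸ prodLcs h (j + 1)) := by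
      apply commute_mk_of_commutator_mem
      rw [← map_commutatorElement]
      exact ms _ (Subgroup.commutator_mem_commutator hk (Subgroup.mem_top k'))
    have c3 : Commute ((s k : G) : G ⧸ prodLcs h (j + 1)) ((i a' : G) : G ⧸ prodLcs h (j + 1)) := by
      apply commute_mk_of_commutator_mem
      rw [hks]
      exact mi _ (lcs_le (by omega) (hφ.mem hk (mem_lcs_zero a')))
    have c4 : Commute ((s k' : G) : G ⧸ prodLcs h (j + 1)) ((i a : G) : G ⧸ prodLcs h (j + 1)) := by
      apply commute_mk_of_commutator_mem
      rw [hks]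
      exact mi _ (hφ.mem_zero k' j a ha)
    have c : Commute ((i a * s k : G) : G ⧸ prodLcs h (j + 1))
        ((i a' * s k' : G) : G ⧸ prodLcs h (j + 1)) := by
      rw [QuotientGroup.mk_mul, QuotientGroup.mk_mul]
      exact (c1.mul_right c4.symm).mul_left (c3.mul_right c2)
    rw [← commutatorElement_eq_one_iff_commute] at c
    rw [← QuotientGroup.eq_one_iff (N := prodLcs h (j + 1)), ← c]
    exact map_commutatorElement (QuotientGroup.mk' (prodLcs h (j + 1))) _ _

/-! ### The Lie ring of an almost direct product. -/

theorem GrLie.map_cls {G H : Type*} [Group G] [Group H] (f : G →* H) {j : ℕ} {x : G}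
    (hx : x ∈ lcs G j) : GrLie.map f (GrLie.cls j x hx) = GrLie.cls j (f x) (map_mem_lcs f hx) :=
  GrLie.mapAdd_cls f hx

theorem LieGr.mk_eq_zero {G : Type*} [Group G] {j : ℕ} {x : G} {hx : x ∈ lcs G j} :
    LieGr.mk j x hx = 0 ↔ x ∈ lcs G (j + 1) := by
  have e : (0 : LieGr G j) = LieGr.mk j 1 (one_mem _) := rfl
  rw [e, LieGr.mk_eq, QuotientGroup.mk_one, QuotientGroup.eq_one_iff]

theorem GrLie.map_map {G H J : Type*} [Group G] [Group H] [Group J] (f : G →* H) (g : H →* J)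
    (z : GrLie G) : GrLie.map g (GrLie.map f z) = GrLie.map (g.comp f) z := by
  induction z using GrLie.induction with
  | h0 => simp
  | h1 j x hx => simp only [GrLie.map_cls]; rfl
  | h2 u v hu hv => simp only [map_add, hu, hv]

/-- If `i a` is in the next term for `G`, it factors as `i a' * s k` with `a'` and `k` in the next
terms for `A` and `K`. Applying `p` gives `k = 1`, hence `a = a'`. -/
theorem GrLie.map_injective_of_almostDirect (hφ : AbTrivial φ)
    (h : ∀ k a, s k * i a * (s k)⁻¹ = i (φ k a)) (hg : ∀ g, ∃ a k, g = i a * s k)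
    (hi : Function.Injective i) (hpi : ∀ a, p (i a) = 1) (hps : ∀ k, p (s k) = k) :
    Function.Injective (GrLie.map i) := by
  change Function.Injective (DirectSum.map (LieGr.map i))
  rw [DirectSum.map_injective]
  intro j
  rw [injective_iff_map_eq_zero]
  intro q
  induction q using LieGr.ind with
  | h a ha =>
  intro hq
  replace hq : LieGr.mk j (i a) (map_mem_lcs i ha) = 0 := hq
  rw [LieGr.mk_eq_zero] at hq ⊢
  obtain ⟨a', ha', k, hk, e⟩ := lcs_le_prodLcs hφ h hg _ hq
  have hk1 : k = 1 := by
    have e2 := congrArg p e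
    rw [map_mul, hpi, hpi, hps, one_mul] at e2
    exact e2.symm
  rw [hk1, map_one, mul_one] at e
  rwa [hi e]

/-- An element of a term of the series of `G` has both its `A`-part and its `K`-part in the same
term, so its class is the sum of their classes. In particular the kernel of `GrLie.map p` is
contained in the image of `GrLie A`. -/
theorem GrLie.exists_eq_add_of_almostDirect (hφ : AbTrivial φ)
    (h : ∀ k a, s k * i a * (s k)⁻¹ = i (φ k a)) (hg : ∀ g, ∃ a k, g = i a * s k)
    (hpi : ∀ a, p (i a) = 1) (hps : ∀ k, p (s k) = k) (z : GrLie G) :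
    ∃ w, z = GrLie.map i w + GrLie.map s (GrLie.map p z) := by
  induction z using GrLie.induction with
  | h0 => exact ⟨0, by simp⟩
  | h1 j x hx =>
    obtain ⟨a, ha, k, hk, rfl⟩ := lcs_le_prodLcs hφ h hg _ hx
    refine ⟨GrLie.cls j a ha, ?_⟩
    have e : p (i a * s k) = k := by rw [map_mul, hpi, hps, one_mul]
    rw [GrLie.map_cls, GrLie.map_cls, GrLie.map_cls, ← GrLie.cls_mul]
    refine GrLie.cls_congr rfl (congrArg _ ?_)
    rw [e]
  | h2 u v hu hv =>
    obtain ⟨w, hw⟩ := hu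
    obtain ⟨w', hw'⟩ := hv
    refine ⟨w + w', ?_⟩
    simp only [map_add]
    nth_rewrite 1 [hw, hw']
    abel

/-- The commutator of `s k` and `i a` in `G` is the image of `φ k a * a⁻¹`, the very element that
defines the Johnson derivation. -/
theorem GrLie.lie_map_map_of_almostDirect (hφ : AbTrivial φ)
    (h : ∀ k a, s k * i a * (s k)⁻¹ = i (φ k a)) (u : GrLie K) (v : GrLie A) :
    ⁅GrLie.map s u, GrLie.map i v⁆ = GrLie.map i (johnson hφ u v) := by
  induction u using GrLie.induction with
  | h0 => simp
  | h2 u u' hu hu' => simp only [map_add, add_lie, hu, hu', LieDerivation.add_apply]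
  | h1 j k hk =>
  induction v using GrLie.induction with
  | h0 => simp
  | h2 v v' hv hv' => simp only [map_add, lie_add, hv, hv']
  | h1 l a ha =>
  rw [johnson_cls hφ hk ha, GrLie.map_cls, GrLie.map_cls, GrLie.map_cls, GrLie.lie_cls]
  refine GrLie.cls_congr rfl (congrArg _ ?_)
  rw [h, map_mul, map_inv]

end AlmostDirect

/-! ## The decomposition of the pure braid group -/

namespace PureBraid

theorem artin_sigma_left {n i : ℕ} (h : i + 1 < n) :
    BraidGroup.artin n (sigma n i) (FreeGroup.of ⟨i, by omega⟩) = FreeGroup.of ⟨i + 1, h⟩ := by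
  rw [sigma, dif_pos h, BraidGroup.artin, BraidGroup.lift_of]
  exact artinAut_left (BraidGroup.lo_ne_hi (⟨i, by omega⟩ : Fin (n - 1)))

theorem artin_sigma_right {n i : ℕ} (h : i + 1 < n) :
    BraidGroup.artin n (sigma n i) (FreeGroup.of ⟨i + 1, h⟩) =
      (FreeGroup.of ⟨i + 1, h⟩)⁻¹ * FreeGroup.of ⟨i, by omega⟩ * FreeGroup.of ⟨i + 1, h⟩ := by
  rw [sigma, dif_pos h, BraidGroup.artin, BraidGroup.lift_of]
  exact artinAut_right (BraidGroup.lo_ne_hi (⟨i, by omega⟩ : Fin (n - 1)))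

theorem artin_sigma_other {n i : ℕ} (k : Fin n) (h1 : (k : ℕ) ≠ i) (h2 : (k : ℕ) ≠ i + 1) :
    BraidGroup.artin n (sigma n i) (FreeGroup.of k) = FreeGroup.of k := by
  rw [sigma]
  split_ifs with h
  · rw [BraidGroup.artin, BraidGroup.lift_of]
    exact artinAut_other _ (fun e => h1 (congrArg Fin.val e)) (fun e => h2 (congrArg Fin.val e))
  · rw [map_one, MulAut.one_apply]

/-- The morphism `F_n → B_{n+1}` with `x_i ↦ A_{i,n}`. -/
def freeHom (n : ℕ) : FreeGroup (Fin n) →* BraidGroup (n + 1) :=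
  (PureBraid (n + 1)).subtype.comp (ofFree n)

theorem freeHom_of (n : ℕ) (i : Fin n) : freeHom n (FreeGroup.of i) = genAux (n + 1) i n :=
  coe_ofFree_of n i

theorem addStrand_sigma {n i : ℕ} (h : i + 1 < n) :
    BraidGroup.addStrand n (sigma n i) = sigma (n + 1) i := by
  rw [sigma, dif_pos h, BraidGroup.addStrand, BraidGroup.lift_of, sigma, dif_pos (by omega)]
  rfl

theorem braid_induction {n : ℕ} (S : Subgroup (BraidGroup n))
    (h : ∀ i, i + 1 < n → sigma n i ∈ S) (β : BraidGroup n) : β ∈ S := by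
  refine PresentedGroup.generated_by _ S ?_ β
  intro i
  have h1 := h i (by omega)
  rwa [sigma, dif_pos (by omega)] at h1

/-- The version of `addStrand_conj_ofFree` for all braids: coset arguments are simpler for F_n ⋊
B_n, which has only n + 1 cosets in B_{n+1}, than for F_n ⋊ P_n. -/
theorem addStrand_conj_freeHom (n : ℕ) (γ : BraidGroup n) (x : FreeGroup (Fin n)) :
    BraidGroup.addStrand n γ * freeHom n x * (BraidGroup.addStrand n γ)⁻¹ =
      freeHom n (BraidGroup.artin n γ x) := by
  let S : Subgroup (BraidGroup n) :=
    { carrier := {γ | ∀ x, BraidGroup.addStrand n γ * freeHom n x *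
        (BraidGroup.addStrand n γ)⁻¹ = freeHom n (BraidGroup.artin n γ x)}
      one_mem' := by intro x; simp
      mul_mem' := by
        intro γ δ hγ hδ x
        rw [map_mul (BraidGroup.artin n), MulAut.mul_apply, ← hγ, ← hδ]
        simp only [map_mul, mul_inv_rev, mul_assoc]
      inv_mem' := by
        intro γ hγ x
        have h := hγ (BraidGroup.artin n γ⁻¹ x)
        rw [← MulAut.mul_apply, ← map_mul, mul_inv_cancel, map_one, MulAut.one_apply] at h
        rw [← h, map_inv]
        simp only [mul_assoc, inv_inv, inv_mul_cancel_left, inv_mul_cancel, mul_one] }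
  refine braid_induction S ?_ γ x
  intro i hi
  obtain ⟨h1, h2, h3⟩ := sigma_conj_genAux (n + 1) (i := i) (m := n) (by omega) (by omega)
  have h : (MulAut.conj (sigma (n + 1) i)).toMonoidHom.comp (freeHom n) =
      (freeHom n).comp (BraidGroup.artin n (sigma n i)).toMonoidHom := by
    ext k
    change sigma (n + 1) i * freeHom n (FreeGroup.of k) * (sigma (n + 1) i)⁻¹ =
      freeHom n (BraidGroup.artin n (sigma n i) (FreeGroup.of k))
    by_cases k1 : (k : ℕ) = i
    · subst k1
      rw [artin_sigma_left hi, freeHom_of, freeHom_of]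
      exact h1
    by_cases k2 : (k : ℕ) = i + 1
    · obtain ⟨k, hk⟩ := k
      obtain rfl : k = i + 1 := k2
      rw [artin_sigma_right hi, map_mul, map_mul, map_inv, freeHom_of, freeHom_of]
      exact h2
    · rw [artin_sigma_other k k1 k2, freeHom_of]
      exact h3 k k.2 k1 k2
  intro x
  rw [addStrand_sigma hi]
  exact DFunLike.congr_fun h x

/-! ### The semidirect product F_n ⋊ B_n and its relations. -/

/-- The semidirect product `F_n ⋊ B_n` for the Artin action. -/
abbrev ArtinProd (n : ℕ) : Type := FreeGroup (Fin n) ⋊[BraidGroup.artin n] BraidGroup n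

/-- The morphism `F_n ⋊ B_n → B_{n+1}`. -/
def prodHom (n : ℕ) : ArtinProd n →* BraidGroup (n + 1) :=
  SemidirectProduct.lift (freeHom n) (BraidGroup.addStrand n) (by
    intro γ
    ext k
    exact (addStrand_conj_freeHom n γ (FreeGroup.of k)).symm)

/-- The generator `x_i` in `F_n ⋊ B_n`. -/
def prodX (n i : ℕ) : ArtinProd n :=
  if h : i < n then SemidirectProduct.inl (FreeGroup.of ⟨i, h⟩) else 1

/-- The generator `σ_i` in `F_n ⋊ B_n`. -/
def prodS (n i : ℕ) : ArtinProd n := SemidirectProduct.inr (sigma n i)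

theorem prodS_mul_inl (n i : ℕ) (x : FreeGroup (Fin n)) :
    prodS n i * SemidirectProduct.inl x =
      SemidirectProduct.inl (BraidGroup.artin n (sigma n i) x) * prodS n i := by
  rw [SemidirectProduct.inl_aut, prodS, map_inv, inv_mul_cancel_right]

theorem prodS_braid {n i : ℕ} (h : i + 2 < n) :
    prodS n i * prodS n (i + 1) * prodS n i = prodS n (i + 1) * prodS n i * prodS n (i + 1) := by
  simp only [prodS, ← map_mul, sigma_braid n i h]

theorem prodS_comm (n : ℕ) {i j : ℕ} (h : i + 1 < j) :
    prodS n i * prodS n j = prodS n j * prodS n i := by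
  simp only [prodS, ← map_mul, (sigma_comm n h).eq]

theorem prodS_mul_prodX {n i : ℕ} (h : i + 1 < n) :
    prodS n i * prodX n i = prodX n (i + 1) * prodS n i := by
  rw [prodX, prodX, dif_pos (by omega), dif_pos h, prodS_mul_inl, artin_sigma_left h]

theorem prodS_mul_prodX_mul {n i : ℕ} (h : i + 1 < n) :
    prodS n i * (prodX n i * prodX n (i + 1)) = prodX n i * prodX n (i + 1) * prodS n i := by
  rw [prodX, prodX, dif_pos (by omega), dif_pos h, ← map_mul, prodS_mul_inl, map_mul,
    artin_sigma_left h, artin_sigma_right h]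
  simp only [mul_assoc, mul_inv_cancel_left]

theorem prodS_mul_prodX_other {n i k : ℕ} (h1 : k ≠ i) (h2 : k ≠ i + 1) :
    prodS n i * prodX n k = prodX n k * prodS n i := by
  rw [prodX]
  split_ifs with h
  · rw [prodS_mul_inl, artin_sigma_other _ h1 h2]
  · rw [mul_one, one_mul]

/-! ### The action of B_{n+1} on the cosets of F_n ⋊ B_n. -/

/-- The transposition of `i` and `i + 1`. -/
def stepN (i k : ℕ) : ℕ := if k = i then i + 1 else if k = i + 1 then i else k

/-- The cocycle with `σ_i b_k = b_{s_i(k)} c(i, k)`, for the coset representatives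
`b_k = σ_k⁻¹ ⋯ σ_{n-1}⁻¹` of `F_n ⋊ B_n` in `B_{n+1}`. -/
def cocycle (n i k : ℕ) : ArtinProd n :=
  if i + 1 < k then prodS n i else if i + 1 = k then prodX n i
  else if i = k then 1 else prodS n (i - 1)

/-- According to the position of `k`, the two factors are distant generators σ, or a σ and some x
that it fixes, or one of them is 1. -/
theorem cocycle_comm {n i j k : ℕ} (h : i + 1 < j) (hk : k ≤ n) :
    cocycle n i (stepN j k) * cocycle n j k = cocycle n j (stepN i k) * cocycle n i k := by
  obtain ⟨d, rfl⟩ : ∃ d, j = i + d + 2 := ⟨j - i - 2, by omega⟩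
  have c1 : k < i ∨ k = i ∨ k = i + 1 ∨ (i + 1 < k ∧ k < i + d + 2) ∨ k = i + d + 2 ∨
    k = i + d + 3 ∨ i + d + 3 < k := by omega
  rcases c1 with c | rfl | rfl | ⟨c, c'⟩ | rfl | rfl | c
  · obtain ⟨i, rfl⟩ : ∃ l, i = l + 1 := ⟨i - 1, by omega⟩
    simp (discharger := omega) only [cocycle, stepN, if_neg]
    exact prodS_comm n (by omega)
  · simp (discharger := omega) only [cocycle, stepN, if_neg, if_true]
    simp
  · simp (discharger := omega) only [cocycle, stepN, if_neg, if_true]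
    exact (prodS_mul_prodX_other (by omega) (by omega)).symm
  · simp (discharger := omega) only [cocycle, stepN, if_pos, if_neg]
    exact prodS_comm n (by omega)
  · simp (discharger := omega) only [cocycle, stepN, if_pos, if_neg, if_true]
    simp
  · simp (discharger := omega) only [cocycle, stepN, if_pos, if_neg, if_true]
    exact prodS_mul_prodX_other (by omega) (by omega)
  · simp (discharger := omega) only [cocycle, stepN, if_pos, if_neg]
    exact prodS_comm n (by omega)

/-- Apart from braid relations in B_n and the trivial case `k = i`, two cases remain. For `k = i +
1` the identity is σ_i x_i = x_{i+1} σ_i, and for `k = i + 2` it says that σ_i commutes with x_i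
x_{i+1}. Together these are the defining formulas of the Artin action. -/
theorem cocycle_braid {n i k : ℕ} (hi : i + 1 < n) (hk : k ≤ n) :
    cocycle n i (stepN (i + 1) (stepN i k)) * cocycle n (i + 1) (stepN i k) * cocycle n i k =
      cocycle n (i + 1) (stepN i (stepN (i + 1) k)) * cocycle n i (stepN (i + 1) k) *
        cocycle n (i + 1) k := by
  have c1 : k < i ∨ k = i ∨ k = i + 1 ∨ k = i + 2 ∨ i + 2 < k := by omega
  rcases c1 with c | rfl | rfl | rfl | c
  · obtain ⟨i, rfl⟩ : ∃ l, i = l + 1 := ⟨i - 1, by omega⟩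
    simp (discharger := omega) only [cocycle, stepN, if_neg]
    exact prodS_braid (by omega)
  · simp (discharger := omega) only [cocycle, stepN, if_pos, if_neg, if_true]
    simp
  · simp (discharger := omega) only [cocycle, stepN, if_pos, if_neg, if_true]
    simp only [mul_one, one_mul, Nat.add_sub_cancel]
    exact prodS_mul_prodX (by omega)
  · simp (discharger := omega) only [cocycle, stepN, if_pos, if_neg, if_true]
    simp only [Nat.add_sub_cancel]
    rw [mul_assoc (prodS n i)]
    exact (prodS_mul_prodX_mul (by omega)).symm
  · simp (discharger := omega) only [cocycle, stepN, if_pos, if_neg]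
    exact prodS_braid (by omega)

/-- The permutation `(k, g) ↦ (e k, h k * g)` of `α × H`. -/
def twist {α H : Type*} [Group H] (e : Equiv.Perm α) (h : α → H) : Equiv.Perm (α × H) where
  toFun p := (e p.1, h p.1 * p.2)
  invFun p := (e.symm p.1, (h (e.symm p.1))⁻¹ * p.2)
  left_inv p := by simp
  right_inv p := by simp

theorem twist_apply {α H : Type*} [Group H] (e : Equiv.Perm α) (h : α → H) (k : α) (g : H) :
    twist e h (k, g) = (e k, h k * g) := rfl

theorem val_swap {n : ℕ} (i : Fin (n - 1)) (k : Fin n) :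
    (Equiv.swap (BraidGroup.lo i) (BraidGroup.hi i) k : ℕ) = stepN i k := by
  rw [Equiv.swap_apply_def, stepN]
  have h1 : k = BraidGroup.lo i ↔ (k : ℕ) = i := Fin.ext_iff
  have h2 : k = BraidGroup.hi i ↔ (k : ℕ) = i + 1 := Fin.ext_iff
  simp only [h1, h2]
  split_ifs <;> rfl

/-- The action of `B_{n+1}` by left multiplication on the cosets of `F_n ⋊ B_n`. -/
def cosetAction (n : ℕ) : BraidGroup (n + 1) →* Equiv.Perm (Fin (n + 1) × ArtinProd n) :=
  BraidGroup.lift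
    (fun i => twist (Equiv.swap (BraidGroup.lo i) (BraidGroup.hi i)) fun k => cocycle n i k)
    (by
      intro i j h
      ext1 ⟨k, g⟩
      simp only [Equiv.Perm.mul_apply, twist_apply, ← mul_assoc]
      refine Prod.ext ?_ ?_
      · have e := congrArg (BraidGroup.perm (n + 1)) (BraidGroup.of_braid h)
        simp only [map_mul, BraidGroup.perm, BraidGroup.lift_of] at e
        exact DFunLike.congr_fun e k
      · simp only [val_swap, ← h]
        rw [cocycle_braid (by omega) (by omega)])
    (by
      intro i j h
      ext1 ⟨k, g⟩
      simp only [Equiv.Perm.mul_apply, twist_apply, ← mul_assoc]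
      refine Prod.ext ?_ ?_
      · have e := congrArg (BraidGroup.perm (n + 1)) (BraidGroup.of_comm h)
        simp only [map_mul, BraidGroup.perm, BraidGroup.lift_of] at e
        exact DFunLike.congr_fun e k
      · simp only [val_swap]
        rw [cocycle_comm h (by omega)])

theorem cosetAction_sigma {n i : ℕ} (h : i < n) (k : Fin (n + 1)) (g : ArtinProd n) :
    cosetAction n (sigma (n + 1) i) (k, g) =
      (BraidGroup.perm (n + 1) (sigma (n + 1) i) k, cocycle n i k * g) := by
  rw [sigma, dif_pos (by omega), cosetAction, BraidGroup.lift_of, BraidGroup.perm,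
    BraidGroup.lift_of]
  rfl

theorem val_perm_sigma {n i : ℕ} (h : i < n) (k : Fin (n + 1)) :
    (BraidGroup.perm (n + 1) (sigma (n + 1) i) k : ℕ) = stepN i k := by
  rw [sigma, dif_pos (by omega), BraidGroup.perm, BraidGroup.lift_of]
  exact val_swap _ _

theorem cosetAction_fst (n : ℕ) (β : BraidGroup (n + 1)) (p : Fin (n + 1) × ArtinProd n) :
    (cosetAction n β p).1 = BraidGroup.perm (n + 1) β p.1 := by
  let S : Subgroup (BraidGroup (n + 1)) :=
    { carrier := {β | ∀ p, (cosetAction n β p).1 = BraidGroup.perm (n + 1) β p.1}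
      one_mem' := by intro p; simp
      mul_mem' := by
        intro β γ hβ hγ p
        rw [map_mul, map_mul, Equiv.Perm.mul_apply, Equiv.Perm.mul_apply, hβ, hγ]
      inv_mem' := by
        intro β hβ p
        have h := hβ ((cosetAction n β)⁻¹ p)
        have e : cosetAction n β ((cosetAction n β)⁻¹ p) = p := Equiv.apply_symm_apply _ _
        rw [e] at h
        rw [map_inv, map_inv, h]
        exact (Equiv.symm_apply_apply _ _).symm }
  refine braid_induction S ?_ β p
  rintro i hi ⟨k, g⟩
  rw [cosetAction_sigma (by omega)]

/-- The coset representative `b_k = σ_k⁻¹ ⋯ σ_{k+d-1}⁻¹`. -/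
def descend (N k : ℕ) : ℕ → BraidGroup N
  | 0 => 1
  | d + 1 => descend N k d * (sigma N (k + d))⁻¹

theorem descend_succ (N k d : ℕ) :
    descend N k (d + 1) = (sigma N k)⁻¹ * descend N (k + 1) d := by
  induction d with
  | zero => simp [descend]
  | succ d ih =>
    rw [descend, ih, descend, mul_assoc, show k + (d + 1) = k + 1 + d by omega]

theorem descend_eq (N i d : ℕ) : descend N (i + 1) d = (sigmaProd N i d)⁻¹ := by
  induction d with
  | zero => simp [descend, sigmaProd]
  | succ d ih =>
    rw [descend, ih, sigmaProd, mul_inv_rev, show i + 1 + d = i + d + 1 by omega]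

theorem sigma_comm_descend (N : ℕ) {i k : ℕ} (h : i + 1 < k) (d : ℕ) :
    sigma N i * descend N k d = descend N k d * sigma N i := by
  induction d with
  | zero => simp [descend]
  | succ d ih =>
    have c : Commute (sigma N i) (descend N k d) := ih
    exact c.mul_right (sigma_comm N (show i + 1 < k + d by omega)).inv_right

/-- The letters of the representative before σ_{k+e}⁻¹ commute with σ_{k+e+1}. The two adjacent
letters are handled by t s⁻¹ t⁻¹ = s⁻¹ t⁻¹ s, and s commutes with the letters after them. The bound
`e + 2 ≤ d` ensures that both adjacent letters occur. -/
theorem sigma_mul_descend {N : ℕ} {e : ℕ} :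
    ∀ {k d : ℕ}, e + 2 ≤ d → k + e + 2 < N →
      sigma N (k + e + 1) * descend N k d = descend N k d * sigma N (k + e) := by
  induction e with
  | zero =>
    intro k d h1 h2
    obtain ⟨d, rfl⟩ : ∃ l, d = l + 2 := ⟨d - 2, by omega⟩
    have c := sigma_comm_descend N (show k + 1 < k + 2 by omega) d
    rw [descend_succ, descend_succ]
    have hb := sigma_braid N k h2
    simp only [add_zero, Nat.add_assoc, Nat.reduceAdd] at *
    generalize descend N (k + 2) d = b at *
    generalize sigma N k = s at *
    generalize sigma N (k + 1) = t at *
    have h3 : t * s⁻¹ * t⁻¹ = s⁻¹ * t⁻¹ * s := by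
      rw [mul_inv_eq_iff_eq_mul, eq_comm, mul_assoc, mul_assoc, inv_mul_eq_iff_eq_mul,
        inv_mul_eq_iff_eq_mul, ← mul_assoc, ← mul_assoc, eq_mul_inv_iff_mul_eq, hb]
    calc t * (s⁻¹ * (t⁻¹ * b)) = t * s⁻¹ * t⁻¹ * b := by simp only [mul_assoc]
      _ = s⁻¹ * t⁻¹ * (s * b) := by rw [h3]; simp only [mul_assoc]
      _ = _ := by rw [c]; simp only [mul_assoc]
  | succ e ih =>
    intro k d h1 h2
    obtain ⟨d, rfl⟩ : ∃ l, d = l + 1 := ⟨d - 1, by omega⟩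
    have h := ih (k := k + 1) (d := d) (by omega) (by omega)
    have c : sigma N (k + 1 + e + 1) * (sigma N k)⁻¹ = (sigma N k)⁻¹ * sigma N (k + 1 + e + 1) :=
      (sigma_comm N (show k + 1 < k + 1 + e + 1 by omega)).symm.inv_right
    rw [descend_succ, show k + (e + 1) = k + 1 + e by omega, ← mul_assoc, c, mul_assoc, h,
      mul_assoc]

/-- The map `(k, g) ↦ b_k g` from the set of pairs of a coset and an element of `F_n ⋊ B_n`
to `B_{n+1}`. -/
def cosetMap (n : ℕ) (p : Fin (n + 1) × ArtinProd n) : BraidGroup (n + 1) :=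
  descend (n + 1) p.1 (n - p.1) * prodHom n p.2

theorem prodHom_prodS {n i : ℕ} (h : i + 1 < n) : prodHom n (prodS n i) = sigma (n + 1) i := by
  rw [prodHom, prodS, SemidirectProduct.lift_inr, addStrand_sigma h]

theorem prodHom_prodX {n i : ℕ} (h : i < n) : prodHom n (prodX n i) = genAux (n + 1) i n := by
  rw [prodHom, prodX, dif_pos h, SemidirectProduct.lift_inl, freeHom_of]

theorem sigma_mul_descend_eq {n i k : ℕ} (hi : i < n) (hk : k ≤ n) :
    sigma (n + 1) i * descend (n + 1) k (n - k) =
      descend (n + 1) (stepN i k) (n - stepN i k) * prodHom n (cocycle n i k) := by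
  have c1 : k < i ∨ k = i ∨ k = i + 1 ∨ i + 1 < k := by omega
  rcases c1 with c | rfl | rfl | c
  · simp (discharger := omega) only [cocycle, stepN, if_neg]
    rw [prodHom_prodS (by omega)]
    obtain ⟨e, rfl⟩ : ∃ e, i = k + e + 1 := ⟨i - k - 1, by omega⟩
    exact sigma_mul_descend (by omega) (by omega)
  · simp (discharger := omega) only [cocycle, stepN, if_neg, if_true]
    rw [show n - k = n - (k + 1) + 1 by omega, descend_succ, mul_inv_cancel_left, map_one, mul_one]
  · simp (discharger := omega) only [cocycle, stepN, if_neg, if_true]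
    -- Since b_i = σ_i⁻¹ b_{i+1}, the cocycle has to be b_{i+1}⁻¹ σ_i² b_{i+1}, which is A_{i,n},
    -- the image of x_i.
    rw [prodHom_prodX hi, show n - i = n - (i + 1) + 1 by omega, descend_succ, descend_eq, genAux,
      show n - i - 1 = n - (i + 1) by omega]
    simp only [sq, mul_assoc, inv_mul_cancel_left]
  · simp (discharger := omega) only [cocycle, stepN, if_pos, if_neg]
    rw [prodHom_prodS (by omega)]
    exact sigma_comm_descend (n + 1) c (n - k)

/-- The formal action becomes left multiplication in B_{n+1}; this is how a braid is recovered from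
its effect on the base point. -/
theorem cosetMap_cosetAction (n : ℕ) (β : BraidGroup (n + 1)) (p : Fin (n + 1) × ArtinProd n) :
    cosetMap n (cosetAction n β p) = β * cosetMap n p := by
  let S : Subgroup (BraidGroup (n + 1)) :=
    { carrier := {β | ∀ p, cosetMap n (cosetAction n β p) = β * cosetMap n p}
      one_mem' := by intro p; simp
      mul_mem' := by
        intro β γ hβ hγ p
        rw [map_mul, Equiv.Perm.mul_apply, hβ, hγ, mul_assoc]
      inv_mem' := by
        intro β hβ p
        have h := hβ ((cosetAction n β)⁻¹ p)
        have e : cosetAction n β ((cosetAction n β)⁻¹ p) = p := Equiv.apply_symm_apply _ _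
        rw [e] at h
        rw [map_inv, h, inv_mul_cancel_left] }
  refine braid_induction S ?_ β p
  rintro i hi ⟨k, g⟩
  rw [cosetAction_sigma (by omega)]
  simp only [cosetMap]
  rw [val_perm_sigma (by omega), map_mul, ← mul_assoc, ← mul_assoc,
    sigma_mul_descend_eq (by omega) (by omega)]

/-- Every letter of the representative undoes a move from coset `i` to coset `i + 1` under σ_i, and
the cocycle of that move is 1. -/
theorem cosetAction_descend (n : ℕ) {d : ℕ} (hd : d ≤ n) (g : ArtinProd n) :
    cosetAction n (descend (n + 1) (n - d) d) (Fin.last n, g) = (⟨n - d, by omega⟩, g) := by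
  induction d with
  | zero => simp [descend]; rfl
  | succ d ih =>
    rw [descend_succ, map_mul, Equiv.Perm.mul_apply, show n - (d + 1) + 1 = n - d by omega,
      ih (by omega), map_inv, Equiv.Perm.inv_eq_iff_eq, cosetAction_sigma (by omega)]
    refine Prod.ext (Fin.ext ?_) ?_
    · rw [val_perm_sigma (by omega)]
      simp (discharger := omega) only [stepN, if_neg, if_true]
      omega
    · simp (discharger := omega) only [cocycle, if_neg, if_true]
      rw [one_mul]

/-- On the base coset, F_n ⋊ B_n acts by left translation. A translation determines its element,
whence injectivity of `prodHom`. -/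
theorem cosetAction_prodHom (n : ℕ) (g h : ArtinProd n) :
    cosetAction n (prodHom n g) (Fin.last n, h) = (Fin.last n, g * h) := by
  let S : Subgroup (ArtinProd n) :=
    { carrier := {g | ∀ h, cosetAction n (prodHom n g) (Fin.last n, h) = (Fin.last n, g * h)}
      one_mem' := by intro h; simp
      mul_mem' := by
        intro g g' hg hg' h
        rw [map_mul, map_mul, Equiv.Perm.mul_apply, hg', hg, mul_assoc]
      inv_mem' := by
        intro g hg h
        rw [map_inv, map_inv, Equiv.Perm.inv_eq_iff_eq, hg, mul_inv_cancel_left] }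
  have h1 : ∀ x, SemidirectProduct.inl x ∈ S := by
    suffices e : (⊤ : Subgroup (FreeGroup (Fin n))) ≤ S.comap SemidirectProduct.inl from
      fun x => e (Subgroup.mem_top x)
    rw [← FreeGroup.closure_range_of, Subgroup.closure_le]
    rintro _ ⟨⟨i, hi⟩, rfl⟩ h
    have hX : (SemidirectProduct.inl (FreeGroup.of ⟨i, hi⟩) : ArtinProd n) = prodX n i := by
      rw [prodX, dif_pos hi]
    -- In A_{i,n} = b_{i+1}⁻¹ σ_i² b_{i+1}, the right factor moves the base coset to coset `i + 1`,
    -- σ_i² comes back to it with cocycle x_i, and the left factor returns to the base coset.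
    have hP : genAux (n + 1) i n = (descend (n + 1) (i + 1) (n - (i + 1)))⁻¹ *
        (sigma (n + 1) i * sigma (n + 1) i * descend (n + 1) (i + 1) (n - (i + 1))) := by
      rw [genAux, descend_eq, show n - i - 1 = n - (i + 1) by omega, sq, inv_inv]
      simp only [mul_assoc]
    have hD := cosetAction_descend n (d := n - (i + 1)) (by omega)
    simp only [show n - (n - (i + 1)) = i + 1 by omega] at hD
    rw [hX, prodHom_prodX hi, hP, map_mul, Equiv.Perm.mul_apply, map_inv,
      Equiv.Perm.inv_eq_iff_eq, hD, map_mul, Equiv.Perm.mul_apply, hD, map_mul,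
      Equiv.Perm.mul_apply, cosetAction_sigma hi, cosetAction_sigma hi]
    refine Prod.ext (Fin.ext ?_) ?_
    · rw [val_perm_sigma hi, val_perm_sigma hi]
      simp (discharger := omega) only [stepN, if_neg, if_true]
    · simp only [val_perm_sigma hi]
      simp (discharger := omega) only [cocycle, stepN, if_neg, if_true]
      rw [one_mul]
  have h2 : ∀ γ, SemidirectProduct.inr γ ∈ S := by
    suffices e : ∀ γ, γ ∈ S.comap SemidirectProduct.inr from e
    refine braid_induction _ ?_
    intro i hi h
    have hS : (SemidirectProduct.inr (sigma n i) : ArtinProd n) = prodS n i := rfl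
    rw [hS, prodHom_prodS hi, cosetAction_sigma (by omega)]
    refine Prod.ext (Fin.ext ?_) ?_
    · rw [val_perm_sigma (by omega)]
      simp (discharger := omega) only [Fin.val_last, stepN, if_neg]
    · simp (discharger := omega) only [Fin.val_last, cocycle, if_pos]
  have h3 : g ∈ S := by
    rw [← SemidirectProduct.inl_left_mul_inr_right g]
    exact mul_mem (h1 _) (h2 _)
  exact h3 h

/-! ### The splitting of the pure braid group on n + 1 strands. -/

theorem prodHom_injective (n : ℕ) : Function.Injective (prodHom n) := by
  intro g g' h
  have h1 := cosetAction_prodHom n g 1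
  rw [h, cosetAction_prodHom, mul_one, mul_one] at h1
  exact (Prod.ext_iff.1 h1).2.symm

/-- A pure braid fixes the base coset, so it sends the base point to `(Fin.last n, g)` for some `g`.
Equivariance of `cosetMap` then gives β = b_n g, where b_n is the empty product. -/
theorem exists_prodHom_eq (n : ℕ) (β : PureBraid (n + 1)) : ∃ g, prodHom n g = β.1 := by
  have h := cosetMap_cosetAction n β.1 (Fin.last n, 1)
  have h1 := cosetAction_fst n β.1 (Fin.last n, 1)
  have hb : BraidGroup.perm (n + 1) β.1 = 1 := β.2
  rw [hb, Equiv.Perm.one_apply] at h1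
  refine ⟨(cosetAction n β.1 (Fin.last n, 1)).2, ?_⟩
  simp only [cosetMap] at h
  rw [h1] at h
  simpa [descend] using h

theorem right_mem_of_prodHom_mem {n : ℕ} {g : ArtinProd n} (h : prodHom n g ∈ PureBraid (n + 1)) :
    g.right ∈ PureBraid n := by
  rw [← SemidirectProduct.inl_left_mul_inr_right g, map_mul, prodHom, SemidirectProduct.lift_inl,
    SemidirectProduct.lift_inr,
    Subgroup.mul_mem_cancel_left _
      (show freeHom n g.left ∈ PureBraid (n + 1) from (ofFree n g.left).2),
    MonoidHom.mem_ker, BraidGroup.perm_addStrand] at h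
  rw [MonoidHom.mem_ker]
  refine Equiv.Perm.viaEmbeddingHom_injective Fin.castSuccEmb ?_
  rw [map_one]
  exact h

/-- The isomorphism of the pure braid group on `n + 1` strands with a subgroup
of `F_n ⋊ B_n`. -/
noncomputable def toProd (n : ℕ) : PureBraid (n + 1) →* ArtinProd n :=
  (MonoidHom.ofInjective (prodHom_injective n)).symm.toMonoidHom.comp
    ((PureBraid (n + 1)).subtype.codRestrict (prodHom n).range (exists_prodHom_eq n))

theorem prodHom_toProd {n : ℕ} (β : PureBraid (n + 1)) : prodHom n (toProd n β) = β.1 :=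
  MonoidHom.apply_ofInjective_symm (prodHom_injective n)
    ⟨β.1, exists_prodHom_eq n β⟩

theorem toProd_eq {n : ℕ} {β : PureBraid (n + 1)} {g : ArtinProd n} (h : prodHom n g = β.1) :
    toProd n β = g := prodHom_injective n ((prodHom_toProd β).trans h.symm)

/-- The morphism that forgets the last strand. -/
noncomputable def forget (n : ℕ) : PureBraid (n + 1) →* PureBraid n :=
  (SemidirectProduct.rightHom.comp (toProd n)).codRestrict (PureBraid n) (fun β =>
    right_mem_of_prodHom_mem (by rw [prodHom_toProd]; exact β.2))

theorem toProd_ofFree (n : ℕ) (x : FreeGroup (Fin n)) :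
    toProd n (ofFree n x) = SemidirectProduct.inl x :=
  toProd_eq (SemidirectProduct.lift_inl _ _ _ _)

theorem forget_ofFree (n : ℕ) (x : FreeGroup (Fin n)) : forget n (ofFree n x) = 1 := by
  apply Subtype.ext
  change (toProd n (ofFree n x)).right = 1
  rw [toProd_ofFree, SemidirectProduct.right_inl]

theorem forget_addStrand (n : ℕ) (γ : PureBraid n) : forget n (addStrand n γ) = γ := by
  apply Subtype.ext
  have h : toProd n (addStrand n γ) = SemidirectProduct.inr γ.1 :=
    toProd_eq (SemidirectProduct.lift_inr _ _ _ _)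
  change (toProd n (addStrand n γ)).right = γ.1
  rw [h, SemidirectProduct.right_inr]

theorem ofFree_injective (n : ℕ) : Function.Injective (ofFree n) := by
  intro x y h
  have h1 := toProd_ofFree n x
  rw [h, toProd_ofFree] at h1
  exact (SemidirectProduct.inl_injective h1).symm

theorem exists_eq_ofFree_mul_addStrand (n : ℕ) (β : PureBraid (n + 1)) :
    ∃ x γ, β = ofFree n x * addStrand n γ := by
  refine ⟨(toProd n β).left, forget n β, Subtype.ext ?_⟩
  rw [← prodHom_toProd β, ← SemidirectProduct.inl_left_mul_inr_right (toProd n β), map_mul,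
    SemidirectProduct.inl_left_mul_inr_right (toProd n β), prodHom, SemidirectProduct.lift_inl,
    SemidirectProduct.lift_inr]
  rfl

end PureBraid

/-! ## The free Lie algebra embeds into the free associative algebra -/

section FreeLie

attribute [local instance] LieRing.ofAssociativeRing

/-- The right-normed bracket `[f a₁, [f a₂, … [f a_m, f x]]]`. -/
def brk {X L : Type*} [LieRing L] (f : X → L) (l : List X) (x : X) : L :=
  l.foldr (fun a u => ⁅f a, u⁆) (f x)

section Brk

variable {X L : Type*} [LieRing L] (f : X → L)

theorem brk_nil (x : X) : brk f [] x = f x := rfl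

theorem brk_cons (a : X) (l : List X) (x : X) : brk f (a :: l) x = ⁅f a, brk f l x⁆ := rfl

theorem map_brk {R L' : Type*} [CommRing R] [LieAlgebra R L] [LieRing L'] [LieAlgebra R L']
    (g : L →ₗ⁅R⁆ L') (l : List X) (x : X) : g (brk f l x) = brk (fun a => g (f a)) l x := by
  induction l with
  | nil => rfl
  | cons a l ih => rw [brk_cons, brk_cons, LieHom.map_lie, ih]

end Brk

variable (R : Type*) [CommRing R]

/-- The canonical morphism from the free Lie algebra to the free associative algebra. -/
noncomputable def lieToAssoc (X : Type*) : FreeLieAlgebra R X →ₗ⁅R⁆ FreeAlgebra R X :=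
  FreeLieAlgebra.lift R (FreeAlgebra.ι R)

theorem lieToAssoc_of {X : Type*} (x : X) :
    lieToAssoc R X (FreeLieAlgebra.of R x) = FreeAlgebra.ι R x :=
  FreeLieAlgebra.lift_of_apply _ _

/-- The elements of degree `m + 1` of the free Lie algebra. -/
noncomputable def lieDeg (X : Type*) (m : ℕ) : Submodule R (FreeLieAlgebra R X) :=
  Submodule.span R {u | ∃ l x, l.length = m ∧ u = brk (FreeLieAlgebra.of R) l x}

theorem lie_of_mem_lieDeg {X : Type*} (x : X) {m : ℕ} {u : FreeLieAlgebra R X}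
    (hu : u ∈ lieDeg R X m) : ⁅FreeLieAlgebra.of R x, u⁆ ∈ lieDeg R X (m + 1) := by
  refine Submodule.span_induction (p := fun u _ => ⁅FreeLieAlgebra.of R x, u⁆ ∈ lieDeg R X (m + 1))
    ?_ ?_ ?_ ?_ hu
  · rintro _ ⟨l, y, hl, rfl⟩
    exact Submodule.subset_span ⟨x :: l, y, by simp [hl], rfl⟩
  · rw [lie_zero]; exact zero_mem _
  · intro u v _ _ hu hv
    rw [lie_add]; exact add_mem hu hv
  · intro c u _ hu
    rw [lie_smul]; exact Submodule.smul_mem _ c hu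

theorem lie_mem_lieDeg {X : Type*} {m : ℕ} {u v : FreeLieAlgebra R X}
    (hv : v ∈ lieDeg R X 0) (hu : u ∈ lieDeg R X m) : ⁅v, u⁆ ∈ lieDeg R X (m + 1) := by
  refine Submodule.span_induction (p := fun v _ => ⁅v, u⁆ ∈ lieDeg R X (m + 1)) ?_ ?_ ?_ ?_ hv
  · rintro _ ⟨l, x, hl, rfl⟩
    rw [List.length_eq_zero_iff.1 hl]
    exact lie_of_mem_lieDeg R x hu
  · rw [zero_lie]; exact zero_mem _
  · intro v v' _ _ hv hv'
    rw [add_lie]; exact add_mem hv hv'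
  · intro r v _ hv
    rw [smul_lie]; exact Submodule.smul_mem _ r hv

/-! ### The grading of the free associative algebra -/

/-- The morphism that multiplies the generators by a parameter. -/
noncomputable def scaleHom (X : Type*) : FreeAlgebra R X →ₐ[R] Polynomial (FreeAlgebra R X) :=
  FreeAlgebra.lift R fun x => Polynomial.monomial 1 (FreeAlgebra.ι R x)

/-- A bracket of m + 1 letters is homogeneous of degree m + 1, and the exponent of the polynomial
variable records the degree. -/
theorem scaleHom_lieToAssoc {X : Type*} {m : ℕ} {u : FreeLieAlgebra R X} (hu : u ∈ lieDeg R X m) :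
    scaleHom R X (lieToAssoc R X u) = Polynomial.monomial (m + 1) (lieToAssoc R X u) := by
  refine Submodule.span_induction (p := fun u _ => scaleHom R X (lieToAssoc R X u) =
    Polynomial.monomial (m + 1) (lieToAssoc R X u)) ?_ ?_ ?_ ?_ hu
  · rintro _ ⟨l, x, hl, rfl⟩
    clear hu
    induction l generalizing m with
    | nil =>
      obtain rfl : 0 = m := hl
      rw [brk_nil, lieToAssoc_of, scaleHom, FreeAlgebra.lift_ι_apply]
    | cons a l ih =>
      obtain rfl : l.length + 1 = m := hl
      have h := ih (m := l.length) rfl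
      have ha : scaleHom R X (FreeAlgebra.ι R a) = Polynomial.monomial 1 (FreeAlgebra.ι R a) :=
        FreeAlgebra.lift_ι_apply _ _
      rw [brk_cons, LieHom.map_lie, lieToAssoc_of, LieRing.of_associative_ring_bracket, map_sub,
        map_mul, map_mul, h, ha, Polynomial.monomial_mul_monomial,
        Polynomial.monomial_mul_monomial, map_sub, add_comm 1]
  · simp
  · intro u v _ _ hu hv
    simp only [map_add, hu, hv]
  · intro c u _ hu
    rw [map_smul, map_smul, hu, Polynomial.smul_monomial]

theorem lieToAssoc_eq_zero_of_sum {X : Type*} {s : Finset ℕ} {u : ℕ → FreeLieAlgebra R X}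
    (hu : ∀ m, u m ∈ lieDeg R X m) (h : lieToAssoc R X (∑ m ∈ s, u m) = 0) {m : ℕ} (hm : m ∈ s) :
    lieToAssoc R X (u m) = 0 := by
  have h1 := congrArg (fun a => (scaleHom R X a).coeff (m + 1)) h
  simp only [map_sum, scaleHom_lieToAssoc R (hu _), Polynomial.finsetSum_coeff,
    Polynomial.coeff_monomial, map_zero, Polynomial.coeff_zero, Nat.add_right_cancel_iff] at h1
  rwa [Finset.sum_ite_eq' s m, if_pos hm] at h1

/-! ### Elimination of a generator -/

variable {R}
variable {X : Type} (c : X)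

/-- The generators `ad(c)^k x`, for `x ≠ c`. -/
abbrev Elim (c : X) : Type := ℕ × {x : X // x ≠ c}

variable (R) in
/-- The element `ad(c)^k x`. -/
noncomputable def adPow (y : Elim c) : FreeLieAlgebra R X :=
  (fun u => ⁅FreeLieAlgebra.of R c, u⁆)^[y.1] (FreeLieAlgebra.of R y.2.1)

theorem lie_adPow (y : Elim c) :
    ⁅FreeLieAlgebra.of R c, adPow R c y⁆ = adPow R c (y.1 + 1, y.2) := by
  rw [adPow, adPow, Function.iterate_succ_apply']

variable (R) in
/-- The inclusion of the free Lie algebra on the generators `ad(c)^k x`. -/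
noncomputable def elimHom : FreeLieAlgebra R (Elim c) →ₗ⁅R⁆ FreeLieAlgebra R X :=
  FreeLieAlgebra.lift R (adPow R c)

variable (R) in
/-- The morphism `y_{k,x} ↦ y_{k,x} + ε y_{k+1,x}`. -/
noncomputable def shiftHom : FreeAlgebra R (Elim c) →ₐ[R] DualNumber (FreeAlgebra R (Elim c)) :=
  FreeAlgebra.lift R fun y => TrivSqZeroExt.inl (FreeAlgebra.ι R y) +
    TrivSqZeroExt.inr (FreeAlgebra.ι R (y.1 + 1, y.2))

variable (R) in
/-- The derivation `y_{k,x} ↦ y_{k+1,x}`. -/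
noncomputable def shiftDer : Module.End R (FreeAlgebra R (Elim c)) :=
  { toFun := fun a => (shiftHom R c a).snd
    map_add' := fun a b => by rw [map_add, TrivSqZeroExt.snd_add]
    map_smul' := fun r a => by rw [map_smul, TrivSqZeroExt.snd_smul, RingHom.id_apply] }

theorem fst_shiftHom (a : FreeAlgebra R (Elim c)) : (shiftHom R c a).fst = a := by
  have h : (TrivSqZeroExt.fstHom R (FreeAlgebra R (Elim c)) (FreeAlgebra R (Elim c))).comp
      (shiftHom R c) = AlgHom.id R _ := by
    ext y
    simp [shiftHom]
  exact DFunLike.congr_fun h a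

/-- This is multiplication of dual numbers. In terms of operators, the commutator of `shiftDer` with
left multiplication by y_{k,x} is left multiplication by y_{k+1,x}, which mirrors the bracket of c
with ad(c)^k x. -/
theorem shiftDer_ι_mul (y : Elim c) (a : FreeAlgebra R (Elim c)) :
    shiftDer R c (FreeAlgebra.ι R y * a) =
      FreeAlgebra.ι R y * shiftDer R c a + FreeAlgebra.ι R (y.1 + 1, y.2) * a := by
  have h : ∀ b, shiftDer R c b = (shiftHom R c b).snd := fun _ => rfl
  rw [h, h, map_mul, DualNumber.snd_mul, fst_shiftHom, fst_shiftHom]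
  simp [shiftHom]

open scoped Classical in
variable (R) in
/-- The action of the free algebra on `X` on the free algebra on the generators `ad(c)^k x`. -/
noncomputable def elimRep : FreeAlgebra R X →ₐ[R] Module.End R (FreeAlgebra R (Elim c)) :=
  FreeAlgebra.lift R fun x => if h : x = c then shiftDer R c
    else LinearMap.mulLeft R (FreeAlgebra.ι R ((0, ⟨x, h⟩) : Elim c))

theorem elimRep_adPow (y : Elim c) :
    elimRep R c (lieToAssoc R X (adPow R c y)) = LinearMap.mulLeft R (FreeAlgebra.ι R y) := by
  obtain ⟨k, x, hx⟩ := y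
  induction k with
  | zero =>
    rw [adPow, Function.iterate_zero_apply, lieToAssoc_of, elimRep, FreeAlgebra.lift_ι_apply,
      dif_neg hx]
  | succ k ih =>
    have hc : elimRep R c (FreeAlgebra.ι R c) = shiftDer R c := by
      rw [elimRep, FreeAlgebra.lift_ι_apply, dif_pos rfl]
    rw [← lie_adPow c (k, ⟨x, hx⟩), LieHom.map_lie, lieToAssoc_of,
      LieRing.of_associative_ring_bracket, map_sub, map_mul, map_mul, ih, hc]
    ext1 a
    rw [LinearMap.sub_apply, Module.End.mul_apply, Module.End.mul_apply, LinearMap.mulLeft_apply,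
      LinearMap.mulLeft_apply, shiftDer_ι_mul, add_sub_cancel_left, LinearMap.mulLeft_apply]

/-- Both sides are Lie morphisms that agree on generators by `elimRep_adPow`. Evaluated at 1, the
operator recovers the associative image of `v`, so no information about it is lost on passing to the
alphabet `X`. -/
theorem elimRep_elimHom (v : FreeLieAlgebra R (Elim c)) :
    elimRep R c (lieToAssoc R X (elimHom R c v)) =
      LinearMap.mulLeft R (lieToAssoc R (Elim c) v) := by
  have h : ((elimRep R c).toLieHom.comp (lieToAssoc R X)).comp (elimHom R c) =
      (Algebra.lmul R (FreeAlgebra R (Elim c))).toLieHom.comp (lieToAssoc R (Elim c)) := by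
    ext1 y
    simp only [LieHom.comp_apply, AlgHom.toLieHom_apply, elimHom, FreeLieAlgebra.lift_of_apply,
      elimRep_adPow, lieToAssoc_of]
    rfl
  exact DFunLike.congr_fun h v

theorem lieToAssoc_eq_zero_of_elimHom {v : FreeLieAlgebra R (Elim c)}
    (h : lieToAssoc R X (elimHom R c v) = 0) : lieToAssoc R (Elim c) v = 0 := by
  have h1 := elimRep_elimHom c v
  rw [h, map_zero] at h1
  have h2 := DFunLike.congr_fun h1 1
  rwa [LinearMap.zero_apply, LinearMap.mulLeft_apply, mul_one, eq_comm] at h2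

/-- The excess of the degree in `X` over the degree in `Elim c`. -/
def excess (l : List (Elim c)) (y : Elim c) : ℕ := (l.map Prod.fst).sum + y.1

variable (R) in
/-- The brackets of degree `p + 1` in `Elim c` and of degree `p + q + 1` in `X`. -/
noncomputable def biDeg (p q : ℕ) : Submodule R (FreeLieAlgebra R (Elim c)) :=
  Submodule.span R {u | ∃ l y, l.length = p ∧ excess c l y = q ∧
    u = brk (FreeLieAlgebra.of R) l y}

theorem biDeg_le (p q : ℕ) : biDeg R c p q ≤ lieDeg R (Elim c) p := by
  refine Submodule.span_mono ?_
  rintro _ ⟨l, y, h1, -, h3⟩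
  exact ⟨l, y, h1, h3⟩

variable (R) in
/-- The span of the images of the brackets of degree `m + 1` in `X`. -/
noncomputable def elimSpan (m : ℕ) : Submodule R (FreeLieAlgebra R X) :=
  Submodule.span R {u | ∃ l y, l.length + excess c l y = m ∧ u = brk (adPow R c) l y}

theorem lie_adPow_mem_elimSpan (y : Elim c) {m : ℕ} {u : FreeLieAlgebra R X}
    (hu : u ∈ elimSpan R c m) : ⁅adPow R c y, u⁆ ∈ elimSpan R c (m + y.1 + 1) := by
  refine Submodule.span_induction
    (p := fun u _ => ⁅adPow R c y, u⁆ ∈ elimSpan R c (m + y.1 + 1)) ?_ ?_ ?_ ?_ hu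
  · rintro _ ⟨l, z, hl, rfl⟩
    refine Submodule.subset_span ⟨y :: l, z, ?_, rfl⟩
    simp only [excess, List.map_cons, List.sum_cons, List.length_cons] at hl ⊢
    omega
  · rw [lie_zero]; exact zero_mem _
  · intro u v _ _ hu hv
    rw [lie_add]; exact add_mem hu hv
  · intro r u _ hu
    rw [lie_smul]; exact Submodule.smul_mem _ r hu

/-- As a derivation, ad(c) acts on a bracket of the generators ad(c)^k x by raising one index k at a
time, which adds one to the total degree. -/
theorem lie_of_mem_elimSpan {m : ℕ} {u : FreeLieAlgebra R X}
    (hu : u ∈ elimSpan R c m) : ⁅FreeLieAlgebra.of R c, u⁆ ∈ elimSpan R c (m + 1) := by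
  refine Submodule.span_induction
    (p := fun u _ => ⁅FreeLieAlgebra.of R c, u⁆ ∈ elimSpan R c (m + 1)) ?_ ?_ ?_ ?_ hu
  · rintro _ ⟨l, z, hl, rfl⟩
    clear hu
    induction l generalizing m with
    | nil =>
      rw [brk_nil, lie_adPow]
      refine Submodule.subset_span ⟨[], (z.1 + 1, z.2), ?_, rfl⟩
      simp only [excess, List.map_nil, List.sum_nil, List.length_nil] at hl ⊢
      omega
    | cons y l ih =>
      rw [brk_cons, leibniz_lie, lie_adPow]
      refine add_mem ?_ ?_
      · refine Submodule.subset_span ⟨(y.1 + 1, y.2) :: l, z, ?_, rfl⟩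
        simp only [excess, List.map_cons, List.sum_cons, List.length_cons] at hl ⊢
        omega
      · have h1 := ih (m := l.length + excess c l z) rfl
        have h2 := lie_adPow_mem_elimSpan c y h1
        have e : l.length + excess c l z + 1 + y.1 + 1 = m + 1 := by
          simp only [excess, List.map_cons, List.sum_cons, List.length_cons] at hl ⊢
          omega
        rwa [e] at h2
  · rw [lie_zero]; exact zero_mem _
  · intro u v _ _ hu hv
    rw [lie_add]; exact add_mem hu hv
  · intro r u _ hu
    rw [lie_smul]; exact Submodule.smul_mem _ r hu

/-- The letter c alone is the only exception: [c, c] = 0, and [a, c] = -ad(c)a if a ≠ c. -/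
theorem brk_mem_elimSpan (l : List X) (x : X) :
    (l = [] ∧ x = c) ∨ brk (FreeLieAlgebra.of R) l x ∈ elimSpan R c l.length ∨
      brk (FreeLieAlgebra.of R) l x = 0 := by
  have h0 : ∀ (a : X) (ha : a ≠ c), FreeLieAlgebra.of R a = adPow R c (0, ⟨a, ha⟩) :=
    fun a ha => rfl
  induction l with
  | nil =>
    by_cases hx : x = c
    · exact Or.inl ⟨rfl, hx⟩
    · exact Or.inr (Or.inl (Submodule.subset_span ⟨[], (0, ⟨x, hx⟩), rfl, rfl⟩))
  | cons a l ih =>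
    right
    rw [brk_cons]
    rcases ih with ⟨rfl, rfl⟩ | ih | ih
    · rw [brk_nil]
      by_cases ha : a = x
      · right
        rw [ha, lie_self]
      · left
        rw [← lie_skew, h0 a ha, lie_adPow]
        exact neg_mem (Submodule.subset_span ⟨[], (0 + 1, ⟨a, ha⟩), by simp [excess], rfl⟩)
    · left
      by_cases ha : a = c
      · rw [ha]
        exact lie_of_mem_elimSpan c ih
      · have h := lie_adPow_mem_elimSpan c (0, ⟨a, ha⟩) ih
        rw [← h0 a ha] at h
        simpa only [List.length_cons, add_zero] using h
    · right
      rw [ih, lie_zero]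

theorem lieDeg_le_elimSpan (m : ℕ) : lieDeg R X (m + 1) ≤ elimSpan R c (m + 1) := by
  refine Submodule.span_le.2 ?_
  rintro _ ⟨l, x, hl, rfl⟩
  rcases brk_mem_elimSpan (R := R) c l x with ⟨rfl, -⟩ | h | h
  · simp at hl
  · rwa [hl] at h
  · rw [h]; exact zero_mem _

/-- Brackets are sorted by their length in the new generators. The truncated subtraction is
harmless, since only indices `p ≤ m` enter the sum. -/
theorem exists_of_mem_elimSpan {m : ℕ} {u : FreeLieAlgebra R X} (hu : u ∈ elimSpan R c m) :
    ∃ v : ℕ → FreeLieAlgebra R (Elim c), (∀ p, v p ∈ biDeg R c p (m - p)) ∧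
      u = elimHom R c (∑ p ∈ Finset.range (m + 1), v p) := by
  refine Submodule.span_induction (p := fun u _ => ∃ v : ℕ → FreeLieAlgebra R (Elim c),
    (∀ p, v p ∈ biDeg R c p (m - p)) ∧ u = elimHom R c (∑ p ∈ Finset.range (m + 1), v p))
    ?_ ?_ ?_ ?_ hu
  · rintro _ ⟨l, y, hl, rfl⟩
    refine ⟨Pi.single l.length (brk (FreeLieAlgebra.of R) l y), ?_, ?_⟩
    · intro p
      by_cases hp : p = l.length
      · subst hp
        rw [Pi.single_eq_same]
        exact Submodule.subset_span ⟨l, y, rfl, by omega, rfl⟩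
      · rw [Pi.single_eq_of_ne hp]
        exact zero_mem _
    · rw [Finset.sum_eq_single_of_mem l.length (Finset.mem_range.2 (by omega))
        (fun p _ hp => Pi.single_eq_of_ne hp _), Pi.single_eq_same, map_brk]
      simp only [elimHom, FreeLieAlgebra.lift_of_apply]
  · exact ⟨0, fun p => zero_mem _, by simp⟩
  · rintro _ _ _ _ ⟨v, hv, rfl⟩ ⟨v', hv', rfl⟩
    refine ⟨v + v', fun p => add_mem (hv p) (hv' p), ?_⟩
    simp only [Pi.add_apply, Finset.sum_add_distrib, map_add]
  · rintro r _ _ ⟨v, hv, rfl⟩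
    refine ⟨r • v, fun p => Submodule.smul_mem _ r (hv p), ?_⟩
    simp only [Pi.smul_apply, ← Finset.smul_sum, map_smul]

/-! ### Killing generators, and injectivity degree by degree. -/

open scoped Classical in
variable (R) in
/-- The endomorphism of the free Lie algebra that kills the generators in `S`. -/
noncomputable def killHom (S : Finset X) : FreeLieAlgebra R X →ₗ⁅R⁆ FreeLieAlgebra R X :=
  FreeLieAlgebra.lift R fun x => if x ∈ S then 0 else FreeLieAlgebra.of R x

theorem killHom_of_mem {S : Finset X} {x : X} (h : x ∈ S) :
    killHom R S (FreeLieAlgebra.of R x) = 0 := by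
  rw [killHom, FreeLieAlgebra.lift_of_apply, if_pos h]

theorem killHom_of_notMem {S : Finset X} {x : X} (h : x ∉ S) :
    killHom R S (FreeLieAlgebra.of R x) = FreeLieAlgebra.of R x := by
  rw [killHom, FreeLieAlgebra.lift_of_apply, if_neg h]

/-- Excess zero forces every generator that occurs to have k = 0, that is, to be a letter other than
c. -/
theorem killHom_elimHom {p : ℕ} {v : FreeLieAlgebra R (Elim c)} (hv : v ∈ biDeg R c p 0) :
    killHom R {c} (elimHom R c v) = elimHom R c v := by
  refine Submodule.span_induction
    (p := fun v _ => killHom R {c} (elimHom R c v) = elimHom R c v) ?_ ?_ ?_ ?_ hv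
  · rintro _ ⟨l, y, -, hq, rfl⟩
    have h0 : ∀ y : Elim c, y.1 = 0 → killHom R {c} (adPow R c y) = adPow R c y := by
      rintro ⟨k, x, hx⟩ hk
      obtain rfl : k = 0 := hk
      exact killHom_of_notMem (by simpa using hx)
    rw [map_brk, elimHom]
    simp only [FreeLieAlgebra.lift_of_apply]
    rw [excess, Nat.add_eq_zero_iff] at hq
    obtain ⟨hl, hy⟩ := hq
    induction l with
    | nil => exact h0 y hy
    | cons a l ih =>
      rw [List.map_cons, List.sum_cons, Nat.add_eq_zero_iff] at hl
      rw [brk_cons, LieHom.map_lie, h0 a hl.1, ih hl.2]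
  · simp
  · intro u v _ _ hu hv
    simp only [map_add, hu, hv]
  · intro r u _ hu
    simp only [map_smul, hu]

/-- A right-normed bracket dies with its last letter, so finitely many letters suffice. This matters
because the alphabets `Elim c` may be infinite. -/
theorem exists_killHom_eq_zero {m : ℕ} {u : FreeLieAlgebra R X} (hu : u ∈ lieDeg R X m) :
    ∃ S : Finset X, ∀ T, S ⊆ T → killHom R T u = 0 := by
  classical
  refine Submodule.span_induction (p := fun u _ => ∃ S : Finset X, ∀ T, S ⊆ T →
    killHom R T u = 0) ?_ ?_ ?_ ?_ hu
  · rintro _ ⟨l, x, -, rfl⟩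
    refine ⟨{x}, fun T hT => ?_⟩
    have hx := killHom_of_mem (R := R) (Finset.singleton_subset_iff.1 hT)
    induction l with
    | nil => exact hx
    | cons a l ih => rw [brk_cons, LieHom.map_lie, ih, lie_zero]
  · exact ⟨∅, fun T _ => map_zero _⟩
  · rintro u v _ _ ⟨S, hS⟩ ⟨S', hS'⟩
    refine ⟨S ∪ S', fun T hT => ?_⟩
    rw [map_add, hS T (Finset.union_subset_left hT), hS' T (Finset.union_subset_right hT), add_zero]
  · rintro r u _ ⟨S, hS⟩
    refine ⟨S, fun T hT => ?_⟩
    rw [map_smul, hS T hT, smul_zero]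

/-- Killing letters one after another leaves `u` unchanged, while killing a large enough finite set
gives 0. -/
theorem eq_zero_of_killHom_singleton {m : ℕ} {u : FreeLieAlgebra R X} (hu : u ∈ lieDeg R X m)
    (h : ∀ c, killHom R {c} u = u) : u = 0 := by
  classical
  obtain ⟨S, hS⟩ := exists_killHom_eq_zero hu
  rw [← hS S subset_rfl]
  clear hS
  induction S using Finset.induction_on with
  | empty =>
    have e : killHom R (∅ : Finset X) = LieHom.id := by
      ext1 x
      exact killHom_of_notMem (Finset.notMem_empty x)
    rw [e]; rfl
  | insert c S hc ih =>
    have e : killHom R (insert c S) = (killHom R S).comp (killHom R {c}) := by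
      ext1 x
      rw [LieHom.comp_apply]
      by_cases h1 : x = c
      · rw [killHom_of_mem (by simp [h1]), killHom_of_mem (by simp [h1]), map_zero]
      · rw [killHom_of_notMem (S := {c}) (by simpa using h1)]
        by_cases h2 : x ∈ S
        · rw [killHom_of_mem (by simp [h2]), killHom_of_mem h2]
        · rw [killHom_of_notMem (by simp [h1, h2]), killHom_of_notMem h2]
    rw [e, LieHom.comp_apply, h, ← ih]

/-- The induction on the degree runs over all alphabets at once, since eliminating c replaces `X` by
`Elim c`. In degree at least two, `u` comes from a sum of terms `v p` of degree p + 1 in the new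
generators, each with zero associative image. Those of smaller degree than `u` vanish by induction;
the one left has excess zero and does not involve c. As c is arbitrary, `u` involves no letter at
all. -/
theorem eq_zero_of_lieToAssoc_eq_zero (m : ℕ) : ∀ (X : Type) (u : FreeLieAlgebra R X),
    u ∈ lieDeg R X m → lieToAssoc R X u = 0 → u = 0 := by
  induction m using Nat.strong_induction_on with
  | h m ih =>
  intro X u hu h
  cases m with
  | zero =>
    classical
    have hu' : u ∈ Submodule.span R (Set.range (FreeLieAlgebra.of R : X → _)) := by
      refine Submodule.span_mono ?_ hu
      rintro _ ⟨l, x, hl, rfl⟩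
      rw [List.length_eq_zero_iff.1 hl]
      exact ⟨x, rfl⟩
    rw [Finsupp.mem_span_range_iff_exists_finsupp] at hu'
    obtain ⟨f, rfl⟩ := hu'
    have hf : f = 0 := by
      ext x
      -- Sending the generator x to 1 and the others to 0 reads off the coefficient of x.
      have h1 := congrArg (FreeAlgebra.lift R fun y => if y = x then (1 : R) else 0) h
      simpa [Finsupp.sum, lieToAssoc_of] using h1
    rw [hf, Finsupp.sum_zero_index]
  | succ m =>
    refine eq_zero_of_killHom_singleton hu ?_
    intro c
    obtain ⟨v, hv, rfl⟩ := exists_of_mem_elimSpan c (lieDeg_le_elimSpan c m hu)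
    have h1 := lieToAssoc_eq_zero_of_elimHom c h
    have h2 : ∀ p ∈ Finset.range (m + 1), v p = 0 := by
      intro p hp
      rw [Finset.mem_range] at hp
      exact ih p hp _ _ (biDeg_le c _ _ (hv p)) (lieToAssoc_eq_zero_of_sum R
        (fun p => biDeg_le c _ _ (hv p)) h1 (Finset.mem_range.2 (by omega)))
    have h3 := hv (m + 1)
    rw [Nat.sub_self] at h3
    rw [Finset.sum_range_succ, Finset.sum_eq_zero h2, zero_add, killHom_elimHom c h3]

end FreeLie

/-! ## The Magnus expansion and the center of the Lie ring of a free group -/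

section Magnus

attribute [local instance] LieRing.ofAssociativeRing

open scoped commutatorElement

/-! ### Leading terms of noncommutative power series. -/

section Lead

variable {A : Type*} [Ring A]

/-- The power series `a` is `1 + α X^{j+1}` up to terms of higher degree. -/
def IsLead (j : ℕ) (a : (PowerSeries A)ˣ) (α : A) : Prop :=
  ∃ f : PowerSeries A, (a : PowerSeries A) = 1 + PowerSeries.X ^ (j + 1) * f ∧
    PowerSeries.constantCoeff f = α

variable {j k : ℕ} {a b : (PowerSeries A)ˣ} {α β : A}

theorem IsLead.coeff_eq (h : IsLead j a α) :
    PowerSeries.coeff (j + 1) (a : PowerSeries A) = α := by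
  obtain ⟨f, hf, rfl⟩ := h
  have e := PowerSeries.coeff_X_pow_mul f (j + 1) 0
  rw [zero_add] at e
  rw [hf, map_add, e, PowerSeries.coeff_one, if_neg (Nat.succ_ne_zero j), zero_add,
    PowerSeries.coeff_zero_eq_constantCoeff_apply]

theorem IsLead.constantCoeff_eq (h : IsLead j a α) :
    PowerSeries.constantCoeff (a : PowerSeries A) = 1 := by
  obtain ⟨f, hf, -⟩ := h
  rw [hf, map_add, map_mul, map_pow, PowerSeries.constantCoeff_X, map_one,
    zero_pow (Nat.succ_ne_zero j), zero_mul, add_zero]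

theorem IsLead.constantCoeff_inv_eq (h : IsLead j a α) :
    PowerSeries.constantCoeff ((a⁻¹ : (PowerSeries A)ˣ) : PowerSeries A) = 1 := by
  have e := congrArg PowerSeries.constantCoeff a.mul_inv
  rwa [map_mul, h.constantCoeff_eq, one_mul, map_one] at e

theorem isLead_one (j : ℕ) : IsLead j (1 : (PowerSeries A)ˣ) 0 := ⟨0, by simp, map_zero _⟩

theorem IsLead.mul (ha : IsLead j a α) (hb : IsLead j b β) : IsLead j (a * b) (α + β) := by
  obtain ⟨f, hf, rfl⟩ := ha
  have hb' := hb.constantCoeff_eq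
  obtain ⟨g, hg, rfl⟩ := hb
  refine ⟨f * b + g, ?_, ?_⟩
  · rw [Units.val_mul, hf, add_mul, one_mul, mul_add, mul_assoc]
    nth_rewrite 1 [hg]
    abel
  · rw [map_add, map_mul, hb', mul_one]

theorem IsLead.inv (ha : IsLead j a α) : IsLead j a⁻¹ (-α) := by
  have ha' := ha.constantCoeff_inv_eq
  obtain ⟨f, hf, rfl⟩ := ha
  refine ⟨-(f * (a⁻¹ : (PowerSeries A)ˣ)), ?_, ?_⟩
  · have e := a.mul_inv
    nth_rewrite 1 [hf] at e
    rw [add_mul, one_mul] at e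
    rw [mul_neg, ← mul_assoc, ← sub_eq_add_neg, eq_sub_iff_add_eq, e]
  · rw [map_neg, map_mul, ha', mul_one]

/-- This makes the leading coefficient well defined on the quotient by the next term of the lower
central series. -/
theorem IsLead.succ (ha : IsLead (j + 1) a α) : IsLead j a 0 := by
  obtain ⟨f, hf, -⟩ := ha
  refine ⟨PowerSeries.X * f, ?_, ?_⟩
  · rw [hf, pow_succ _ (j + 1), mul_assoc]
  · rw [map_mul, PowerSeries.constantCoeff_X, zero_mul]

/-- One has ⁅a, b⁆ - 1 = (ab - ba)a⁻¹b⁻¹. Since the variable is central, ab - ba is its power of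
exponent j + k + 2 times fg - gf, and the inverses have constant term 1. -/
theorem IsLead.commutator (ha : IsLead j a α) (hb : IsLead k b β) :
    IsLead (j + k + 1) ⁅a, b⁆ (α * β - β * α) := by
  have ha' := ha.constantCoeff_inv_eq
  have hb' := hb.constantCoeff_inv_eq
  obtain ⟨f, hf, rfl⟩ := ha
  obtain ⟨g, hg, rfl⟩ := hb
  refine ⟨(f * g - g * f) * (((a⁻¹ : (PowerSeries A)ˣ) : PowerSeries A) *
    ((b⁻¹ : (PowerSeries A)ˣ) : PowerSeries A)), ?_, ?_⟩
  · have e1 : (a : PowerSeries A) * (b : PowerSeries A) = (b : PowerSeries A) * (a : PowerSeries A) +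
        PowerSeries.X ^ (j + k + 1 + 1) * (f * g - g * f) := by
      have e2 : f * (PowerSeries.X ^ (k + 1) * g) = PowerSeries.X ^ (k + 1) * (f * g) := by
        rw [← mul_assoc, ← PowerSeries.X_pow_mul, mul_assoc]
      have e3 : g * (PowerSeries.X ^ (j + 1) * f) = PowerSeries.X ^ (j + 1) * (g * f) := by
        rw [← mul_assoc, ← PowerSeries.X_pow_mul, mul_assoc]
      have e4 : (PowerSeries.X : PowerSeries A) ^ (j + k + 1 + 1) =
          PowerSeries.X ^ (j + 1) * PowerSeries.X ^ (k + 1) := by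
        rw [← pow_add]; congr 1; omega
      have e5 : (PowerSeries.X : PowerSeries A) ^ (j + k + 1 + 1) =
          PowerSeries.X ^ (k + 1) * PowerSeries.X ^ (j + 1) := by
        rw [← pow_add]; congr 1; omega
      rw [mul_sub]
      nth_rewrite 1 [e4]
      rw [hf, hg, e5]
      simp only [add_mul, mul_add, one_mul, mul_one, mul_assoc, e2, e3]
      abel
    rw [commutatorElement_def, Units.val_mul, Units.val_mul, Units.val_mul, e1, mul_assoc, add_mul,
      mul_assoc (b : PowerSeries A), Units.mul_inv_cancel_left, Units.mul_inv, mul_assoc]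
  · rw [map_mul, map_mul, ha', hb', mul_one, mul_one, map_sub, map_mul, map_mul]

end Lead

/-! ### The Magnus expansion on the lower central series of a free group. -/

variable (X : Type)

/-- The ring of noncommutative power series, with the grading recorded by a parameter. -/
abbrev MagnusRing : Type := PowerSeries (FreeAlgebra ℤ X)

/-- The Magnus expansion `x ↦ 1 + x`. -/
noncomputable def magnus : FreeGroup X →* (MagnusRing X)ˣ :=
  FreeGroup.lift fun x =>
    { val := 1 + PowerSeries.X * PowerSeries.C (FreeAlgebra.ι ℤ x)
      inv := PowerSeries.invOfUnit (1 + PowerSeries.X * PowerSeries.C (FreeAlgebra.ι ℤ x)) 1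
      val_inv := PowerSeries.mul_invOfUnit _ _ (by simp)
      inv_val := PowerSeries.invOfUnit_mul _ _ (by simp) }

theorem isLead_magnus_of (x : X) :
    IsLead 0 (magnus X (FreeGroup.of x)) (FreeAlgebra.ι ℤ x) := by
  refine ⟨PowerSeries.C (FreeAlgebra.ι ℤ x), ?_, PowerSeries.constantCoeff_C _⟩
  rw [magnus, FreeGroup.lift_apply_of, zero_add, pow_one]

theorem exists_isLead_magnus_zero (w : FreeGroup X) : ∃ α, IsLead 0 (magnus X w) α := by
  induction w using FreeGroup.induction_on with
  | C1 => exact ⟨0, by rw [map_one]; exact isLead_one 0⟩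
  | of x => exact ⟨_, isLead_magnus_of X x⟩
  | inv_of x _ => exact ⟨_, by rw [map_inv]; exact (isLead_magnus_of X x).inv⟩
  | mul x y hx hy =>
    obtain ⟨α, hα⟩ := hx
    obtain ⟨β, hβ⟩ := hy
    exact ⟨_, by rw [map_mul]; exact hα.mul hβ⟩

theorem exists_isLead_magnus {j : ℕ} {w : FreeGroup X} (hw : w ∈ lcs (FreeGroup X) j) :
    ∃ α, IsLead j (magnus X w) α := by
  induction j generalizing w with
  | zero => exact exists_isLead_magnus_zero X w
  | succ j ih =>
    let S : Subgroup (FreeGroup X) :=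
      { carrier := {w | ∃ α, IsLead (j + 1) (magnus X w) α}
        one_mem' := ⟨0, by rw [map_one]; exact isLead_one _⟩
        mul_mem' := by
          rintro x y ⟨α, hα⟩ ⟨β, hβ⟩
          exact ⟨_, by rw [map_mul]; exact hα.mul hβ⟩
        inv_mem' := by
          rintro x ⟨α, hα⟩
          exact ⟨_, by rw [map_inv]; exact hα.inv⟩ }
    suffices h : lcs (FreeGroup X) (j + 1) ≤ S from h hw
    refine Subgroup.commutator_le.2 ?_
    intro a ha b _
    obtain ⟨α, hα⟩ := ih ha
    obtain ⟨β, hβ⟩ := exists_isLead_magnus_zero X b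
    have h := hα.commutator hβ
    rw [add_zero, ← map_commutatorElement] at h
    exact ⟨_, h⟩

/-- Additive maps out of a graded piece. -/
def LieGr.lift {G M : Type*} [Group G] [AddCommGroup M] {j : ℕ} (f : lcs G j → M)
    (hf : ∀ x y, f (x * y) = f x + f y) (h : ∀ x : lcs G j, x.1 ∈ lcs G (j + 1) → f x = 0) :
    LieGr G j →+ M :=
  MonoidHom.toAdditiveLeft (QuotientGroup.lift ((lcs G (j + 1)).subgroupOf (lcs G j))
    (MonoidHom.mk' (fun x => Multiplicative.ofAdd (f x)) hf : lcs G j →* Multiplicative M) h)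

theorem LieGr.lift_mk {G M : Type*} [Group G] [AddCommGroup M] {j : ℕ} (f : lcs G j → M)
    (hf : ∀ x y, f (x * y) = f x + f y) (h : ∀ x : lcs G j, x.1 ∈ lcs G (j + 1) → f x = 0)
    {x : G} (hx : x ∈ lcs G j) : LieGr.lift f hf h (LieGr.mk j x hx) = f ⟨x, hx⟩ := rfl

/-- The leading term of the Magnus expansion. -/
noncomputable def leadHom (j : ℕ) : LieGr (FreeGroup X) j →+ FreeAlgebra ℤ X :=
  LieGr.lift
    (fun w => PowerSeries.coeff (j + 1) ((magnus X w.1 : (MagnusRing X)ˣ) : MagnusRing X))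
    (by
      rintro ⟨w, hw⟩ ⟨w', hw'⟩
      obtain ⟨α, hα⟩ := exists_isLead_magnus X hw
      obtain ⟨β, hβ⟩ := exists_isLead_magnus X hw'
      have h := (hα.mul hβ).coeff_eq
      rw [← map_mul] at h
      exact h.trans (congrArg₂ (· + ·) hα.coeff_eq.symm hβ.coeff_eq.symm))
    (by
      rintro ⟨w, hw⟩ hw'
      obtain ⟨α, hα⟩ := exists_isLead_magnus X hw'
      exact hα.succ.coeff_eq)

theorem leadHom_mk {j : ℕ} {w : FreeGroup X} (hw : w ∈ lcs (FreeGroup X) j) {α : FreeAlgebra ℤ X}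
    (h : IsLead j (magnus X w) α) : leadHom X j (LieGr.mk j w hw) = α :=
  (LieGr.lift_mk _ _ _ hw).trans h.coeff_eq

/-- The map from the Lie ring of the free group to the free associative algebra. -/
noncomputable def magnusGr : GrLie (FreeGroup X) →+ FreeAlgebra ℤ X := GrLie.lift (leadHom X)

/-- The canonical morphism from the free Lie ring to the Lie ring of the free group. -/
noncomputable def freeToGr : FreeLieAlgebra ℤ X →ₗ⁅ℤ⁆ GrLie (FreeGroup X) :=
  FreeLieAlgebra.lift ℤ fun x => GrLie.cls 0 (FreeGroup.of x) (mem_lcs_zero _)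

theorem freeToGr_of (x : X) : freeToGr X (FreeLieAlgebra.of ℤ x) =
    GrLie.cls 0 (FreeGroup.of x) (mem_lcs_zero _) := FreeLieAlgebra.lift_of_apply _ _

/-- The iterated group commutator of the same letters represents the bracket, and the commutator
rule for leading terms computes its Magnus expansion. Hence `magnusGr` composed with `freeToGr` is
`lieToAssoc`. -/
theorem freeToGr_brk (l : List X) (x : X) : ∃ (w : FreeGroup X) (hw : w ∈ lcs (FreeGroup X) l.length),
    freeToGr X (brk (FreeLieAlgebra.of ℤ) l x) = GrLie.cls l.length w hw ∧
      IsLead l.length (magnus X w) (lieToAssoc ℤ X (brk (FreeLieAlgebra.of ℤ) l x)) := by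
  induction l with
  | nil =>
    refine ⟨FreeGroup.of x, mem_lcs_zero _, freeToGr_of X x, ?_⟩
    rw [brk_nil, lieToAssoc_of]
    exact isLead_magnus_of X x
  | cons a l ih =>
    obtain ⟨w, hw, h1, h2⟩ := ih
    have hm := commutator_lcs_le (FreeGroup X) 0 l.length
      (Subgroup.commutator_mem_commutator (mem_lcs_zero (FreeGroup.of a)) hw)
    have e : 0 + l.length + 1 = (a :: l).length := by rw [zero_add, List.length_cons]
    refine ⟨⁅FreeGroup.of a, w⁆, by rw [← e]; exact hm, ?_, ?_⟩
    · rw [brk_cons, LieHom.map_lie, h1, freeToGr_of, GrLie.lie_cls]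
      exact GrLie.cls_congr e rfl
    · have h3 := (isLead_magnus_of X a).commutator h2
      rw [← map_commutatorElement, e] at h3
      rwa [brk_cons, LieHom.map_lie, lieToAssoc_of, LieRing.of_associative_ring_bracket]

/-- Every ℤ-module structure on an abelian group is given by integer multiples. This reconciles the
scalar action on the free Lie algebra with the one that additive maps preserve. -/
theorem AddMonoidHom.eq_smul_int_of_eq {M N : Type*} [AddCommGroup M] (h : Module ℤ M)
    [AddCommGroup N] (f g : M →+ N) (r : ℤ) {u : M} (hu : f u = g u) :
    f (h.smul r u) = g (h.smul r u) := by
  rw [int_smul_eq_zsmul, map_zsmul, map_zsmul, hu]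

theorem magnusGr_freeToGr {m : ℕ} {u : FreeLieAlgebra ℤ X} (hu : u ∈ lieDeg ℤ X m) :
    magnusGr X (freeToGr X u) = lieToAssoc ℤ X u := by
  refine Submodule.span_induction
    (p := fun u _ => magnusGr X (freeToGr X u) = lieToAssoc ℤ X u) ?_ ?_ ?_ ?_ hu
  · rintro _ ⟨l, x, -, rfl⟩
    obtain ⟨w, hw, h1, h2⟩ := freeToGr_brk X l x
    rw [h1, ← leadHom_mk X hw h2]
    exact GrLie.lift_of _ _ _
  · simp
  · intro u v _ _ hu hv
    simp only [map_add, hu, hv]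
  · intro r u _ hu
    exact AddMonoidHom.eq_smul_int_of_eq _
      ((magnusGr X).comp (freeToGr X).toLinearMap.toAddMonoidHom)
      (lieToAssoc ℤ X).toLinearMap.toAddMonoidHom r hu

theorem exists_freeToGr_eq_cls_zero (w : FreeGroup X) :
    ∃ u ∈ lieDeg ℤ X 0, freeToGr X u = GrLie.cls 0 w (mem_lcs_zero w) := by
  induction w using FreeGroup.induction_on with
  | C1 => exact ⟨0, zero_mem _, by rw [map_zero]; exact (GrLie.cls_one 0).symm⟩
  | of x => exact ⟨FreeLieAlgebra.of ℤ x, Submodule.subset_span ⟨[], x, rfl, rfl⟩, freeToGr_of X x⟩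
  | inv_of x _ =>
    refine ⟨-FreeLieAlgebra.of ℤ x, neg_mem (Submodule.subset_span ⟨[], x, rfl, rfl⟩), ?_⟩
    rw [map_neg, freeToGr_of, neg_eq_iff_add_eq_zero, ← GrLie.cls_mul, ← GrLie.cls_one 0]
    exact GrLie.cls_congr rfl (by rw [mul_inv_cancel])
  | mul x y hx hy =>
    obtain ⟨u, hu, h1⟩ := hx
    obtain ⟨v, hv, h2⟩ := hy
    exact ⟨u + v, add_mem hu hv, by rw [map_add, h1, h2, ← GrLie.cls_mul]⟩

/-- Each term of the series is generated by commutators of the previous term with the whole group,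
and their classes are brackets with elements of degree one. Right-normed brackets are therefore
enough. -/
theorem exists_freeToGr_eq_cls {j : ℕ} {w : FreeGroup X} (hw : w ∈ lcs (FreeGroup X) j) :
    ∃ u ∈ lieDeg ℤ X j, freeToGr X u = GrLie.cls j w hw := by
  induction j generalizing w with
  | zero => exact exists_freeToGr_eq_cls_zero X w
  | succ j ih =>
    let S : Subgroup (FreeGroup X) :=
      { carrier := {w | ∃ (hw : w ∈ lcs (FreeGroup X) (j + 1)), ∃ u ∈ lieDeg ℤ X (j + 1),
          freeToGr X u = GrLie.cls (j + 1) w hw}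
        one_mem' := ⟨one_mem _, 0, zero_mem _, by rw [map_zero, GrLie.cls_one]⟩
        mul_mem' := by
          rintro x y ⟨hx, u, hu, h1⟩ ⟨hy, v, hv, h2⟩
          exact ⟨mul_mem hx hy, u + v, add_mem hu hv, by rw [map_add, h1, h2, ← GrLie.cls_mul]⟩
        inv_mem' := by
          rintro x ⟨hx, u, hu, h1⟩
          refine ⟨inv_mem hx, -u, neg_mem hu, ?_⟩
          rw [map_neg, h1, neg_eq_iff_add_eq_zero, ← GrLie.cls_mul hx (inv_mem hx),
            ← GrLie.cls_one (j + 1)]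
          exact GrLie.cls_congr rfl (by rw [mul_inv_cancel]) }
    suffices h : lcs (FreeGroup X) (j + 1) ≤ S from (h hw).2
    refine Subgroup.commutator_le.2 ?_
    intro a ha b _
    refine ⟨Subgroup.commutator_mem_commutator ha (Subgroup.mem_top b), ?_⟩
    obtain ⟨u, hu, h1⟩ := ih ha
    obtain ⟨v, hv, h2⟩ := exists_freeToGr_eq_cls_zero X b
    refine ⟨⁅u, v⁆, ?_, ?_⟩
    · rw [← lie_skew]
      exact neg_mem (lie_mem_lieDeg ℤ hv hu)
    · rw [LieHom.map_lie, h1, h2, GrLie.lie_cls]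
      rfl

/-! ### Elements that commute with the generators. -/

variable {X}

theorem exists_freeToGr_eq_sum (z : GrLie (FreeGroup X)) : ∃ (s : Finset ℕ)
    (u : ℕ → FreeLieAlgebra ℤ X), (∀ m, u m ∈ lieDeg ℤ X m) ∧ z = freeToGr X (∑ m ∈ s, u m) := by
  classical
  -- Finitely supported families can be added without comparing index sets.
  suffices h : ∃ u : ℕ →₀ FreeLieAlgebra ℤ X, (∀ m, u m ∈ lieDeg ℤ X m) ∧
      z = freeToGr X (u.sum fun _ v => v) by
    obtain ⟨u, hu, hz⟩ := h
    exact ⟨u.support, u, hu, hz⟩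
  induction z using GrLie.induction with
  | h0 => exact ⟨0, fun m => zero_mem _, by simp⟩
  | h1 j w hw =>
    obtain ⟨v, hv, h⟩ := exists_freeToGr_eq_cls X hw
    refine ⟨Finsupp.single j v, fun m => ?_, ?_⟩
    · rw [Finsupp.single_apply]
      split_ifs with e
      · rwa [← e]
      · exact zero_mem _
    · rw [Finsupp.sum_single_index rfl, h]
  | h2 z z' hz hz' =>
    obtain ⟨u, hu, rfl⟩ := hz
    obtain ⟨u', hu', rfl⟩ := hz'
    refine ⟨u + u', fun m => add_mem (hu m) (hu' m), ?_⟩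
    rw [Finsupp.sum_add_index' (fun _ => rfl) (fun _ _ _ => rfl), map_add]

/-- An element of the free algebra without constant term that commutes with two generators
is zero. -/
theorem FreeAlgebra.eq_zero_of_commute {R : Type*} [CommRing R] {a : FreeAlgebra R X} {x y : X}
    (hxy : x ≠ y) (hx : Commute (FreeAlgebra.ι R x) a) (hy : Commute (FreeAlgebra.ι R y) a)
    (h0 : (FreeAlgebra.equivMonoidAlgebraFreeMonoid a).coeff 1 = 0) : a = 0 := by
  set e := FreeAlgebra.equivMonoidAlgebraFreeMonoid (R := R) (X := X)
  -- If w occurs in a, then zw occurs in za = az, so zw ends in z.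
  have key : ∀ (z : X), Commute (FreeAlgebra.ι R z) a → ∀ w : FreeMonoid X, (e a).coeff w ≠ 0 →
      ∃ v, FreeMonoid.of z * w = v * FreeMonoid.of z := by
    intro z hz w hw
    by_contra hne
    push Not at hne
    have hi : e (FreeAlgebra.ι R z) = MonoidAlgebra.single (FreeMonoid.of z) 1 := by
      simp [e, FreeAlgebra.equivMonoidAlgebraFreeMonoid]
    have h1 := congrArg (fun b => (e b).coeff (FreeMonoid.of z * w)) hz.eq
    simp only [map_mul, hi] at h1
    rw [MonoidAlgebra.coeff_mul_single_of_forall_mul_ne _ _ (fun d hd => hne d hd.symm),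
      MonoidAlgebra.coeff_single_mul_eq_mul_coeff (m₂ := w) (by
        intro m' _
        exact mul_right_inj _), one_mul] at h1
    exact hw h1
  apply e.injective
  rw [map_zero]
  ext w
  by_contra hw
  replace hw : (e a).coeff w ≠ 0 := hw
  obtain ⟨v, hv⟩ := key x hx w hw
  obtain ⟨v', hv'⟩ := key y hy w hw
  have hw1 : w ≠ 1 := by
    rintro rfl
    exact hw h0
  obtain ⟨w', b, rfl⟩ : ∃ (w' : FreeMonoid X) (b : X), w = w' * FreeMonoid.of b := by
    rcases List.eq_nil_or_concat w.toList with h | ⟨l, b, h⟩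
    · exact absurd h hw1
    · exact ⟨FreeMonoid.ofList l, b, FreeMonoid.toList.injective (by simpa using h)⟩
  have hl : ∀ (z : X) (v : FreeMonoid X),
      FreeMonoid.of z * (w' * FreeMonoid.of b) = v * FreeMonoid.of z → b = z := by
    intro z v h
    rw [← mul_assoc] at h
    have h2 := congrArg (fun m : FreeMonoid X => m.toList.getLast?) h
    simp only [FreeMonoid.toList_mul, FreeMonoid.toList_of, List.getLast?_concat] at h2
    exact Option.some.inj h2
  -- The nonempty word w would end both in x and in y.
  exact hxy ((hl x v hv).symm.trans (hl y v' hv'))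

/-- Needed to exclude constants, which commute with everything. -/
theorem coeff_one_lieToAssoc {m : ℕ} {u : FreeLieAlgebra ℤ X} (hu : u ∈ lieDeg ℤ X m) :
    (FreeAlgebra.equivMonoidAlgebraFreeMonoid (lieToAssoc ℤ X u)).coeff 1 = 0 := by
  have hi : ∀ a : X, FreeAlgebra.equivMonoidAlgebraFreeMonoid (FreeAlgebra.ι ℤ a) =
      MonoidAlgebra.single (FreeMonoid.of a) 1 := by
    intro a
    simp [FreeAlgebra.equivMonoidAlgebraFreeMonoid]
  have h1 : ∀ (a : X) (d : FreeMonoid X), FreeMonoid.of a * d ≠ 1 := by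
    intro a d h
    have := congrArg FreeMonoid.length h
    simp at this
  have h2 : ∀ (a : X) (d : FreeMonoid X), d * FreeMonoid.of a ≠ 1 := by
    intro a d h
    have := congrArg FreeMonoid.length h
    simp at this
  refine Submodule.span_induction (p := fun u _ =>
    (FreeAlgebra.equivMonoidAlgebraFreeMonoid (lieToAssoc ℤ X u)).coeff 1 = 0) ?_ ?_ ?_ ?_ hu
  · rintro _ ⟨l, x, -, rfl⟩
    cases l with
    | nil =>
      rw [brk_nil, lieToAssoc_of, hi]
      have h3 := MonoidAlgebra.coeff_single_mul_of_forall_mul_ne (1 : ℤ) 1 (h1 x)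
      rwa [mul_one] at h3
    | cons a l =>
      rw [brk_cons, LieHom.map_lie, lieToAssoc_of, LieRing.of_associative_ring_bracket, map_sub,
        map_mul, map_mul, hi, MonoidAlgebra.coeff_sub, Finsupp.sub_apply,
        MonoidAlgebra.coeff_single_mul_of_forall_mul_ne _ _ (h1 a),
        MonoidAlgebra.coeff_mul_single_of_forall_mul_ne _ _ (h2 a), sub_zero]
  · simp
  · intro u v _ _ hu hv
    rw [map_add, map_add, MonoidAlgebra.coeff_add, Finsupp.add_apply, hu, hv, add_zero]
  · intro r u _ hu
    rw [map_smul, map_smul, MonoidAlgebra.coeff_smul, Finsupp.smul_apply, hu, smul_zero]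

/-- The associative image of a lift of `z` commutes with two generators and has no constant term, so
it is zero. By homogeneity each component of the lift has image zero, hence is itself zero in the
free Lie ring. -/
theorem GrLie.eq_zero_of_lie_of_eq_zero {z : GrLie (FreeGroup X)} {x y : X} (hxy : x ≠ y)
    (hz : ∀ a : X, ⁅GrLie.cls 0 (FreeGroup.of a) (mem_lcs_zero _), z⁆ = 0) : z = 0 := by
  obtain ⟨s, u, hu, rfl⟩ := exists_freeToGr_eq_sum z
  have hc : ∀ a, Commute (FreeAlgebra.ι ℤ a) (lieToAssoc ℤ X (∑ m ∈ s, u m)) := by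
    intro a
    have h1 : lieToAssoc ℤ X ⁅FreeLieAlgebra.of ℤ a, ∑ m ∈ s, u m⁆ = 0 := by
      have h2 := hz a
      rw [← freeToGr_of, ← LieHom.map_lie, lie_sum] at h2
      have h3 := congrArg (magnusGr X) h2
      rw [map_sum, map_sum, map_zero] at h3
      rw [lie_sum, map_sum, ← h3]
      exact Finset.sum_congr rfl fun m _ =>
        (magnusGr_freeToGr X (lie_of_mem_lieDeg ℤ a (hu m))).symm
    rw [LieHom.map_lie, lieToAssoc_of, LieRing.of_associative_ring_bracket, sub_eq_zero] at h1
    exact h1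
  have h0 := FreeAlgebra.eq_zero_of_commute hxy (hc x) (hc y) (by
    rw [map_sum, map_sum, MonoidAlgebra.coeff_sum, Finsupp.finsetSum_apply]
    exact Finset.sum_eq_zero fun m _ => coeff_one_lieToAssoc (hu m))
  rw [Finset.sum_eq_zero fun m hm => eq_zero_of_lieToAssoc_eq_zero m X (u m) (hu m)
    (lieToAssoc_eq_zero_of_sum ℤ hu h0 hm), map_zero]

end Magnus

/-! ## The Lie ring of a free group is generated by the classes of the generators -/

/-- Every element is the image under `freeToGr` of a combination of right-normed brackets of
generators. -/
theorem GrLie.freeGroup_induction {X : Type} {p : GrLie (FreeGroup X) → Prop} (h0 : p 0)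
    (hX : ∀ x, p (GrLie.cls 0 (FreeGroup.of x) (mem_lcs_zero _)))
    (hadd : ∀ u v, p u → p v → p (u + v)) (hneg : ∀ u, p u → p (-u))
    (hlie : ∀ u v, p u → p v → p ⁅u, v⁆) (z : GrLie (FreeGroup X)) : p z := by
  let S : AddSubgroup (GrLie (FreeGroup X)) :=
    { carrier := {z | p z}
      zero_mem' := h0
      add_mem' := fun {u v} => hadd u v
      neg_mem' := fun {u} => hneg u }
  obtain ⟨s, u, hu, rfl⟩ := exists_freeToGr_eq_sum z
  suffices h : freeToGr X (∑ m ∈ s, u m) ∈ S from h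
  rw [map_sum]
  refine sum_mem fun m _ => ?_
  refine Submodule.span_induction (p := fun u _ => freeToGr X u ∈ S) ?_ ?_ ?_ ?_ (hu m)
  · rintro _ ⟨l, x, -, rfl⟩
    induction l with
    | nil =>
      rw [brk_nil, freeToGr_of]
      exact hX x
    | cons a l ih =>
      rw [brk_cons, LieHom.map_lie, freeToGr_of]
      exact hlie _ _ (hX a) ih
  · rw [map_zero]; exact zero_mem S
  · intro u v _ _ hu hv
    rw [map_add]; exact add_mem hu hv
  · intro r u _ hu
    have e := int_smul_eq_zsmul inferInstance r u
    refine (congrArg (fun v => freeToGr X v ∈ S) e).mpr ?_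
    rw [map_zsmul]
    exact zsmul_mem hu r

theorem GrLie.cls_inv {G : Type*} [Group G] {j : ℕ} {x : G} (hx : x ∈ lcs G j) :
    GrLie.cls j x⁻¹ (inv_mem hx) = -GrLie.cls j x hx := by
  rw [eq_neg_iff_add_eq_zero, ← GrLie.cls_mul (inv_mem hx) hx, ← GrLie.cls_one j]
  exact GrLie.cls_congr rfl (by rw [inv_mul_cancel])

theorem GrLie.cls_eq_zero_of_eq_one {G : Type*} [Group G] {j : ℕ} {x : G} {hx : x ∈ lcs G j}
    (h : x = 1) : GrLie.cls j x hx = 0 := by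
  rw [← GrLie.cls_one j]
  exact GrLie.cls_congr rfl (by rw [h])

namespace DrinfeldKohno

/-! ## The elements `ξ_n` -/

theorem addStrand_genAux {n i j : ℕ} (hij : i < j) (hj : j < n) :
    BraidGroup.addStrand n (PureBraid.genAux n i j) = PureBraid.genAux (n + 1) i j := by
  induction j, hij using Nat.le_induction with
  | base =>
    rw [Nat.succ_eq_add_one, PureBraid.genAux_succ_self, PureBraid.genAux_succ_self, map_pow,
      PureBraid.addStrand_sigma hj]
  | succ j hij ih =>
    rw [PureBraid.genAux_succ n hij, PureBraid.genAux_succ (n + 1) hij, map_mul, map_mul, map_inv,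
      PureBraid.addStrand_sigma hj, ih (by omega)]

theorem addStrand_t {n : ℕ} {i j : Fin n} (h : i < j) :
    addStrand n (t n i j) = t (n + 1) i.castSucc j.castSucc := by
  rw [addStrand, t, GrLie.map_cls, t]
  refine GrLie.cls_congr rfl (congrArg _ (Subtype.ext ?_))
  rw [PureBraid.gen, if_pos h, PureBraid.gen, if_pos (Fin.castSucc_lt_castSucc_iff.2 h)]
  exact addStrand_genAux h j.2

theorem ofFree_X (n : ℕ) (i : Fin n) : ofFree n (X n i) = t (n + 1) i.castSucc (Fin.last n) := by
  rw [ofFree, X, GrLie.map_cls, t]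
  refine GrLie.cls_congr rfl (congrArg _ ?_)
  rw [PureBraid.ofFree, FreeGroup.lift_apply_of]

theorem xi_eq_sum (n : ℕ) : xi n = ∑ i, ∑ j, if i < j then t n i j else 0 := by
  rw [xi, Finset.sum_filter, Fintype.sum_prod_type]

theorem xi_succ (n : ℕ) :
    xi (n + 1) = ofFree n (boundary n) + addStrand n (xi n) := by
  have h1 : ∀ i : Fin (n + 1), ¬ Fin.last n < i := fun i => (Fin.le_last i).not_gt
  rw [xi_eq_sum, xi_eq_sum, boundary, Fin.sum_univ_castSucc]
  simp only [h1, if_false, Finset.sum_const_zero, add_zero, Fin.sum_univ_castSucc,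
    Fin.castSucc_lt_last, if_true, Finset.sum_add_distrib, map_sum, ofFree_X,
    Fin.castSucc_lt_castSucc_iff]
  refine (add_comm _ _).trans ?_
  congr 1
  refine Finset.sum_congr rfl fun i _ => Finset.sum_congr rfl fun j _ => ?_
  split_ifs with h
  · rw [addStrand_t h]
  · rw [map_zero]

theorem xi_one : xi 1 = 0 := by
  rw [xi_eq_sum]
  simp

/-! ## The Johnson morphism on the generators -/

/-- The generator `X_i`, with the convention `X_i = 0` if `i ≥ n`. -/
noncomputable def genX (n i : ℕ) : FreeLieRing n := if h : i < n then X n ⟨i, h⟩ else 0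

theorem genX_eq {n : ℕ} (i : Fin n) : genX n i = X n i := dif_pos i.2

/-- In degree one the conjugation in the Artin formula is invisible, and only the transposition
remains. -/
theorem map_artin_sigma_genX {n j : ℕ} (hj : j + 1 < n) (k : ℕ) :
    GrLie.map (BraidGroup.artin n (PureBraid.sigma n j)).toMonoidHom (genX n k) =
      genX n (PureBraid.stepN j k) := by
  have hmap : ∀ (k : ℕ) (hk : k < n),
      GrLie.map (BraidGroup.artin n (PureBraid.sigma n j)).toMonoidHom (genX n k) =
        GrLie.cls 0 (BraidGroup.artin n (PureBraid.sigma n j) (FreeGroup.of ⟨k, hk⟩))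
          (mem_lcs_zero _) := by
    intro k hk
    rw [genX, dif_pos hk]
    exact GrLie.map_cls _ _
  by_cases h1 : k = j
  · subst h1
    rw [hmap k (by omega), PureBraid.stepN, if_pos rfl, genX, dif_pos hj, X]
    exact GrLie.cls_congr rfl (by rw [PureBraid.artin_sigma_left hj])
  by_cases h2 : k = j + 1
  · subst h2
    rw [hmap _ hj, PureBraid.stepN, if_neg h1, if_pos rfl, genX, dif_pos (by omega), X]
    refine GrLie.cls_congr rfl ?_
    rw [PureBraid.artin_sigma_right hj, QuotientGroup.mk_mul, QuotientGroup.mk_mul,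
      (lcs_commute (k := 1) (mem_lcs_zero (FreeGroup.of (⟨j + 1, hj⟩ : Fin n))⁻¹)
        (mem_lcs_zero (FreeGroup.of (⟨j, by omega⟩ : Fin n))) le_rfl).eq, mul_assoc,
      QuotientGroup.mk_inv, inv_mul_cancel, mul_one]
  rw [PureBraid.stepN, if_neg h1, if_neg h2]
  by_cases hk : k < n
  · rw [hmap k hk, genX, dif_pos hk, X]
    exact GrLie.cls_congr rfl (by rw [PureBraid.artin_sigma_other _ h1 h2])
  · rw [genX, dif_neg hk, map_zero]

theorem tau_cls {n : ℕ} {i j : ℕ} {β : PureBraid n} {x : FreeGroup (Fin n)}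
    (hβ : β ∈ lcs (PureBraid n) i) (hx : x ∈ lcs (FreeGroup (Fin n)) j) :
    tau n (GrLie.cls i β hβ) (GrLie.cls j x hx) = GrLie.cls (i + j + 1)
      (PureBraid.artin n β x * x⁻¹) ((PureBraid.abTrivial_artin n).mem hβ hx) :=
  johnson_cls _ hβ hx

/-- The conjugate of a pure braid by a braid. -/
def conjPure {n : ℕ} (γ : BraidGroup n) (β : PureBraid n) : PureBraid n :=
  ⟨γ * β.1 * γ⁻¹, (inferInstance : (PureBraid n).Normal).conj_mem _ β.2 γ⟩

/-- Applying γ to (β·x)x⁻¹ gives the same expression for γβγ⁻¹ and γ·x. This equivariance carries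
the formula for A_{i,i+1} over to all A_{ij}. -/
theorem tau_conjPure {n : ℕ} (γ : BraidGroup n) (β : PureBraid n) (u : FreeLieRing n) :
    tau n (GrLie.cls 0 (conjPure γ β) (mem_lcs_zero _))
        (GrLie.map (BraidGroup.artin n γ).toMonoidHom u) =
      GrLie.map (BraidGroup.artin n γ).toMonoidHom
        (tau n (GrLie.cls 0 β (mem_lcs_zero _)) u) := by
  induction u using GrLie.induction with
  | h0 => simp
  | h2 u v hu hv => simp only [map_add, hu, hv]
  | h1 j x hx =>
    rw [GrLie.map_cls, tau_cls, tau_cls, GrLie.map_cls]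
    refine GrLie.cls_congr rfl (congrArg _ ?_)
    change BraidGroup.artin n (γ * β.1 * γ⁻¹) (BraidGroup.artin n γ x) *
      (BraidGroup.artin n γ x)⁻¹ = BraidGroup.artin n γ (BraidGroup.artin n β.1 x * x⁻¹)
    rw [← MulAut.mul_apply, ← map_mul, inv_mul_cancel_right, map_mul, MulAut.mul_apply, map_mul,
      map_inv]

/-- The pure braid `A_{ij}`, with natural numbers as indices. -/
def pureGen (n i j : ℕ) : PureBraid n := ⟨PureBraid.genAux n i j, PureBraid.genAux_mem n i j⟩

/-- The braid σ_i² conjugates x_i by x_{i+1}⁻¹, so (β·x_i)x_i⁻¹ is the commutator of x_{i+1}⁻¹ and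
x_i; the inverse gives the sign. -/
theorem tau_pureGen_succ_self {n i : ℕ} (hi : i + 1 < n) (k : ℕ) :
    tau n (GrLie.cls 0 (pureGen n i (i + 1)) (mem_lcs_zero _)) (genX n k) =
      -((if k = i then ⁅genX n (i + 1), genX n i⁆ else 0) +
        if k = i + 1 then ⁅genX n i, genX n (i + 1)⁆ else 0) := by
  have hA : ∀ x, PureBraid.artin n (pureGen n i (i + 1)) x =
      BraidGroup.artin n (PureBraid.sigma n i) (BraidGroup.artin n (PureBraid.sigma n i) x) := by
    intro x
    change BraidGroup.artin n (PureBraid.genAux n i (i + 1)) x = _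
    rw [PureBraid.genAux_succ_self, sq, map_mul, MulAut.mul_apply]
  have e0 : genX n i = GrLie.cls 0 (FreeGroup.of ⟨i, by omega⟩) (mem_lcs_zero _) :=
    dif_pos (by omega)
  have e1 : genX n (i + 1) = GrLie.cls 0 (FreeGroup.of ⟨i + 1, hi⟩) (mem_lcs_zero _) :=
    dif_pos hi
  by_cases h1 : k = i
  · subst h1
    rw [if_pos rfl, if_neg (by omega), add_zero, ← neg_lie, e0, e1, tau_cls, ← GrLie.cls_inv,
      GrLie.lie_cls]
    refine GrLie.cls_congr rfl (congrArg _ ?_)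
    rw [hA, PureBraid.artin_sigma_left hi, PureBraid.artin_sigma_right hi, inv_inv]
  by_cases h2 : k = i + 1
  · subst h2
    -- Here the element is the commutator of x_{i+1}⁻¹ and x_i⁻¹, so both entries of the bracket are
    -- given a sign.
    rw [if_neg h1, if_pos rfl, zero_add, lie_skew, ← neg_neg (genX n (i + 1)), neg_lie, ← lie_neg,
      e0, e1, neg_neg, tau_cls, ← GrLie.cls_inv, ← GrLie.cls_inv, GrLie.lie_cls]
    refine GrLie.cls_congr rfl (congrArg _ ?_)
    rw [hA, PureBraid.artin_sigma_right hi]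
    simp only [map_mul, map_inv, PureBraid.artin_sigma_right hi, PureBraid.artin_sigma_left hi,
      inv_inv, mul_inv_rev, mul_assoc, mul_inv_cancel, mul_one, mul_inv_cancel_left]
  rw [if_neg h1, if_neg h2, add_zero, neg_zero, genX]
  split_ifs with hk
  · rw [X, tau_cls]
    refine GrLie.cls_eq_zero_of_eq_one ?_
    rw [hA, PureBraid.artin_sigma_other _ h1 h2, PureBraid.artin_sigma_other _ h1 h2,
      mul_inv_cancel]
  · rw [map_zero]

theorem stepN_stepN (j k : ℕ) : PureBraid.stepN j (PureBraid.stepN j k) = k := by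
  unfold PureBraid.stepN
  split_ifs <;> omega

/-- Since A_{i,j+1} = σ_j A_{ij} σ_j⁻¹, equivariance transports the formula by the transposition of
j and j + 1. -/
theorem tau_pureGen {n i j : ℕ} (hij : i < j) (hj : j < n) (k : ℕ) :
    tau n (GrLie.cls 0 (pureGen n i j) (mem_lcs_zero _)) (genX n k) =
      -((if k = i then ⁅genX n j, genX n i⁆ else 0) +
        if k = j then ⁅genX n i, genX n j⁆ else 0) := by
  induction j, hij using Nat.le_induction generalizing k with
  | base => exact tau_pureGen_succ_self hj k
  | succ j hij ih =>
    have e : pureGen n i (j + 1) = conjPure (PureBraid.sigma n j) (pureGen n i j) :=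
      Subtype.ext (PureBraid.genAux_succ n hij)
    have e1 : GrLie.cls 0 (pureGen n i (j + 1)) (mem_lcs_zero _) =
        GrLie.cls 0 (conjPure (PureBraid.sigma n j) (pureGen n i j)) (mem_lcs_zero _) :=
      GrLie.cls_congr rfl (by rw [e])
    have s1 : PureBraid.stepN j i = i := by
      unfold PureBraid.stepN; split_ifs <;> omega
    have s2 : PureBraid.stepN j j = j + 1 := if_pos rfl
    have c1 : PureBraid.stepN j k = i ↔ k = i := by
      unfold PureBraid.stepN; split_ifs <;> omega
    have c2 : PureBraid.stepN j k = j ↔ k = j + 1 := by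
      unfold PureBraid.stepN; split_ifs <;> omega
    -- X_k is the image under σ_j of the generator with the transposed index, because `stepN j` is
    -- an involution.
    have h := tau_conjPure (PureBraid.sigma n j) (pureGen n i j) (genX n (PureBraid.stepN j k))
    rw [map_artin_sigma_genX hj, stepN_stepN, ih (by omega)] at h
    rw [e1, h, map_neg, map_add]
    simp only [c1, c2]
    congr 2
    · split_ifs
      · rw [LieHom.map_lie, map_artin_sigma_genX hj, map_artin_sigma_genX hj, s1, s2]
      · rw [map_zero]
    · split_ifs
      · rw [LieHom.map_lie, map_artin_sigma_genX hj, map_artin_sigma_genX hj, s1, s2]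
      · rw [map_zero]

theorem tau_t {n : ℕ} {i j : Fin n} (h : i < j) (k : Fin n) :
    tau n (t n i j) (X n k) = -((if k = i then ⁅X n j, X n k⁆ else 0) +
        if k = j then ⁅X n i, X n k⁆ else 0) := by
  have h1 := tau_pureGen h j.2 k
  have e : t n i j = GrLie.cls 0 (pureGen n i j) (mem_lcs_zero _) := by
    rw [t]
    refine GrLie.cls_congr rfl (congrArg _ ?_)
    rw [PureBraid.gen, if_pos h]
    rfl
  rw [← e] at h1
  simp only [genX_eq, ← Fin.ext_iff] at h1
  rw [h1]
  congr 2
  · split_ifs with h2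
    · rw [h2]
    · rfl
  · split_ifs with h2
    · rw [h2]
    · rfl

/-- Each j ≠ k contributes -[X_j, X_k] through the pair {j, k}, and the missing term j = k is zero
anyway. -/
theorem tau_xi_X (n : ℕ) (k : Fin n) : tau n (xi n) (X n k) = -⁅boundary n, X n k⁆ := by
  have h : ∀ i j : Fin n, tau n (if i < j then t n i j else 0) (X n k) =
      -((if k = i then (if k < j then ⁅X n j, X n k⁆ else 0) else 0) +
        if k = j then (if i < k then ⁅X n i, X n k⁆ else 0) else 0) := by
    intro i j
    by_cases h1 : i < j
    · rw [if_pos h1, tau_t h1]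
      congr 2
      · split_ifs with h2 h3
        · rfl
        · exact absurd (h2 ▸ h1) h3
        · rfl
      · split_ifs with h2 h3
        · rfl
        · exact absurd (h2 ▸ h1) h3
        · rfl
    · rw [if_neg h1, map_zero, LieDerivation.zero_apply]
      have h2 : ¬ (k = i ∧ k < j) := fun h => h1 (h.1 ▸ h.2)
      have h3 : ¬ (k = j ∧ i < k) := fun h => h1 (h.1 ▸ h.2)
      rw [← ite_and, ← ite_and, if_neg h2, if_neg h3, add_zero, neg_zero]
  have hs : ∀ {s : Finset (Fin n)} (f : Fin n → DrinfeldKohno n),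
      tau n (∑ i ∈ s, f i) (X n k) = ∑ i ∈ s, tau n (f i) (X n k) := by
    intro s f
    classical
    induction s using Finset.induction_on with
    | empty => rw [Finset.sum_empty, map_zero, LieDerivation.zero_apply, Finset.sum_empty]
    | insert a s ha ih =>
      rw [Finset.sum_insert ha, Finset.sum_insert ha, map_add, LieDerivation.add_apply, ih]
  rw [xi_eq_sum, hs]
  simp only [hs, h, Finset.sum_neg_distrib, Finset.sum_add_distrib]
  rw [boundary, sum_lie]
  congr 1
  have h1 : ∀ i : Fin n, (∑ j, if k = i then (if k < j then ⁅X n j, X n k⁆ else 0) else 0) =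
      if k = i then ∑ j, (if k < j then ⁅X n j, X n k⁆ else 0) else 0 := by
    intro i
    split_ifs
    · rfl
    · exact Finset.sum_const_zero
  simp only [h1, Finset.sum_ite_eq, Finset.mem_univ, if_true]
  rw [← Finset.sum_add_distrib]
  refine Finset.sum_congr rfl fun j _ => ?_
  rcases lt_trichotomy k j with hk | rfl | hk
  · rw [if_pos hk, if_neg hk.not_gt, add_zero]
  · rw [if_neg (lt_irrefl k), add_zero, lie_self]
  · rw [if_neg hk.not_gt, if_pos hk, zero_add]

/-- Two derivations that agree on generators of the Lie ring are equal. -/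
theorem tau_xi (n : ℕ) : tau n (xi n) = -LieDerivation.ad ℤ (FreeLieRing n) (boundary n) := by
  ext1 z
  induction z using GrLie.freeGroup_induction with
  | h0 => rw [map_zero, map_zero]
  | hX k =>
    rw [LieDerivation.neg_apply, LieDerivation.ad_apply_apply]
    exact tau_xi_X n k
  | hadd u v hu hv => rw [map_add, map_add, hu, hv]
  | hneg u hu => rw [map_neg, map_neg, hu]
  | hlie u v hu hv =>
    rw [LieDerivation.apply_lie_eq_add, LieDerivation.apply_lie_eq_add, hu, hv]

/-! ## Braid derivations kill the boundary element -/

/-- The product `x_0 ⋯ x_{m-1}`. -/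
def boundaryProd (n : ℕ) : ℕ → FreeGroup (Fin n)
  | 0 => 1
  | m + 1 => boundaryProd n m * if h : m < n then FreeGroup.of ⟨m, h⟩ else 1

/-- The product x_i x_{i+1} goes to x_{i+1} · x_{i+1}⁻¹ x_i x_{i+1}, so it is fixed. The length `m =
i + 1` is excluded because it cuts this pair. -/
theorem artin_sigma_boundaryProd {n i : ℕ} (hi : i + 1 < n) (m : ℕ) (hm : m ≤ i ∨ i + 2 ≤ m) :
    BraidGroup.artin n (PureBraid.sigma n i) (boundaryProd n m) = boundaryProd n m := by
  have step : ∀ m, m ≠ i → m ≠ i + 1 →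
      BraidGroup.artin n (PureBraid.sigma n i) (boundaryProd n m) = boundaryProd n m →
      BraidGroup.artin n (PureBraid.sigma n i) (boundaryProd n (m + 1)) =
        boundaryProd n (m + 1) := by
    intro m h1 h2 h
    rw [boundaryProd, map_mul, h]
    congr 1
    split_ifs
    · exact PureBraid.artin_sigma_other _ h1 h2
    · exact map_one _
  have h1 : ∀ m, m ≤ i →
      BraidGroup.artin n (PureBraid.sigma n i) (boundaryProd n m) = boundaryProd n m := by
    intro m hm
    induction m with
    | zero => exact map_one _
    | succ m ih => exact step m (by omega) (by omega) (ih (by omega))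
  rcases hm with hm | hm
  · exact h1 m hm
  · induction m, hm using Nat.le_induction with
    | base =>
      rw [boundaryProd, boundaryProd, map_mul, map_mul, h1 i le_rfl, dif_pos hi,
        dif_pos (by omega), PureBraid.artin_sigma_left hi, PureBraid.artin_sigma_right hi]
      simp only [mul_assoc, mul_inv_cancel_left]
    | succ m hm ih => exact step m (by omega) (by omega) ih

theorem artin_boundaryProd (n : ℕ) (β : BraidGroup n) :
    BraidGroup.artin n β (boundaryProd n n) = boundaryProd n n := by
  refine PureBraid.braid_induction ((MulAction.stabilizer (MulAut (FreeGroup (Fin n)))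
    (boundaryProd n n)).comap (BraidGroup.artin n)) ?_ β
  intro i hi
  exact artin_sigma_boundaryProd hi n (Or.inr (by omega))

theorem boundary_eq_cls (n : ℕ) :
    boundary n = GrLie.cls 0 (boundaryProd n n) (mem_lcs_zero _) := by
  have h : ∀ m ≤ n, GrLie.cls 0 (boundaryProd n m) (mem_lcs_zero _) =
      ∑ k ∈ Finset.range m, genX n k := by
    intro m hm
    induction m with
    | zero => rw [Finset.sum_range_zero]; exact GrLie.cls_one 0
    | succ m ih =>
      rw [Finset.sum_range_succ, ← ih (by omega), genX, dif_pos (by omega), X, ← GrLie.cls_mul]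
      refine GrLie.cls_congr rfl (congrArg _ ?_)
      rw [boundaryProd, dif_pos (by omega)]
  rw [h n le_rfl, Finset.sum_range, boundary]
  exact Finset.sum_congr rfl fun k _ => (genX_eq k).symm

/-- The boundary element is the class of x_0⋯x_{n-1}, which every braid fixes exactly, so (β·h)h⁻¹ =
1 in all degrees. -/
theorem tau_boundary (n : ℕ) (u : DrinfeldKohno n) : tau n u (boundary n) = 0 := by
  induction u using GrLie.induction with
  | h0 => rw [map_zero, LieDerivation.zero_apply]
  | h2 u v hu hv => rw [map_add, LieDerivation.add_apply, hu, hv, add_zero]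
  | h1 j β hβ =>
    rw [boundary_eq_cls, tau_cls]
    exact GrLie.cls_eq_zero_of_eq_one (mul_inv_eq_one.2 (artin_boundaryProd n β.1))

/-! ## The center -/

/-- `DK_{n+1} → DK_n`, induced by forgetting the last strand. -/
noncomputable def forget (n : ℕ) : DrinfeldKohno (n + 1) →ₗ⁅ℤ⁆ DrinfeldKohno n :=
  GrLie.map (PureBraid.forget n)

theorem exists_eq_mul (n : ℕ) : ∀ β, ∃ x γ, β = PureBraid.ofFree n x * PureBraid.addStrand n γ :=
  PureBraid.exists_eq_ofFree_mul_addStrand n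

theorem ofFree_injective (n : ℕ) : Function.Injective (ofFree n) :=
  GrLie.map_injective_of_almostDirect (PureBraid.abTrivial_artin n)
    (PureBraid.addStrand_conj_ofFree n) (exists_eq_mul n) (PureBraid.ofFree_injective n)
    (PureBraid.forget_ofFree n) (PureBraid.forget_addStrand n)

theorem exists_eq_ofFree_add (n : ℕ) (z : DrinfeldKohno (n + 1)) :
    ∃ w, z = ofFree n w + addStrand n (forget n z) :=
  GrLie.exists_eq_add_of_almostDirect (PureBraid.abTrivial_artin n)
    (PureBraid.addStrand_conj_ofFree n) (exists_eq_mul n)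
    (PureBraid.forget_ofFree n) (PureBraid.forget_addStrand n) z

theorem lie_addStrand_ofFree (n : ℕ) (u : DrinfeldKohno n) (v : FreeLieRing n) :
    ⁅addStrand n u, ofFree n v⁆ = ofFree n (tau n u v) :=
  GrLie.lie_map_map_of_almostDirect (PureBraid.abTrivial_artin n)
    (PureBraid.addStrand_conj_ofFree n) u v

theorem forget_addStrand (n : ℕ) (u : DrinfeldKohno n) : forget n (addStrand n u) = u := by
  rw [forget, addStrand, GrLie.map_map]
  induction u using GrLie.induction with
  | h0 => rw [map_zero]
  | h1 j x hx =>
    rw [GrLie.map_cls]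
    exact GrLie.cls_congr rfl (congrArg _ (PureBraid.forget_addStrand n x))
  | h2 u v hu hv => rw [map_add, hu, hv]

/-- With ξ_{n+1} = ∂_n + ξ_n and z = w + u, the brackets [∂_n, w] and [ξ_n, w] = τ(ξ_n)(w) cancel.
The bracket [∂_n, u] = -τ(u)(∂_n) is zero, and [ξ_n, u] is zero by induction. -/
theorem xi_lie (n : ℕ) (z : DrinfeldKohno n) : ⁅xi n, z⁆ = 0 := by
  induction n with
  | zero =>
    have h : xi 0 = 0 := by rw [xi_eq_sum]; simp
    rw [h, zero_lie]
  | succ n ih =>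
    obtain ⟨w, hw⟩ := exists_eq_ofFree_add n z
    rw [hw, xi_succ, add_lie, lie_add, lie_add, ← LieHom.map_lie, ← LieHom.map_lie, ih, map_zero,
      lie_addStrand_ofFree, ← lie_skew (ofFree n _) (addStrand n _), lie_addStrand_ofFree,
      tau_boundary, tau_xi, map_zero,
      neg_zero, add_zero, add_zero, LieDerivation.neg_apply, LieDerivation.ad_apply_apply, map_neg,
      add_neg_cancel]

theorem eq_zero_one (z : DrinfeldKohno 1) : z = 0 := by
  have h : ∀ β : BraidGroup 1, β ∈ (⊥ : Subgroup (BraidGroup 1)) :=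
    PureBraid.braid_induction _ (fun i hi => by omega)
  induction z using GrLie.induction with
  | h0 => rfl
  | h1 j x hx => exact GrLie.cls_eq_zero_of_eq_one (Subtype.ext (Subgroup.mem_bot.1 (h x.1)))
  | h2 u v hu hv => rw [hu, hv, add_zero]

theorem exists_eq_smul_X (z : FreeLieRing 1) : ∃ k : ℤ, z = k • X 1 0 := by
  induction z using GrLie.freeGroup_induction with
  | h0 => exact ⟨0, (zero_smul _ _).symm⟩
  | hX x =>
    obtain rfl : x = 0 := Subsingleton.elim _ _
    exact ⟨1, (one_smul _ _).symm⟩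
  | hadd u v hu hv =>
    obtain ⟨k, rfl⟩ := hu
    obtain ⟨l, rfl⟩ := hv
    exact ⟨k + l, (add_smul _ _ _).symm⟩
  | hneg u hu =>
    obtain ⟨k, rfl⟩ := hu
    exact ⟨-k, (neg_smul _ _).symm⟩
  | hlie u v hu hv =>
    obtain ⟨k, rfl⟩ := hu
    obtain ⟨l, rfl⟩ := hv
    exact ⟨0, by rw [smul_lie, lie_smul, lie_self, smul_zero, smul_zero, zero_smul]⟩

theorem exists_eq_smul_xi_of_central {n : ℕ} (hn : 1 ≤ n) {z : DrinfeldKohno n}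
    (hz : ∀ u : DrinfeldKohno n, ⁅u, z⁆ = 0) : ∃ k : ℤ, z = k • xi n := by
  induction n, hn using Nat.le_induction with
  | base => exact ⟨0, by rw [eq_zero_one z, zero_smul]⟩
  | succ n hn ih =>
    obtain ⟨w, hw⟩ := exists_eq_ofFree_add n z
    -- The forgetful morphism is surjective, with section `addStrand`, so it maps central elements
    -- to central elements.
    obtain ⟨k, hk⟩ := ih (z := forget n z) (fun u => by
      rw [← forget_addStrand n u, ← LieHom.map_lie, hz, map_zero])
    -- As ξ_{n+1} = ∂_n + ξ_n, subtracting kξ_{n+1} removes the DK_n-component and leaves an element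
    -- of the free Lie ring.
    have h1 : z = ofFree n (w - k • boundary n) + k • xi (n + 1) := by
      rw [hw, hk, xi_succ, map_sub, map_zsmul, map_zsmul, smul_add]
      abel
    have h2 : ∀ v : FreeLieRing n, ⁅v, w - k • boundary n⁆ = 0 := by
      intro v
      apply ofFree_injective n
      have h3 := hz (ofFree n v)
      rw [h1, lie_add, lie_smul, ← lie_skew _ (xi (n + 1)), xi_lie, neg_zero, smul_zero, add_zero]
        at h3
      rw [LieHom.map_lie, h3, map_zero]
    -- For n = 1 the free Lie ring is ℤX_1, which is not centerless, but there X_1 = t_12 = ξ_2.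
    rcases hn.eq_or_lt with rfl | hn
    · obtain ⟨l, hl⟩ := exists_eq_smul_X (w - k • boundary 1)
      have h3 : xi 2 = ofFree 1 (X 1 0) := by
        rw [xi_succ, xi_one, map_zero, add_zero, boundary, Fin.sum_univ_one]
      refine ⟨l + k, ?_⟩
      rw [h1, hl, map_zsmul, ← h3, add_smul]
    · have h3 : w - k • boundary n = 0 :=
        GrLie.eq_zero_of_lie_of_eq_zero (x := ⟨0, by omega⟩) (y := ⟨1, hn⟩)
          (fun h => by simpa using congrArg Fin.val h) (fun a => h2 _)
      exact ⟨k, by rw [h1, h3, map_zero, zero_add]⟩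

/-! ## The total linking number -/

/-- The abelianization `σ_i ↦ 1` of the braid group. -/
def exponentSum (n : ℕ) : BraidGroup n →* Multiplicative ℤ :=
  BraidGroup.lift (fun _ => Multiplicative.ofAdd 1) (fun _ _ _ => rfl) (fun _ _ _ => rfl)

theorem exponentSum_genAux {n i j : ℕ} (hij : i < j) (hj : j < n) :
    exponentSum n (PureBraid.genAux n i j) = Multiplicative.ofAdd 2 := by
  rw [PureBraid.genAux, map_mul, map_mul, map_inv, mul_comm, inv_mul_cancel_left, map_pow,
    PureBraid.sigma, dif_pos (by omega), exponentSum, BraidGroup.lift_of]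
  rfl

/-- The exponent sum on the degree-one part of `DK_n`. -/
noncomputable def exponentGr (n : ℕ) : DrinfeldKohno n →+ ℤ :=
  GrLie.lift fun
    | 0 => LieGr.lift (fun β => (exponentSum n β.1.1).toAdd) (fun β γ => by
        rw [Subgroup.coe_mul, Subgroup.coe_mul, map_mul, toAdd_mul]) (by
        have h : lcs (PureBraid n) 1 ≤ ((exponentSum n).comp (PureBraid n).subtype).ker := by
          refine Subgroup.commutator_le.2 ?_
          intro x _ y _
          rw [MonoidHom.mem_ker, map_commutatorElement, commutatorElement_eq_one_iff_commute]
          exact mul_comm _ _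
        intro β hβ
        exact congrArg Multiplicative.toAdd (h hβ))
    | _ + 1 => 0

theorem exponentGr_t {n : ℕ} {i j : Fin n} (h : i < j) : exponentGr n (t n i j) = 2 := by
  have e : exponentGr n (t n i j) = (exponentSum n (PureBraid.gen n i j).1).toAdd :=
    GrLie.lift_of _ _ _
  rw [e, PureBraid.gen, if_pos h, exponentSum_genAux h j.2]
  rfl

/-- The exponent sum of ξ_n is twice the number of pairs of strands, which is nonzero as soon as
there are two strands. -/
theorem smul_xi_injective {n : ℕ} (hn : 2 ≤ n) : Function.Injective fun k : ℤ => k • xi n := by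
  intro k l h
  have h1 := congrArg (exponentGr n) h
  have h2 : exponentGr n (xi n) ≠ 0 := by
    rw [xi, map_sum, Finset.sum_congr rfl
      (fun p hp => exponentGr_t (Finset.mem_filter.1 hp).2), Finset.sum_const]
    have hne : (Finset.univ.filter fun p : Fin n × Fin n => p.1 < p.2).card ≠ 0 :=
      Finset.card_ne_zero_of_mem (Finset.mem_filter.2
        ⟨Finset.mem_univ ((⟨0, by omega⟩, ⟨1, by omega⟩) : Fin n × Fin n), by simp⟩)
    simpa using hne
  simp only [map_zsmul, smul_eq_mul] at h1
  exact mul_right_cancel₀ h2 h1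

end DrinfeldKohno

theorem mainTheorem7 :
    DrinfeldKohno.xi 1 = 0 ∧
    (∀ n : ℕ, DrinfeldKohno.xi (n + 1) =
      DrinfeldKohno.ofFree n (DrinfeldKohno.boundary n) +
        DrinfeldKohno.addStrand n (DrinfeldKohno.xi n)) ∧
    ∀ n : ℕ, 1 ≤ n →
      (LieAlgebra.center ℤ (DrinfeldKohno n)).toSubmodule =
          Submodule.span ℤ {DrinfeldKohno.xi n} ∧
      (2 ≤ n → Function.Injective fun k : ℤ => k • DrinfeldKohno.xi n) ∧
      DrinfeldKohno.tau n (DrinfeldKohno.xi n) =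
        -LieDerivation.ad ℤ (FreeLieRing n) (DrinfeldKohno.boundary n) := by
  refine ⟨DrinfeldKohno.xi_one, DrinfeldKohno.xi_succ, fun n hn =>
    ⟨?_, DrinfeldKohno.smul_xi_injective, DrinfeldKohno.tau_xi n⟩⟩
  ext z
  rw [LieSubmodule.mem_toSubmodule, LieModule.mem_maxTrivSubmodule, Submodule.mem_span_singleton]
  constructor
  · intro hz
    obtain ⟨k, hk⟩ := DrinfeldKohno.exists_eq_smul_xi_of_central hn hz
    exact ⟨k, hk.symm⟩
  · rintro ⟨k, rfl⟩ u
    rw [lie_smul, ← lie_skew, DrinfeldKohno.xi_lie, neg_zero, smul_zero]
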